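/- Let $M$ be a smooth $n$-dimensional manifold and $\mathcal C$ a conical region of $TM\setminus\{0\}$: an open set such that each $\mathcal C_x=\mathcal C\cap T_xM$ is non-empty, connected and stable under multiplication by positive numbers. In local coordinates $(x^i,y^i)$ of $TM$ write $\partial_i=\partial/\partial x^i$, $\dot\partial_i=\partial/\partial y^i$ and $f_{.i}=\dot\partial_i f$. A spray on $\mathcal C$ is a smooth vector field ${\bf G}=y^i\partial_i-2G^i\dot\partial_i$ on $\mathcal C$ with $G^i(x,ty)=t^2G^i(x,y)$ for $t>0$; its Riemann curvature is $$R^i_{\ k}=2\partial_kG^i-y^j\partial_j\dot\partial_kG^i+2G^j\dot\partial_j\dot\partial_kG^i-(\dot\partial_jG^i)(\dot\partial_kG^j).$$ A Finsler metric on $\mathcal C$ is a smooth function $L$ on $\mathcal C$, positively homogeneous of degree two in $y$, with $g_{ij}=\frac12L_{.i.j}$ non-degenerate. It is regular if $\mathcal C=TM\setminus\{0\}$ and $(g_{ij})$ is positive definite, and a Riemann metric if it is a quadratic form (of any signature) on each tangent space. It induces the spray $G^i=\frac14g^{il}(y^k\partial_k\dot\partial_lL-\partial_lL)$, and it has (scalar)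 flag curvature $\lambda=\lambda(x,y)$ if $R^i_{\ k}=\lambda(L\delta^i_k-y^iy_k)$, where $y_k=\frac12L_{.k}$. Let ${\bf G}$ be a spray on $\mathcal C$ of scalar curvature, that is, $R^i_{\ k}=R\,\delta^i_k-\tau_ky^i$ with $R,\tau_k$ positively homogeneous in $y$. For a smooth 2-form $\omega=\omega_{ij}\,dx^i\wedge dx^j$ ($\omega_{ij}=-\omega_{ji}$) on $M$ consider the condition $$R_{.i}-2\tau_i=\omega_{ir}y^r.\qquad(*)$$ (i) Suppose that ${\bf G}$ is induced by a Finsler metric $L$ on $\mathcal C$ and satisfies $(*)$. (ia) If $n\ge3$ and $M$ is connected, then $L$ has constant flag curvature and $\omega=0$. (ib) If $n=2$, then $L$ has a flag curvature $\lambda$. If moreover $L=F^2>0$, then on each tangent space $$\lambda''(\theta)+\epsilon\,I(\theta)\,\lambda'(\theta)=0.$$ Here $\epsilon=\pm1$ is the sign of $g=\det(g_{ij})$; with $\ell_i=F_{.i}$, $(m^1,m^2)=(\epsilon g)^{-1/2}(-\ell_2,\ell_1)$ and $m_i=g_{ij}m^j$, the main scalar $I$ is defined by $\frac12F\,(g_{ij})_{.k}=I\,m_im_jm_k$,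 and the Landsberg angle $\theta$ is the function on $\mathcal C_x$, defined locally and up to an additive constant, with $F\theta_{.i}=m_i$; near each point of $\mathcal C_x$ such a $\theta$ exists and $\lambda$ and $I$ are smooth functions of it. Further, if $L$ is a Riemann metric or a regular Finsler metric, then $\lambda=\lambda(x)$ depends on $x$ only, and $\omega=0$. (ii) If $n=2$ and ${\bf G}$ is induced by a Finsler metric $L>0$ on $\mathcal C$ with constant main scalar ($I$ constant; up to sign, since $I$ changes its sign with the orientation of the coordinates), then ${\bf G}$ satisfies $(*)$ for some smooth 2-form $\omega$ on $M$. This $\omega$ need not vanish: on $M=\mathbb R^2$ there are a conical region and a Finsler metric $L>0$ on it with constant main scalar whose spray satisfies $(*)$ with some $\omega\neq0$. -/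

import Mathlib

open scoped Manifold ContDiff

noncomputable section

namespace SprayGeometry

/-- The model space of `n`-dimensional manifolds. -/
abbrev E (n : ℕ) : Type := EuclideanSpace ℝ (Fin n)

/-- Local coordinates `(x, y) = (x¹,…,xⁿ,y¹,…,yⁿ)` of a tangent bundle. -/
abbrev Coord (n : ℕ) : Type := E n × E n

/-- The standard basis vector `e_i`. -/
def e {n : ℕ} (i : Fin n) : E n := EuclideanSpace.single i 1

/-! ### Local formulas in the coordinates `(x, y)` -/

section Local

variable {n : ℕ}

/-- The partial derivative `∂f/∂xⁱ`. -/
def dx (i : Fin n) (f : Coord n → ℝ) (p : Coord n) : ℝ := fderiv ℝ f p (e i, 0)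

/-- The partial derivative `f_{.i} = ∂f/∂yⁱ`. -/
def dy (i : Fin n) (f : Coord n → ℝ) (p : Coord n) : ℝ := fderiv ℝ f p (0, e i)

/-- The Riemann curvature `Rⁱ_k` of a spray with local coefficients `Gⁱ`:
`2 ∂_k Gⁱ - yʲ ∂_j ∂̇_k Gⁱ + 2 Gʲ ∂̇_j ∂̇_k Gⁱ - (∂̇_j Gⁱ)(∂̇_k Gʲ)`. -/
def riemann (G : Coord n → E n) (i k : Fin n) (p : Coord n) : ℝ :=
  2 * dx k (fun q => G q i) p
    - ∑ j, p.2 j * dx j (dy k (fun q => G q i)) p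
    + 2 * ∑ j, G p j * dy j (dy k (fun q => G q i)) p
    - ∑ j, dy j (fun q => G q i) p * dy k (fun q => G q j) p

/-- The fundamental tensor `g_{ij} = (L/2)_{.i.j}`. -/
def fundTensor (L : Coord n → ℝ) (p : Coord n) : Matrix (Fin n) (Fin n) ℝ :=
  Matrix.of fun i j => (1 / 2) * dy i (dy j L) p

/-- `y_k = (L/2)_{.k}`. -/
def yLow (L : Coord n → ℝ) (k : Fin n) (p : Coord n) : ℝ := (1 / 2) * dy k L p

/-- The spray coefficients of `L`: `Gⁱ = ¼ gⁱˡ (L_{xᵏyˡ} yᵏ - L_{xˡ})`. -/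
def sprayCoeff (L : Coord n → ℝ) (p : Coord n) : E n :=
  WithLp.toLp 2 fun i => (1 / 4) * ∑ l, (fundTensor L p)⁻¹ i l *
    ((∑ k, dx k (dy l L) p * p.2 k) - dx l L p)

/-- The Cartan tensor `C_{ijk} = ½ (g_{ij})_{.k}`. -/
def cartan (L : Coord n → ℝ) (i j k : Fin n) (p : Coord n) : ℝ :=
  (1 / 2) * dy k (fun q => fundTensor L q i j) p

/-- `F = √L`, for `L > 0`. -/
def normF (L : Coord n → ℝ) (p : Coord n) : ℝ := Real.sqrt (L p)

/-- `ε`, the sign of `det (g_{ij})`. -/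
def epsSign (L : Coord n → ℝ) (p : Coord n) : ℝ := Real.sign (fundTensor L p).det

/-! In dimension two, for `L = F² > 0`: the Berwald frame, the main scalar, the Landsberg angle. -/

/-- `ℓ_i = F_{.i} = y_i / F`. -/
def ellLow (L : Coord 2 → ℝ) (i : Fin 2) (p : Coord 2) : ℝ := yLow L i p / normF L p

/-- `(m¹, m²) = (√(ε det g))⁻¹ (-ℓ₂, ℓ₁)`. -/
def mUp (L : Coord 2 → ℝ) (i : Fin 2) (p : Coord 2) : ℝ :=
  (Real.sqrt (epsSign L p * (fundTensor L p).det))⁻¹ * (![-ellLow L 1 p, ellLow L 0 p] i)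

/-- `m_i = g_{ij} mʲ`. -/
def mLow (L : Coord 2 → ℝ) (i : Fin 2) (p : Coord 2) : ℝ :=
  ∑ j, fundTensor L p i j * mUp L j p

/-- `s` is the value at `p` of the main scalar: `F C_{ijk} = s m_i m_j m_k`. -/
def IsMainScalarAt (L : Coord 2 → ℝ) (p : Coord 2) (s : ℝ) : Prop :=
  ∀ i j k, normF L p * cartan L i j k p = s * mLow L i p * mLow L j p * mLow L k p

/-- `θ` is a Landsberg angle on the set `U` of directions at the point `x`: `F θ_{.i} = m_i`. -/
structure IsLandsbergAngle (L : Coord 2 → ℝ) (x : E 2) (U : Set (E 2)) (θ : E 2 → ℝ) : Prop where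
  differentiable : DifferentiableOn ℝ θ U
  eq : ∀ y ∈ U, ∀ i, normF L (x, y) * fderiv ℝ θ y (e i) = mLow L i (x, y)

/-- On the open set `U` of directions at `x`, there is a Landsberg angle `θ`, and the function
`lam` and the main scalar are smooth functions `l(θ)` and `I(θ)` of it. -/
structure InLandsbergAngle (L lam : Coord 2 → ℝ) (x : E 2) (U : Set (E 2))
    (θ : E 2 → ℝ) (l I : ℝ → ℝ) : Prop where
  isOpen : IsOpen U
  angle : IsLandsbergAngle L x U θ
  smooth_l : ContDiffOn ℝ ∞ l (θ '' U)
  smooth_I : ContDiffOn ℝ ∞ I (θ '' U)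
  eq_l : ∀ y ∈ U, lam (x, y) = l (θ y)
  eq_I : ∀ y ∈ U, IsMainScalarAt L (x, y) (I (θ y))

end Local

/-! ### Objects on a manifold -/

section Global

variable {n : ℕ} {M : Type*} [TopologicalSpace M] [ChartedSpace (E n) M]

/-- The coordinate vector at `φ⁻¹(x)` with components `u` in the chart `φ`. -/
def vec (φ : OpenPartialHomeomorph M (E n)) (x u : E n) : TangentSpace (𝓡 n) (φ.symm x) :=
  mfderiv (𝓡 n) (𝓡 n) φ.symm x u

/-- The tangent vector with coordinates `(x, y)` in the chart `φ`. -/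
def lift (φ : OpenPartialHomeomorph M (E n)) (p : Coord n) : TangentBundle (𝓡 n) M :=
  ⟨φ.symm p.1, vec φ p.1 p.2⟩

variable (n M) in
/-- A conical region of `TM ∖ {0}`: an open set (openness is expressed in the coordinates of `TM`)
that meets every tangent space in a (non-empty, connected) region stable under multiplication by
positive numbers. -/
structure ConicalRegion where
  carrier : Set (TangentBundle (𝓡 n) M)
  isOpen : ∀ φ ∈ atlas (E n) M, IsOpen {p : Coord n | p.1 ∈ φ.target ∧ lift φ p ∈ carrier}
  ne_zero : ∀ v ∈ carrier, v.2 ≠ 0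
  cone : ∀ v ∈ carrier, ∀ t : ℝ, 0 < t → (⟨v.1, t • v.2⟩ : TangentBundle (𝓡 n) M) ∈ carrier
  fibre : ∀ x : M, IsConnected
    {y : TangentSpace (𝓡 n) x | (⟨x, y⟩ : TangentBundle (𝓡 n) M) ∈ carrier}

/-- The coordinates, in the chart `φ`, of the vectors in the conical region. -/
def ConicalRegion.coords (C : ConicalRegion n M) (φ : OpenPartialHomeomorph M (E n)) :
    Set (Coord n) :=
  {p | p.1 ∈ φ.target ∧ lift φ p ∈ C.carrier}

/-- A spray on a conical region: in each chart, smooth coefficients `Gⁱ(x, y)`, positively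
homogeneous of degree two in `y`, such that `yⁱ ∂/∂xⁱ - 2 Gⁱ ∂/∂yⁱ` is one and the same vector field
in all the charts. The last field is the transformation law of the coefficients under the change of
coordinates `T = ψ ∘ φ⁻¹`, `G̃ = DT (G) - ½ D²T (y, y)`. -/
structure Spray (C : ConicalRegion n M) where
  coeff : OpenPartialHomeomorph M (E n) → Coord n → E n
  smooth : ∀ φ ∈ atlas (E n) M, ContDiffOn ℝ ∞ (coeff φ) (C.coords φ)
  homogeneous : ∀ φ ∈ atlas (E n) M, ∀ p ∈ C.coords φ, ∀ t : ℝ, 0 < t →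
    coeff φ (p.1, t • p.2) = t ^ 2 • coeff φ p
  compatible : ∀ φ ∈ atlas (E n) M, ∀ ψ ∈ atlas (E n) M, ∀ p ∈ C.coords φ,
    φ.symm p.1 ∈ ψ.source →
      coeff ψ (ψ (φ.symm p.1), fderiv ℝ (ψ ∘ φ.symm) p.1 p.2) =
        fderiv ℝ (ψ ∘ φ.symm) p.1 (coeff φ p)
          - (1 / 2 : ℝ) • fderiv ℝ (fderiv ℝ (ψ ∘ φ.symm)) p.1 p.2 p.2

/-- A Finsler metric on a conical region: a smooth function `L`, positively homogeneous of degree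
two, with non-degenerate fundamental tensor (no sign or definiteness is required). -/
structure FinslerMetric (C : ConicalRegion n M) where
  toFun : TangentBundle (𝓡 n) M → ℝ
  smooth : ∀ φ ∈ atlas (E n) M, ContDiffOn ℝ ∞ (fun p => toFun (lift φ p)) (C.coords φ)
  homogeneous : ∀ v ∈ C.carrier, ∀ t : ℝ, 0 < t → toFun ⟨v.1, t • v.2⟩ = t ^ 2 * toFun v
  nondegenerate : ∀ φ ∈ atlas (E n) M, ∀ p ∈ C.coords φ,
    (fundTensor (fun q => toFun (lift φ q)) p).det ≠ 0

/-- The expression of `L` in the chart `φ`. -/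
def FinslerMetric.loc {C : ConicalRegion n M} (L : FinslerMetric C)
    (φ : OpenPartialHomeomorph M (E n)) (p : Coord n) : ℝ := L.toFun (lift φ p)

/-- `L > 0`. -/
def FinslerMetric.IsPositive {C : ConicalRegion n M} (L : FinslerMetric C) : Prop :=
  ∀ v ∈ C.carrier, 0 < L.toFun v

/-- `L` is regular: defined on all of `TM ∖ {0}`, with positive definite fundamental tensor. -/
def FinslerMetric.IsRegular {C : ConicalRegion n M} (L : FinslerMetric C) : Prop :=
  C.carrier = {v | v.2 ≠ 0} ∧
    ∀ φ ∈ atlas (E n) M, ∀ p ∈ C.coords φ, (fundTensor (L.loc φ) p).PosDef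

/-- `L` is a Riemann metric: a quadratic form on each tangent space (of any signature). -/
def FinslerMetric.IsRiemannian {C : ConicalRegion n M} (L : FinslerMetric C) : Prop :=
  ∃ h : (x : M) → TangentSpace (𝓡 n) x →L[ℝ] TangentSpace (𝓡 n) x →L[ℝ] ℝ,
    (∀ x u w, h x u w = h x w u) ∧ ∀ v ∈ C.carrier, L.toFun v = h v.1 v.2 v.2

/-- The spray `G` is induced by `L`. -/
def Spray.IsInducedBy {C : ConicalRegion n M} (G : Spray C) (L : FinslerMetric C) : Prop :=
  ∀ φ ∈ atlas (E n) M, ∀ p ∈ C.coords φ, G.coeff φ p = sprayCoeff (L.loc φ) p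

/-- `L` is of scalar flag curvature `K`: `Rⁱ_k = K (L δⁱ_k - yⁱ y_k)`, where `Rⁱ_k` is the Riemann
curvature of the spray of `L`. -/
def FinslerMetric.HasFlagCurvature {C : ConicalRegion n M} (L : FinslerMetric C)
    (K : TangentBundle (𝓡 n) M → ℝ) : Prop :=
  ∀ φ ∈ atlas (E n) M, ∀ p ∈ C.coords φ, ∀ i k,
    riemann (sprayCoeff (L.loc φ)) i k p =
      K (lift φ p) * (L.loc φ p * (if i = k then 1 else 0) - p.2 i * yLow (L.loc φ) k p)

/-- A (not necessarily smooth) covector field `τ_k(x, y)` along the projection `TM → M`. -/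
abbrev SprayCovector (n : ℕ) (M : Type*) [TopologicalSpace M] [ChartedSpace (E n) M] : Type _ :=
  (v : TangentBundle (𝓡 n) M) → TangentSpace (𝓡 n) v.1 →L[ℝ] ℝ

/-- The spray `G` is of scalar curvature `Rⁱ_k = R δⁱ_k - τ_k yⁱ`, with `R` and `τ` positively
homogeneous (of the only possible degrees, two and one). -/
structure Spray.IsOfScalarCurvature {C : ConicalRegion n M} (G : Spray C)
    (R : TangentBundle (𝓡 n) M → ℝ) (τ : SprayCovector n M) : Prop where
  homogeneous_R : ∀ v ∈ C.carrier, ∀ t : ℝ, 0 < t → R ⟨v.1, t • v.2⟩ = t ^ 2 * R v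
  homogeneous_τ : ∀ v ∈ C.carrier, ∀ t : ℝ, 0 < t → ∀ u : TangentSpace (𝓡 n) v.1,
    τ ⟨v.1, t • v.2⟩ u = t * τ v u
  eq : ∀ φ ∈ atlas (E n) M, ∀ p ∈ C.coords φ, ∀ i k,
    riemann (G.coeff φ) i k p =
      R (lift φ p) * (if i = k then 1 else 0) - τ (lift φ p) (vec φ p.1 (e k)) * p.2 i

variable (n M) in
/-- A smooth 2-form on `M`. -/
structure TwoForm where
  toFun : (x : M) → TangentSpace (𝓡 n) x [⋀^Fin 2]→L[ℝ] ℝ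
  smooth : ∀ φ ∈ atlas (E n) M, ∀ u w : E n,
    ContDiffOn ℝ ∞ (fun x => toFun (φ.symm x) ![vec φ x u, vec φ x w]) φ.target

/-- `ω = 0`. -/
def TwoForm.IsZero (Ω : TwoForm n M) : Prop := ∀ x, Ω.toFun x = 0

/-- The condition `R_{.i} - 2 τ_i = ω_{i0}`, where `ω_{i0} = ω_{ir} yʳ`. -/
def WeakIsotropy (C : ConicalRegion n M) (R : TangentBundle (𝓡 n) M → ℝ) (τ : SprayCovector n M)
    (Ω : TwoForm n M) : Prop :=
  ∀ φ ∈ atlas (E n) M, ∀ p ∈ C.coords φ, ∀ i,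
    dy i (fun q => R (lift φ q)) p - 2 * τ (lift φ p) (vec φ p.1 (e i)) =
      Ω.toFun (φ.symm p.1) ![vec φ p.1 (e i), vec φ p.1 p.2]

end Global

/-- `L > 0` is of constant main scalar. The main scalar changes its sign with the orientation of the
coordinates, hence it is only required to be constant up to sign. -/
def FinslerMetric.HasConstantMainScalar {M : Type*} [TopologicalSpace M] [ChartedSpace (E 2) M]
    {C : ConicalRegion 2 M} (L : FinslerMetric C) : Prop :=
  ∃ c : ℝ, ∀ φ ∈ atlas (E 2) M, ∀ p ∈ C.coords φ,
    IsMainScalarAt (L.loc φ) p c ∨ IsMainScalarAt (L.loc φ) p (-c)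

end SprayGeometry

end

open SprayGeometry

namespace SprayGeometry

/-! ### Sprays in a ring with coordinate derivations -/

/-! Everything rests on brackets of vector fields in the coordinates (x, y). Let S be the spray,
N^j_i = ∂̇_i G^j and H_i = ∂_i - N^j_i ∂̇_j. Then [∂̇_i, S] = H_i - N^j_i ∂̇_j and [S, H_i] = N^j_i
H_j + R^j_i ∂̇_j. The spray of a metric satisfies S L = 0 and H_i L = 0, so the second bracket
applied to L gives R^j_i L_{.j} = 0. For scalar curvature this reads R L_{.i} = 2 τ_i L, whence R =
λL and τ_i = λ y_i with λ smooth, also across the zeros of L (`IsLocalScalar.exists_flag`).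
Condition (*) becomes L λ_{.i} = ω_{ir} y^r with ω a function of x alone, and everything in (i) is
drawn from this equation.

If n ≥ 3, antisymmetrizing its y-derivative gives 2ω_{ij} = L_{.j} λ_{.i} - L_{.i} λ_{.j}.
Multiplying by L, differentiating again and contracting with the inverse metric leaves (n - 2)
ω_{ir} y^r = 0 (`form_contract`). So ω = 0, λ depends on x only, and the Jacobi identity for three
horizontal fields makes λ locally constant (Schur).

If n = 2 and L > 0, the equation says that ε √|g| λ'(θ) = -ω_{12} is constant on each tangent space.
As (√|g|)' = ε I √|g|, one more derivative is the differential equation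
(`IsLocalForm.landsberg_ode`). For a regular metric λ has a critical point on the circle of
directions, which forces ω_{12} = 0. For a Riemann metric R is quadratic in y, so τ is linear in y;
the symmetry of τ_i L_{.j} then forces the symmetry of τ_{i.j}, hence ω = 0.

For (ii), let V = F m^i ∂̇_i and H = F m^i H_i. The Jacobi identity for V, S, H gives V λ = -I λ
when I is constant (`CoordFrame.IsMetricSpray.berwald_flag`), while V √|g| = I √|g|. Thus I λ √|g|
depends on x only and is the required form. The example is exp(2x¹x²)(y¹)³/y². If x¹x² were replaced
by a sum f(x¹) + h(x²), a change of each coordinate would remove the exponential; the product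
prevents this.

The bracket calculus is carried out in an abstract algebra with commuting derivations, `CoordFrame`,
later realized by smooth functions on an open set, `SmoothRing`. Local results are glued through
fibre derivatives, which involve no chart. -/

/-- A commutative algebra with elements `xⁱ`, `yⁱ` and commuting derivations `∂/∂xⁱ`, `∂/∂yⁱ`. -/
structure CoordFrame (n : ℕ) (A : Type*) [CommRing A] [Algebra ℝ A] where
  px : Fin n → Derivation ℝ A A
  py : Fin n → Derivation ℝ A A
  x : Fin n → A
  y : Fin n → A
  px_px : ∀ i j, ⁅px i, px j⁆ = 0
  px_py : ∀ i j, ⁅px i, py j⁆ = 0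
  py_py : ∀ i j, ⁅py i, py j⁆ = 0
  px_x : ∀ i j, px i (x j) = if i = j then 1 else 0
  py_x : ∀ i j, py i (x j) = 0
  px_y : ∀ i j, px i (y j) = 0
  py_y : ∀ i j, py i (y j) = if i = j then 1 else 0

section Algebra

variable {A : Type*} [CommRing A] [Algebra ℝ A]

lemma derivation_lie_smul (D D' : Derivation ℝ A A) (a : A) :
    ⁅D, a • D'⁆ = D a • D' + a • ⁅D, D'⁆ := by
  ext f
  simp only [Derivation.commutator_apply, Derivation.smul_apply, Derivation.add_apply,
    smul_eq_mul, Derivation.leibniz]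
  ring

lemma derivation_smul_lie (D D' : Derivation ℝ A A) (a : A) :
    ⁅a • D, D'⁆ = a • ⁅D, D'⁆ - D' a • D := by
  rw [← lie_skew, derivation_lie_smul, ← lie_skew D' D, smul_neg]
  abel

lemma derivation_sum_apply {ι : Type*} (s : Finset ι) (D : ι → Derivation ℝ A A) (f : A) :
    (∑ i ∈ s, D i) f = ∑ i ∈ s, D i f := by
  rw [← Derivation.coeFnAddMonoidHom_apply, map_sum, Finset.sum_apply]
  rfl

/-- Derivations kill the numerals. -/
lemma derivation_two (D : Derivation ℝ A A) : D (2 : A) = 0 := by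
  simpa using D.map_natCast 2

lemma eq_zero_of_two_mul {a : A} (h : 2 * a = 0) : a = 0 := by
  have h2 : (algebraMap ℝ A (1 / 2)) * 2 = 1 := by
    rw [← map_ofNat (algebraMap ℝ A) 2, ← map_mul]
    norm_num
  calc a = (algebraMap ℝ A (1 / 2)) * (2 * a) := by rw [← mul_assoc, h2, one_mul]
    _ = 0 := by rw [h, mul_zero]

lemma eq_of_two_mul {a b : A} (h : 2 * a = 2 * b) : a = b :=
  sub_eq_zero.1 (eq_zero_of_two_mul (by rw [mul_sub, h, sub_self]))

namespace CoordFrame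

variable {n : ℕ} (Φ : CoordFrame n A)

lemma py_px_apply (i j : Fin n) (f : A) : Φ.py i (Φ.px j f) = Φ.px j (Φ.py i f) := by
  have := congrArg (fun D => D f) (Φ.px_py j i)
  rw [Derivation.commutator_apply] at this
  exact (sub_eq_zero.1 this).symm

lemma py_py_apply (i j : Fin n) (f : A) : Φ.py i (Φ.py j f) = Φ.py j (Φ.py i f) := by
  have := congrArg (fun D => D f) (Φ.py_py i j)
  simpa [Derivation.commutator_apply, sub_eq_zero] using this

lemma py_px (i j : Fin n) : ⁅Φ.py i, Φ.px j⁆ = 0 := by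
  rw [← lie_skew, Φ.px_py, neg_zero]

/-- The Euler field `yⁱ ∂/∂yⁱ`. -/
def euler : Derivation ℝ A A := ∑ i, Φ.y i • Φ.py i

/-- The spray `yⁱ ∂/∂xⁱ - 2 Gⁱ ∂/∂yⁱ`. -/
def spray (G : Fin n → A) : Derivation ℝ A A :=
  ∑ i, Φ.y i • Φ.px i - (2 : A) • ∑ i, G i • Φ.py i

/-- The horizontal field `∂/∂xⁱ - Nʲᵢ ∂/∂yʲ`, where `Nʲᵢ = ∂Gʲ/∂yⁱ`. -/
def hor (G : Fin n → A) (i : Fin n) : Derivation ℝ A A :=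
  Φ.px i - ∑ j, Φ.py i (G j) • Φ.py j

/-- The Riemann curvature of a spray. -/
def riem (G : Fin n → A) (i k : Fin n) : A :=
  2 * Φ.px k (G i) - ∑ j, Φ.y j * Φ.px j (Φ.py k (G i))
    + 2 * ∑ j, G j * Φ.py j (Φ.py k (G i)) - ∑ j, Φ.py j (G i) * Φ.py k (G j)

lemma euler_apply (f : A) : Φ.euler f = ∑ i, Φ.y i * Φ.py i f := by
  simp [euler, derivation_sum_apply]

lemma spray_apply (G : Fin n → A) (f : A) :
    Φ.spray G f = ∑ i, Φ.y i * Φ.px i f - 2 * ∑ i, G i * Φ.py i f := by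
  simp [spray, derivation_sum_apply]

lemma hor_apply (G : Fin n → A) (i : Fin n) (f : A) :
    Φ.hor G i f = Φ.px i f - ∑ j, Φ.py i (G j) * Φ.py j f := by
  simp [hor, derivation_sum_apply]

lemma riem_eq (G : Fin n → A) (i k : Fin n) :
    Φ.riem G i k = 2 * Φ.px k (G i) - Φ.spray G (Φ.py k (G i))
      - ∑ j, Φ.py j (G i) * Φ.py k (G j) := by
  rw [riem, spray_apply]
  ring

lemma lie_py_euler (k : Fin n) : ⁅Φ.py k, Φ.euler⁆ = Φ.py k := by
  simp [euler, lie_sum, Φ.py_py, Φ.py_y]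

lemma lie_py_spray (G : Fin n → A) (k : Fin n) :
    ⁅Φ.py k, Φ.spray G⁆ = Φ.hor G k - ∑ j, Φ.py k (G j) • Φ.py j := by
  simp only [spray, hor, lie_sub, lie_sum, derivation_lie_smul, Φ.py_py, Φ.py_px, Φ.py_y,
    derivation_two, smul_zero, add_zero, zero_smul, zero_add, ite_smul, one_smul,
    Finset.sum_ite_eq, Finset.mem_univ, if_true]
  rw [two_smul]
  abel

lemma lie_py_hor (G : Fin n → A) (j i : Fin n) :
    ⁅Φ.py j, Φ.hor G i⁆ = -∑ k, Φ.py j (Φ.py i (G k)) • Φ.py k := by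
  simp only [hor, lie_sub, lie_sum, derivation_lie_smul, Φ.py_py, Φ.py_px, smul_zero, add_zero,
    zero_sub]

lemma lie_px_spray (G : Fin n → A) (k : Fin n) :
    ⁅Φ.px k, Φ.spray G⁆ = -((2 : A) • ∑ j, Φ.px k (G j) • Φ.py j) := by
  simp only [spray, lie_sub, lie_sum, derivation_lie_smul, Φ.px_px, Φ.px_py, Φ.px_y,
    derivation_two, smul_zero, add_zero, zero_smul, zero_add, Finset.sum_const_zero, zero_sub]

/-- The curvature is the vertical part of this bracket. Applied to `L`, or combined with the Berwald
frame of a surface, the identity yields the constraints that a metric puts on its curvature. -/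
lemma lie_spray_hor (G : Fin n → A) (i : Fin n) :
    ⁅Φ.spray G, Φ.hor G i⁆ =
      ∑ j, Φ.py i (G j) • Φ.hor G j + ∑ j, Φ.riem G j i • Φ.py j := by
  have h1 : ⁅Φ.spray G, Φ.px i⁆ = (2 : A) • ∑ j, Φ.px i (G j) • Φ.py j := by
    rw [← lie_skew, lie_px_spray, neg_neg]
  have h2 : ∀ j, ⁅Φ.spray G, Φ.py j⁆ = -Φ.hor G j + ∑ k, Φ.py j (G k) • Φ.py k := fun j => by
    rw [← lie_skew, lie_py_spray]; abel
  rw [hor, lie_sub, h1, lie_sum]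
  simp only [derivation_lie_smul, h2, riem_eq, smul_add, smul_neg, Finset.sum_add_distrib,
    sub_smul, Finset.sum_sub_distrib, Finset.sum_neg_distrib, Finset.smul_sum, Finset.sum_smul,
    smul_smul]
  rw [Finset.sum_comm (f := fun j k => (Φ.py i (G j) * Φ.py j (G k)) • Φ.py k)]
  simp only [mul_comm (Φ.py i (G _))]
  abel

/-- `Rⁱ_k yᵏ = 0`, when the `Gⁱ` are homogeneous of degree two. -/
lemma sum_riem_mul_y {G : Fin n → A} (hG : ∀ i, Φ.euler (G i) = 2 * G i) (i : Fin n) :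
    ∑ k, Φ.riem G i k * Φ.y k = 0 := by
  have e1 : ∀ f : A, ∑ k, Φ.px k f * Φ.y k = ∑ k, Φ.y k * Φ.px k f := fun f =>
    Finset.sum_congr rfl fun k _ => mul_comm _ _
  have e2 : ∀ f : A, ∑ k, Φ.py k f * Φ.y k = Φ.euler f := fun f => by
    rw [euler_apply]; exact Finset.sum_congr rfl fun k _ => mul_comm _ _
  have e3 : ∑ k, (∑ j, Φ.y j * Φ.px j (Φ.py k (G i))) * Φ.y k
      = 2 * ∑ j, Φ.y j * Φ.px j (G i) := by
    simp only [Finset.sum_mul]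
    rw [Finset.sum_comm, Finset.mul_sum]
    refine Finset.sum_congr rfl fun j _ => ?_
    have := congrArg (Φ.px j) (hG i)
    rw [euler_apply, map_sum] at this
    simp only [Derivation.leibniz, Φ.px_y, derivation_two, smul_eq_mul, mul_zero, add_zero] at this
    calc ∑ k, Φ.y j * Φ.px j (Φ.py k (G i)) * Φ.y k
        = Φ.y j * ∑ k, Φ.y k * Φ.px j (Φ.py k (G i)) := by
          rw [Finset.mul_sum]; exact Finset.sum_congr rfl fun k _ => by ring
      _ = _ := by rw [this]; ring
  have e4 : ∑ k, (∑ j, G j * Φ.py j (Φ.py k (G i))) * Φ.y k = ∑ j, Φ.py j (G i) * G j := by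
    simp only [Finset.sum_mul]
    rw [Finset.sum_comm]
    refine Finset.sum_congr rfl fun j _ => ?_
    have := congrArg (Φ.py j) (hG i)
    have h2 := congrArg (fun D => D (G i)) (Φ.lie_py_euler j)
    rw [Derivation.commutator_apply, this, euler_apply] at h2
    simp only [Derivation.leibniz, derivation_two, smul_eq_mul, mul_zero, add_zero] at h2
    calc ∑ k, G j * Φ.py j (Φ.py k (G i)) * Φ.y k
        = G j * ∑ k, Φ.y k * Φ.py k (Φ.py j (G i)) := by
          rw [Finset.mul_sum]
          exact Finset.sum_congr rfl fun k _ => by rw [Φ.py_py_apply j k]; ring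
      _ = _ := by linear_combination (-G j) * h2
  have e5 : ∑ k, (∑ j, Φ.py j (G i) * Φ.py k (G j)) * Φ.y k = 2 * ∑ j, Φ.py j (G i) * G j := by
    simp only [Finset.sum_mul]
    rw [Finset.sum_comm, Finset.mul_sum]
    refine Finset.sum_congr rfl fun j _ => ?_
    simp only [mul_assoc]
    rw [← Finset.mul_sum, e2, hG]
    ring
  have : ∑ k, Φ.riem G i k * Φ.y k = 2 * ∑ k, Φ.px k (G i) * Φ.y k
      - ∑ k, (∑ j, Φ.y j * Φ.px j (Φ.py k (G i))) * Φ.y k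
      + 2 * ∑ k, (∑ j, G j * Φ.py j (Φ.py k (G i))) * Φ.y k
      - ∑ k, (∑ j, Φ.py j (G i) * Φ.py k (G j)) * Φ.y k := by
    rw [Finset.mul_sum, Finset.mul_sum, ← Finset.sum_sub_distrib, ← Finset.sum_add_distrib,
      ← Finset.sum_sub_distrib]
    exact Finset.sum_congr rfl fun k _ => by rw [riem]; ring
  rw [this, e1, e3, e4, e5]
  ring

/-! #### Sprays of metrics -/

/-- `L` is homogeneous of degree two and its Euler–Lagrange equations are those of the spray `G`. -/
structure IsMetricSpray (G : Fin n → A) (L : A) : Prop where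
  euler_L : Φ.euler L = 2 * L
  lagrange : ∀ l, 2 * ∑ i, G i * Φ.py i (Φ.py l L) = ∑ k, Φ.y k * Φ.px k (Φ.py l L) - Φ.px l L

namespace IsMetricSpray

variable {Φ} {G : Fin n → A} {L : A}

lemma euler_py (h : Φ.IsMetricSpray G L) (i : Fin n) : Φ.euler (Φ.py i L) = Φ.py i L := by
  have h2 := congrArg (fun D => D L) (Φ.lie_py_euler i)
  rw [Derivation.commutator_apply, h.euler_L] at h2
  simp only [Derivation.leibniz, derivation_two, smul_eq_mul, mul_zero, add_zero] at h2
  linear_combination -h2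

lemma euler_py_py (h : Φ.IsMetricSpray G L) (i j : Fin n) : Φ.euler (Φ.py i (Φ.py j L)) = 0 := by
  have h2 := congrArg (fun D => D (Φ.py j L)) (Φ.lie_py_euler i)
  rw [Derivation.commutator_apply, h.euler_py] at h2
  linear_combination -h2

lemma sum_y_mul_py_py (h : Φ.IsMetricSpray G L)
    (i : Fin n) : ∑ j, Φ.y j * Φ.py i (Φ.py j L) = Φ.py i L := by
  rw [← h.euler_py i, euler_apply]
  exact Finset.sum_congr rfl fun j _ => by rw [Φ.py_py_apply]

/-- Conservation of energy: contract the Euler–Lagrange equations with y^l and use the homogeneity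
of `L` and of its derivatives. -/
lemma spray_L (h : Φ.IsMetricSpray G L) : Φ.spray G L = 0 := by
  have e1 : ∑ l, Φ.y l * (2 * ∑ i, G i * Φ.py i (Φ.py l L)) = 2 * ∑ i, G i * Φ.py i L := by
    simp only [Finset.mul_sum]
    rw [Finset.sum_comm]
    refine Finset.sum_congr rfl fun i _ => ?_
    conv_rhs => rw [← h.sum_y_mul_py_py i, Finset.mul_sum, Finset.mul_sum]
    exact Finset.sum_congr rfl fun l _ => by ring
  have e2 : ∑ l, Φ.y l * ∑ k, Φ.y k * Φ.px k (Φ.py l L) = 2 * ∑ k, Φ.y k * Φ.px k L := by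
    simp only [Finset.mul_sum]
    rw [Finset.sum_comm]
    refine Finset.sum_congr rfl fun k _ => ?_
    have := congrArg (Φ.px k) h.euler_L
    rw [euler_apply, map_sum] at this
    simp only [Derivation.leibniz, Φ.px_y, derivation_two, smul_eq_mul, mul_zero, add_zero] at this
    calc ∑ l, Φ.y l * (Φ.y k * Φ.px k (Φ.py l L))
        = Φ.y k * ∑ l, Φ.y l * Φ.px k (Φ.py l L) := by
          rw [Finset.mul_sum]; exact Finset.sum_congr rfl fun k _ => by ring
      _ = _ := by rw [this]; ring
  rw [spray_apply, ← e1]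
  simp only [h.lagrange, mul_sub, Finset.sum_sub_distrib]
  rw [e2]
  ring

lemma spray_py (h : Φ.IsMetricSpray G L) (l : Fin n) : Φ.spray G (Φ.py l L) = Φ.px l L := by
  rw [spray_apply, h.lagrange]
  ring

/-- Since S L = 0 and S(L_{.l}) = ∂_l L, the bracket [∂̇_l, S] sends L to -∂_l L. It also sends L to
H_l L - N^j_l L_{.j}, and comparing the two gives 2 H_l L = 0. -/
lemma hor_L (h : Φ.IsMetricSpray G L) (l : Fin n) : Φ.hor G l L = 0 := by
  have h2 := congrArg (fun D => D L) (Φ.lie_py_spray G l)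
  rw [Derivation.commutator_apply, h.spray_L, h.spray_py, Derivation.sub_apply,
    derivation_sum_apply] at h2
  simp only [Derivation.smul_apply, smul_eq_mul, map_zero] at h2
  refine eq_zero_of_two_mul ?_
  have h3 := Φ.hor_apply G l L
  linear_combination -h2 + h3

lemma px_L (h : Φ.IsMetricSpray G L) (l : Fin n) : Φ.px l L = ∑ j, Φ.py l (G j) * Φ.py j L := by
  have := Φ.hor_apply G l L
  rw [h.hor_L] at this
  linear_combination -this

lemma spray_py' (h : Φ.IsMetricSpray G L)
    (l : Fin n) : Φ.spray G (Φ.py l L) = ∑ j, Φ.py l (G j) * Φ.py j L := by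
  rw [h.spray_py, h.px_L]

/-- Apply `lie_spray_hor` to `L`: both S and the H_i kill `L`, so only the curvature term is left.
-/
lemma sum_riem_mul_py (h : Φ.IsMetricSpray G L)
    (i : Fin n) : ∑ j, Φ.riem G j i * Φ.py j L = 0 := by
  have h2 := congrArg (fun D => D L) (Φ.lie_spray_hor G i)
  simp only [Derivation.commutator_apply, h.spray_L, h.hor_L, Derivation.add_apply,
    derivation_sum_apply, Derivation.smul_apply, smul_eq_mul, map_zero, mul_zero,
    Finset.sum_const_zero, zero_add, sub_self] at h2
  exact h2.symm

/-- The right-hand side is symmetric in i and j; this symmetry removes the unwanted terms of the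
Jacobi identity in Schur's lemma. -/
lemma hor_py (h : Φ.IsMetricSpray G L) (j i : Fin n) :
    Φ.hor G j (Φ.py i L) = ∑ k, Φ.py i (Φ.py j (G k)) * Φ.py k L := by
  have h2 := congrArg (fun D => D L) (Φ.lie_py_hor G i j)
  simp only [Derivation.commutator_apply, h.hor_L, Derivation.neg_apply, derivation_sum_apply,
    Derivation.smul_apply, smul_eq_mul, map_zero, zero_sub] at h2
  exact neg_inj.1 h2

/-- The Hessian of `L` is parallel along the geodesics for the connection N. The second derivatives
of G produced by [∂̇_j, S] cancel by `hor_py`. -/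
lemma spray_py_py (h : Φ.IsMetricSpray G L) (i j : Fin n) : Φ.spray G (Φ.py j (Φ.py i L)) =
    ∑ k, Φ.py i (G k) * Φ.py j (Φ.py k L) + ∑ k, Φ.py j (G k) * Φ.py i (Φ.py k L) := by
  have h2 := congrArg (fun D => D (Φ.py i L)) (Φ.lie_py_spray G j)
  rw [Derivation.commutator_apply, h.spray_py', Derivation.sub_apply, h.hor_py,
    derivation_sum_apply, map_sum] at h2
  simp only [Derivation.leibniz, Derivation.smul_apply, smul_eq_mul,
    Finset.sum_add_distrib] at h2
  have e1 : ∑ k, Φ.py k L * Φ.py j (Φ.py i (G k)) = ∑ k, Φ.py i (Φ.py j (G k)) * Φ.py k L :=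
    Finset.sum_congr rfl fun k _ => by rw [Φ.py_py_apply j i]; ring
  have e2 : ∑ k, Φ.py j (G k) * Φ.py k (Φ.py i L) = ∑ k, Φ.py j (G k) * Φ.py i (Φ.py k L) :=
    Finset.sum_congr rfl fun k _ => by rw [Φ.py_py_apply k i]
  linear_combination -h2 + e1 + e2

end IsMetricSpray

end CoordFrame

end Algebra

/-! ### Curvature of the horizontal distribution, Schur's lemma, and the algebra of the 2-form -/

section Algebra

variable {A : Type*} [CommRing A] [Algebra ℝ A]

lemma eq_of_three_mul {a b : A} (h : 3 * a = 3 * b) : a = b := by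
  have h2 : (algebraMap ℝ A (1 / 3)) * 3 = 1 := by
    rw [← map_ofNat (algebraMap ℝ A) 3, ← map_mul]
    norm_num
  calc a = (algebraMap ℝ A (1 / 3)) * (3 * a) := by rw [← mul_assoc, h2, one_mul]
    _ = (algebraMap ℝ A (1 / 3)) * (3 * b) := by rw [h]
    _ = b := by rw [← mul_assoc, h2, one_mul]

namespace CoordFrame

variable {n : ℕ} (Φ : CoordFrame n A)

/-- The coefficients of the curvature `[δ_k, δ_j]` of the horizontal distribution. -/
def horCurv (G : Fin n → A) (l k j : Fin n) : A :=
  Φ.hor G j (Φ.py k (G l)) - Φ.hor G k (Φ.py j (G l))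

lemma lie_hor_py (G : Fin n → A) (i j : Fin n) :
    ⁅Φ.hor G i, Φ.py j⁆ = ∑ k, Φ.py j (Φ.py i (G k)) • Φ.py k := by
  rw [← lie_skew, lie_py_hor, neg_neg]

lemma lie_hor_py_comm (G : Fin n → A) (i j : Fin n) :
    ⁅Φ.hor G i, Φ.py j⁆ = ⁅Φ.hor G j, Φ.py i⁆ := by
  simp only [lie_hor_py, Φ.py_py_apply i j]

lemma lie_hor_px (G : Fin n → A) (k j : Fin n) :
    ⁅Φ.hor G k, Φ.px j⁆ = ∑ i, Φ.px j (Φ.py k (G i)) • Φ.py i := by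
  rw [← lie_skew]
  simp only [hor, lie_sub, lie_sum, derivation_lie_smul, Φ.px_py, Φ.px_px, smul_zero, add_zero,
    zero_sub, neg_neg]

lemma lie_hor_hor (G : Fin n → A) (k j : Fin n) :
    ⁅Φ.hor G k, Φ.hor G j⁆ = ∑ l, Φ.horCurv G l k j • Φ.py l := by
  conv_lhs => rw [hor.eq_1 Φ G j, lie_sub, lie_hor_px, lie_sum]
  simp only [derivation_lie_smul, lie_hor_py, horCurv, sub_smul, Finset.sum_add_distrib,
    Finset.sum_sub_distrib, Finset.smul_sum, smul_smul]
  conv_rhs => enter [1, 2, l, 1]; rw [hor_apply]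
  simp only [sub_smul, Finset.sum_sub_distrib, Finset.sum_smul]
  rw [Finset.sum_comm (f := fun i l => (Φ.py j (G i) * Φ.py i (Φ.py k (G l))) • Φ.py l)]
  abel

/-- Antisymmetrizing the vertical derivative of the Riemann curvature recovers the bracket of
horizontal fields. Two of the three copies come from the term 2∂_k G, the third from moving ∂̇_k
past S. -/
lemma py_riem_sub_py_riem (G : Fin n → A) (l k j : Fin n) :
    Φ.py k (Φ.riem G l j) - Φ.py j (Φ.riem G l k) = 3 * Φ.horCurv G l k j := by
  -- After ∂̇_k has been moved past S, the second-order term S(∂̇_k ∂̇_j G) is symmetric in k, j and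
  -- drops out of the difference.
  have key : ∀ k j, Φ.py k (Φ.riem G l j) = 2 * Φ.px j (Φ.py k (G l))
      - Φ.hor G k (Φ.py j (G l)) + ∑ i, Φ.py k (G i) * Φ.py i (Φ.py j (G l))
      - Φ.spray G (Φ.py k (Φ.py j (G l)))
      - ∑ i, Φ.py j (G i) * Φ.py k (Φ.py i (G l))
      - ∑ i, Φ.py i (G l) * Φ.py k (Φ.py j (G i)) := fun k j => by
    have h2 := congrArg (fun D => D (Φ.py j (G l))) (Φ.lie_py_spray G k)
    simp only [Derivation.commutator_apply, Derivation.sub_apply, derivation_sum_apply,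
      Derivation.smul_apply, smul_eq_mul] at h2
    rw [riem_eq, map_sub, map_sub, map_sum]
    simp only [Derivation.leibniz, derivation_two, smul_eq_mul, mul_zero, add_zero,
      Φ.py_px_apply, Finset.sum_add_distrib]
    linear_combination -h2
  have e : ∀ k j, ∑ i, Φ.py k (G i) * Φ.py i (Φ.py j (G l))
      = ∑ i, Φ.py k (G i) * Φ.py j (Φ.py i (G l)) := fun k j =>
    Finset.sum_congr rfl fun i _ => by rw [Φ.py_py_apply i j]
  have e' : ∑ i, Φ.py i (G l) * Φ.py k (Φ.py j (G i))
      = ∑ i, Φ.py i (G l) * Φ.py j (Φ.py k (G i)) :=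
    Finset.sum_congr rfl fun i _ => by rw [Φ.py_py_apply k j]
  have a1 := Φ.hor_apply G j (Φ.py k (G l))
  have a2 := Φ.hor_apply G k (Φ.py j (G l))
  have b1 := e k j
  have b2 := e j k
  rw [key k j, key j k, horCurv, Φ.py_py_apply k j (G l)]
  linear_combination -e' + 2 * a2 - 2 * a1 - b1 + b2

/-- The spray is horizontal, because y^i N^j_i = 2G^j by homogeneity. -/
lemma euler_eq_sum_hor {G : Fin n → A} (hG : ∀ i, Φ.euler (G i) = 2 * G i) :
    Φ.spray G = ∑ i, Φ.y i • Φ.hor G i := by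
  simp only [spray, hor, smul_sub, Finset.smul_sum, smul_smul, Finset.sum_sub_distrib]
  rw [Finset.sum_comm (f := fun i j => (Φ.y i * Φ.py i (G j)) • Φ.py j)]
  simp only [← Finset.sum_smul, ← euler_apply, hG]

/-! #### Schur's lemma -/

/-- The first step of Schur's lemma: the curvature of a metric whose flag curvature does not depend
on the direction. -/
lemma two_smul_lie_hor_hor {G : Fin n → A} {L lam : A} (hlam : ∀ i, Φ.py i lam = 0)
    (hR : ∀ i k, 2 * Φ.riem G i k
      = lam * (2 * L * (if i = k then 1 else 0) - Φ.y i * Φ.py k L)) (k j : Fin n) :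
    (2 : A) • ⁅Φ.hor G k, Φ.hor G j⁆ =
      lam • (Φ.py k L • Φ.py j - Φ.py j L • Φ.py k) := by
  -- Antisymmetrization removes y^l L_{.k.j}, and each L_{.k} δ term appears 2 + 1 times, matching
  -- the factor 3 in `py_riem_sub_py_riem`.
  have hc : ∀ l, 2 * Φ.horCurv G l k j = lam * (Φ.py k L * (if l = j then 1 else 0)
      - Φ.py j L * (if l = k then 1 else 0)) := fun l => by
    have d : ∀ k j : Fin n, 2 * Φ.py k (Φ.riem G l j) = lam * (2 * Φ.py k L *
        (if l = j then 1 else 0) - (if l = k then 1 else 0) * Φ.py j L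
        - Φ.y l * Φ.py k (Φ.py j L)) := fun k j => by
      have := congrArg (Φ.py k) (hR l j)
      have h0 : Φ.py k (if l = j then (1 : A) else 0) = 0 := by split_ifs <;> simp
      simp only [Derivation.leibniz, derivation_two, map_sub, h0, hlam, Φ.py_y, smul_eq_mul,
        mul_zero, add_zero, zero_add, eq_comm (a := k)] at this
      rw [this]
      ring
    have d1 := d k j
    have d2 := d j k
    have e := Φ.py_riem_sub_py_riem G l k j
    have e2 := Φ.py_py_apply k j L
    apply eq_of_three_mul
    linear_combination d1 - d2 - 2 * e - lam * Φ.y l * e2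
  rw [lie_hor_hor, Finset.smul_sum]
  simp only [smul_smul, hc, mul_sub, sub_smul, Finset.sum_sub_distrib, smul_sub]
  simp [mul_smul]

namespace IsMetricSpray

variable {Φ} {G : Fin n → A} {L : A}

/-- In the Jacobi identity for H_m, H_k, H_j the terms H_a L_{.b} and [H_a, ∂̇_b] are symmetric in
a, b and cancel in pairs. What remains is the cyclic sum of ∂_m λ (L_{.k} ∂̇_j - L_{.j} ∂̇_k), which
is evaluated on y^j. -/
lemma px_mul_py_comm (h : Φ.IsMetricSpray G L) {lam : A} (hlam : ∀ i, Φ.py i lam = 0)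
    (hR : ∀ i k, 2 * Φ.riem G i k
      = lam * (2 * L * (if i = k then 1 else 0) - Φ.y i * Φ.py k L))
    {m k j : Fin n} (hmj : m ≠ j) (hkj : k ≠ j) :
    Φ.px m lam * Φ.py k L = Φ.px k lam * Φ.py m L := by
  have hh : ∀ m, Φ.hor G m lam = Φ.px m lam := fun m => by simp [hor_apply, hlam]
  have key : ∀ m k j, (2 : A) • ⁅Φ.hor G m, ⁅Φ.hor G k, Φ.hor G j⁆⁆ =
      Φ.px m lam • (Φ.py k L • Φ.py j - Φ.py j L • Φ.py k)
      + lam • (Φ.hor G m (Φ.py k L) • Φ.py j + Φ.py k L • ⁅Φ.hor G m, Φ.py j⁆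
        - Φ.hor G m (Φ.py j L) • Φ.py k - Φ.py j L • ⁅Φ.hor G m, Φ.py k⁆) := fun m k j => by
    have := derivation_lie_smul (Φ.hor G m) ⁅Φ.hor G k, Φ.hor G j⁆ 2
    rw [derivation_two, zero_smul, zero_add] at this
    rw [← this, two_smul_lie_hor_hor Φ hlam hR, derivation_lie_smul, hh, lie_sub,
      derivation_lie_smul, derivation_lie_smul]
    congr 2
    abel
  have J := congrArg (fun D => (2 : A) • D) (lie_jacobi (Φ.hor G m) (Φ.hor G k) (Φ.hor G j))
  simp only [smul_add, key, smul_zero] at J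
  have c : ∀ a b, Φ.hor G a (Φ.py b L) = Φ.hor G b (Φ.py a L) := fun a b => by
    rw [h.hor_py, h.hor_py]
    simp only [Φ.py_py_apply a b]
  rw [c j m, c j k, c k m, Φ.lie_hor_py_comm G j m, Φ.lie_hor_py_comm G j k,
    Φ.lie_hor_py_comm G k m] at J
  have J' := congrArg (fun D => D (Φ.y j)) J
  simp only [Derivation.add_apply, Derivation.sub_apply, Derivation.smul_apply, smul_eq_mul,
    Φ.py_y, hmj, hkj, if_true, if_false, Derivation.zero_apply] at J'
  linear_combination J'

/-- Schur's lemma. -/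
lemma px_eq_zero (h : Φ.IsMetricSpray G L) (hn : 3 ≤ n)
    (hnd : ∀ f : Fin n → A, (∀ l, ∑ i, f i * Φ.py i (Φ.py l L) = 0) → f = 0)
    {lam : A} (hlam : ∀ i, Φ.py i lam = 0)
    (hR : ∀ i k, 2 * Φ.riem G i k
      = lam * (2 * L * (if i = k then 1 else 0) - Φ.y i * Φ.py k L)) (m : Fin n) :
    Φ.px m lam = 0 := by
  have hne : ∃ k j : Fin n, m ≠ k ∧ m ≠ j ∧ k ≠ j := by
    obtain ⟨k, hk, hm⟩ := Fin.exists_ne_and_ne_of_two_lt m m (by omega)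
    obtain ⟨j, hj, hm'⟩ := Fin.exists_ne_and_ne_of_two_lt m k (by omega)
    exact ⟨k, j, hk.symm, hj.symm, hm'.symm⟩
  obtain ⟨k, j, hmk, hmj, hkj⟩ := hne
  have e := h.px_mul_py_comm hlam hR hmj hkj
  -- A further y-derivative turns the relation into a linear dependence between rows k and m of the
  -- Hessian, which non-degeneracy makes trivial.
  have e2 : ∀ l, Φ.px m lam * Φ.py k (Φ.py l L) = Φ.px k lam * Φ.py m (Φ.py l L) := fun l => by
    have := congrArg (Φ.py l) e
    simp only [Derivation.leibniz, smul_eq_mul, Φ.py_px_apply, hlam, map_zero, mul_zero,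
      add_zero] at this
    rw [Φ.py_py_apply k l, Φ.py_py_apply m l, this]
  have := hnd (fun i => if i = k then Φ.px m lam else if i = m then -Φ.px k lam else 0) fun l => by
    rw [Finset.sum_eq_add k m (Ne.symm hmk)]
    · simp [hmk, e2]
    · intro c _ hc
      simp [hc.1, hc.2]
    · simp
    · simp
  simpa using congrFun this k

/-! #### Scalar curvature -/

/-- This is R^j_i L_{.j} = 0 for a curvature of the scalar form, with y^j L_{.j} = 2L. -/
lemma scalar_mul_py (h : Φ.IsMetricSpray G L) {R : A} {τ : Fin n → A}
    (hR : ∀ i k, Φ.riem G i k = R * (if i = k then 1 else 0) - τ k * Φ.y i) (i : Fin n) :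
    R * Φ.py i L = 2 * τ i * L := by
  have := h.sum_riem_mul_py i
  simp only [hR, sub_mul, Finset.sum_sub_distrib, mul_assoc, ← Finset.mul_sum] at this
  rw [← Φ.euler_apply, h.euler_L] at this
  simp only [ite_mul, one_mul, zero_mul, Finset.sum_ite_eq', Finset.mem_univ, if_true] at this
  linear_combination this

/-- Needed at the zeros of `L`, where the undifferentiated relation says nothing about τ. -/
lemma scalar_mul_py_py (h : Φ.IsMetricSpray G L) {R : A} {τ : Fin n → A}
    (hR : ∀ i k, Φ.riem G i k = R * (if i = k then 1 else 0) - τ k * Φ.y i) (i j : Fin n) :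
    Φ.py j R * Φ.py i L + R * Φ.py j (Φ.py i L) = 2 * Φ.py j (τ i) * L + 2 * τ i * Φ.py j L := by
  have := congrArg (Φ.py j) (h.scalar_mul_py hR i)
  simp only [Derivation.leibniz, smul_eq_mul, derivation_two] at this
  linear_combination this

end IsMetricSpray

/-! #### The 2-form -/

section Form

variable {Φ} {L lam : A} {w : Fin n → Fin n → A}

lemma py_sum_form (hw : ∀ i j k, Φ.py k (w i j) = 0) (i j : Fin n) :
    Φ.py j (∑ r, w i r * Φ.y r) = w i j := by
  simp [map_sum, hw, Φ.py_y]

lemma form_eq_hess (hw : ∀ i j k, Φ.py k (w i j) = 0)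
    (hL : ∀ i, L * Φ.py i lam = ∑ r, w i r * Φ.y r) (i j : Fin n) :
    w i j = Φ.py j L * Φ.py i lam + L * Φ.py j (Φ.py i lam) := by
  have := congrArg (Φ.py j) (hL i)
  rw [py_sum_form hw, Derivation.leibniz] at this
  simp only [smul_eq_mul] at this
  linear_combination -this

/-- Antisymmetrization of `form_eq_hess` removes the Hessian of λ. -/
lemma two_mul_form (hw : ∀ i j k, Φ.py k (w i j) = 0) (hskew : ∀ i j, w i j = -w j i)
    (hL : ∀ i, L * Φ.py i lam = ∑ r, w i r * Φ.y r) (i j : Fin n) :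
    2 * w i j = Φ.py j L * Φ.py i lam - Φ.py i L * Φ.py j lam := by
  linear_combination form_eq_hess hw hL i j - form_eq_hess hw hL j i + hskew i j
    + L * Φ.py_py_apply j i lam

/-- Multiplying `two_mul_form` by `L` eliminates λ, since L λ_{.i} is known. The y^k-derivative is
then an algebraic relation between the form and the derivatives of `L`, ready for contraction. -/
lemma two_mul_py_mul_form (hw : ∀ i j k, Φ.py k (w i j) = 0) (hskew : ∀ i j, w i j = -w j i)
    (hL : ∀ i, L * Φ.py i lam = ∑ r, w i r * Φ.y r) (i j k : Fin n) :
    2 * Φ.py k L * w i j = Φ.py k (Φ.py j L) * (∑ r, w i r * Φ.y r) + Φ.py j L * w i k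
      - Φ.py k (Φ.py i L) * (∑ r, w j r * Φ.y r) - Φ.py i L * w j k := by
  have h1 : 2 * (L * w i j) = Φ.py j L * (∑ r, w i r * Φ.y r)
      - Φ.py i L * (∑ r, w j r * Φ.y r) := by
    rw [← hL, ← hL]
    linear_combination L * two_mul_form hw hskew hL i j
  have := congrArg (Φ.py k) h1
  simp only [Derivation.leibniz, smul_eq_mul, derivation_two, map_sub, py_sum_form hw, hw] at this
  linear_combination this

end Form

/-! #### Polynomial dependence on the direction -/

/-- `f` is polynomial of degree at most `d` in `y`: its `y`-derivatives of order `d + 1` vanish. -/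
def VertDeg : ℕ → A → Prop
  | 0, f => ∀ i, Φ.py i f = 0
  | d + 1, f => ∀ i, VertDeg d (Φ.py i f)

namespace VertDeg

variable {Φ}

lemma zero (d : ℕ) : Φ.VertDeg d 0 := by
  induction d with
  | zero => intro i; simp
  | succ d ih => intro i; simpa using ih

lemma add {d : ℕ} {f g : A} (hf : Φ.VertDeg d f) (hg : Φ.VertDeg d g) : Φ.VertDeg d (f + g) := by
  induction d generalizing f g with
  | zero => intro i; rw [map_add, hf i, hg i, add_zero]
  | succ d ih => intro i; rw [map_add]; exact ih (hf i) (hg i)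

lemma neg {d : ℕ} {f : A} (hf : Φ.VertDeg d f) : Φ.VertDeg d (-f) := by
  induction d generalizing f with
  | zero => intro i; rw [map_neg, hf i, neg_zero]
  | succ d ih => intro i; rw [map_neg]; exact ih (hf i)

lemma sub {d : ℕ} {f g : A} (hf : Φ.VertDeg d f) (hg : Φ.VertDeg d g) : Φ.VertDeg d (f - g) := by
  rw [sub_eq_add_neg]; exact hf.add hg.neg

lemma sum {ι : Type*} {s : Finset ι} {d : ℕ} {f : ι → A} (hf : ∀ i ∈ s, Φ.VertDeg d (f i)) :
    Φ.VertDeg d (∑ i ∈ s, f i) :=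
  Finset.sum_induction _ _ (fun _ _ => add) (zero d) hf

lemma succ {d : ℕ} {f : A} (hf : Φ.VertDeg d f) : Φ.VertDeg (d + 1) f := by
  induction d generalizing f with
  | zero => intro i; rw [hf i]; exact zero 0
  | succ d ih => intro i; exact ih (hf i)

lemma px {d : ℕ} {f : A} (hf : Φ.VertDeg d f) (j : Fin n) : Φ.VertDeg d (Φ.px j f) := by
  induction d generalizing f with
  | zero => intro i; rw [Φ.py_px_apply, hf i, map_zero]
  | succ d ih => intro i; rw [Φ.py_px_apply]; exact ih (hf i)

lemma mul {d e : ℕ} {f g : A} (hf : Φ.VertDeg d f) (hg : Φ.VertDeg e g) :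
    Φ.VertDeg (d + e) (f * g) := by
  induction hm : d + e generalizing d e f g with
  | zero =>
    obtain ⟨rfl, rfl⟩ : d = 0 ∧ e = 0 := by omega
    intro i; simp [hf i, hg i]
  | succ m ih =>
    intro i
    rw [Derivation.leibniz, smul_eq_mul, smul_eq_mul]
    refine add ?_ ?_
    · cases e with
      | zero => rw [hg i, mul_zero]; exact zero m
      | succ e => exact ih hf (hg i) (by omega)
    · cases d with
      | zero => rw [hf i, mul_zero]; exact zero m
      | succ d => rw [mul_comm]; exact ih (hf i) hg (by omega)

lemma two (d : ℕ) : Φ.VertDeg d (2 : A) := by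
  induction d with
  | zero => intro i; exact derivation_two _
  | succ d ih => exact ih.succ

lemma y (j : Fin n) : Φ.VertDeg 1 (Φ.y j) := by
  intro i k
  rw [Φ.py_y]
  split_ifs <;> simp

lemma riem {G : Fin n → A} (hG : ∀ i, Φ.VertDeg 2 (G i)) (i k : Fin n) :
    Φ.VertDeg 2 (Φ.riem G i k) := by
  have h1 : ∀ i k, Φ.VertDeg 1 (Φ.py k (G i)) := fun i k => hG i k
  refine sub (VertDeg.add (sub ?_ (sum fun j _ => ?_)) ?_) (sum fun j _ => (h1 i j).mul (h1 j k))
  · exact (two 0).mul ((hG i).px k)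
  · exact (y j).mul ((h1 i k).px j)
  · exact (two 0).mul (sum fun j _ => (hG j).mul (e := 0) (h1 i k j))

/-- If every combination of the `f i` with an invertible matrix of functions of `x` is polynomial
in `y`, then so are the `f i`. -/
lemma of_sum {d : ℕ} {f : Fin n → A} {g : Fin n → Fin n → A}
    (hg : ∀ i l, Φ.VertDeg 0 (g i l))
    (hnd : ∀ f : Fin n → A, (∀ l, ∑ i, f i * g i l = 0) → f = 0)
    (hf : ∀ l, Φ.VertDeg d (∑ i, f i * g i l)) (i : Fin n) : Φ.VertDeg d (f i) := by
  have hpy : ∀ (f : Fin n → A) (j l : Fin n),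
      Φ.py j (∑ i, f i * g i l) = ∑ i, Φ.py j (f i) * g i l := fun f j l => by
    rw [map_sum]
    refine Finset.sum_congr rfl fun i _ => ?_
    rw [Derivation.leibniz, hg i l j, smul_eq_mul, smul_eq_mul]
    ring
  induction d generalizing f i with
  | zero =>
    intro j
    exact congrFun (hnd (fun i => Φ.py j (f i)) fun l => by rw [← hpy]; exact hf l j) i
  | succ d ih =>
    intro j
    exact ih (f := fun i => Φ.py j (f i)) (fun l => by rw [← hpy]; exact hf l j) i

end VertDeg

namespace IsMetricSpray

variable {Φ} {G : Fin n → A} {L : A}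

/-- The spray of a Riemann metric is quadratic. -/
lemma vertDeg_two (h : Φ.IsMetricSpray G L) (hL : Φ.VertDeg 2 L)
    (hnd : ∀ f : Fin n → A, (∀ l, ∑ i, f i * Φ.py i (Φ.py l L) = 0) → f = 0) (i : Fin n) :
    Φ.VertDeg 2 (G i) := by
  have h2 : ∀ l, Φ.VertDeg 2 (2 * G l) :=
    VertDeg.of_sum (f := fun i => 2 * G i) (g := fun i l => Φ.py i (Φ.py l L)) (fun i l => hL l i)
      hnd fun l => by
        simp only [mul_assoc]
        rw [← Finset.mul_sum, h.lagrange]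
        exact VertDeg.sub (VertDeg.sum fun k _ => (VertDeg.y k).mul
          ((show Φ.VertDeg 1 _ from hL l).px k)) (hL.px l)
  -- A second use of the same principle, with the matrix 2δ, removes the factor 2 from `h2`.
  refine VertDeg.of_sum (f := G) (g := fun i l => if i = l then 2 else 0)
    (fun i l => ?_) (fun f hf => ?_) (fun l => ?_) i
  · split_ifs
    exacts [VertDeg.two 0, VertDeg.zero 0]
  · ext l
    exact eq_zero_of_two_mul (by simpa [mul_comm] using hf l)
  · simpa [mul_comm] using h2 l

end IsMetricSpray

end CoordFrame

end Algebra

/-! ### The Berwald frame of a surface, in the abstract algebra -/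

section Surface

variable {A : Type*} [CommRing A] [Algebra ℝ A]

namespace CoordFrame

variable (Φ : CoordFrame 2 A)

/-- The determinant of the matrix of second derivatives `L_{.i.j}`. -/
def hessDet (L : A) : A :=
  Φ.py 0 (Φ.py 0 L) * Φ.py 1 (Φ.py 1 L) - Φ.py 0 (Φ.py 1 L) * Φ.py 0 (Φ.py 1 L)

/-- The components `ρ (-L_{.2}, L_{.1})` of the vertical field of the Berwald frame. -/
def berwaldVec (L ρ : A) : Fin 2 → A := ![-(ρ * Φ.py 1 L), ρ * Φ.py 0 L]

/-- The vertical field of the Berwald frame. -/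
def berwald (L ρ : A) : Derivation ℝ A A := ∑ i, Φ.berwaldVec L ρ i • Φ.py i

lemma berwald_apply (L ρ f : A) :
    Φ.berwald L ρ f = -(ρ * Φ.py 1 L) * Φ.py 0 f + ρ * Φ.py 0 L * Φ.py 1 f := by
  simp [berwald, berwaldVec, Fin.sum_univ_two]

lemma berwald_self (L ρ : A) : Φ.berwald L ρ L = 0 := by
  rw [berwald_apply]; ring

/-- A derivation kills an element whose square is `1`. -/
lemma derivation_sign (D : Derivation ℝ A A) {ε : A} (hε : ε * ε = 1) : D ε = 0 := by
  have := congrArg D hε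
  rw [Derivation.leibniz, Derivation.map_one_eq_zero, smul_eq_mul, ← two_mul] at this
  have := eq_zero_of_two_mul this
  calc D ε = ε * ε * D ε := by rw [hε, one_mul]
    _ = ε * (ε * D ε) := by ring
    _ = 0 := by rw [this, mul_zero]

namespace IsMetricSpray

variable {Φ} {G : Fin 2 → A} {L ε ρ : A}

lemma py_zero_eq (h : Φ.IsMetricSpray G L) :
    Φ.py 0 L = Φ.y 0 * Φ.py 0 (Φ.py 0 L) + Φ.y 1 * Φ.py 0 (Φ.py 1 L) := by
  have := h.sum_y_mul_py_py 0
  rw [Fin.sum_univ_two] at this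
  exact this.symm

lemma py_one_eq (h : Φ.IsMetricSpray G L) :
    Φ.py 1 L = Φ.y 0 * Φ.py 0 (Φ.py 1 L) + Φ.y 1 * Φ.py 1 (Φ.py 1 L) := by
  have := h.sum_y_mul_py_py 1
  rw [Fin.sum_univ_two, Φ.py_py_apply 1 0] at this
  exact this.symm

lemma two_mul_L (h : Φ.IsMetricSpray G L) : 2 * L = Φ.y 0 * Φ.py 0 L + Φ.y 1 * Φ.py 1 L := by
  rw [← h.euler_L, euler_apply, Fin.sum_univ_two]

/-- Trace of `spray_py_py`: along the geodesics the determinant of the parallel Hessian grows at the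
rate 2 tr N. -/
lemma spray_hessDet (h : Φ.IsMetricSpray G L) :
    Φ.spray G (Φ.hessDet L) = 2 * (Φ.py 0 (G 0) + Φ.py 1 (G 1)) * Φ.hessDet L := by
  have e00 := h.spray_py_py 0 0
  have e11 := h.spray_py_py 1 1
  have e01 := h.spray_py_py 1 0
  simp only [Fin.sum_univ_two] at e00 e11 e01
  rw [Φ.py_py_apply 1 0] at e11 e01
  simp only [hessDet, map_sub, Derivation.leibniz, smul_eq_mul, e00, e11, e01]
  ring

lemma spray_rho (h : Φ.IsMetricSpray G L) (hε : ε * ε = 1)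
    (hρ : ρ * ρ * (ε * Φ.hessDet L) = 1) :
    Φ.spray G ρ = -((Φ.py 0 (G 0) + Φ.py 1 (G 1)) * ρ) := by
  have := congrArg (Φ.spray G) hρ
  simp only [Derivation.leibniz, smul_eq_mul, h.spray_hessDet, derivation_sign _ hε,
    Derivation.map_one_eq_zero] at this
  have h2 : 2 * (Φ.spray G ρ * (ρ * (ε * Φ.hessDet L))
      + (Φ.py 0 (G 0) + Φ.py 1 (G 1)) * (ρ * ρ * (ε * Φ.hessDet L))) = 0 := by
    linear_combination this
  have := eq_zero_of_two_mul h2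
  linear_combination ρ * this - (Φ.spray G ρ + ρ * (Φ.py 0 (G 0) + Φ.py 1 (G 1))) * hρ

/-- The vector v = ρ(-L_{.2}, L_{.1}) is parallel along the geodesics: the density ρ compensates the
trace of N introduced by the rotation of the covector L_{.i}. -/
lemma spray_berwaldVec (h : Φ.IsMetricSpray G L) (hε : ε * ε = 1)
    (hρ : ρ * ρ * (ε * Φ.hessDet L) = 1)
    (i : Fin 2) : Φ.spray G (Φ.berwaldVec L ρ i)
    + ∑ j, Φ.py j (G i) * Φ.berwaldVec L ρ j = 0 := by
  have e0 := h.spray_py' 0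
  have e1 := h.spray_py' 1
  have er := h.spray_rho hε hρ
  simp only [Fin.sum_univ_two] at e0 e1
  fin_cases i
  · simp [berwaldVec, Fin.sum_univ_two, e1, er]
    ring
  · simp [berwaldVec, Fin.sum_univ_two, e0, er]
    ring

/-- The vertical part of the bracket is the covariant derivative of v along the geodesics, which
vanishes by `spray_berwaldVec`. -/
lemma lie_berwald_spray (h : Φ.IsMetricSpray G L) (hε : ε * ε = 1)
    (hρ : ρ * ρ * (ε * Φ.hessDet L) = 1) :
    ⁅Φ.berwald L ρ, Φ.spray G⁆ = ∑ i, Φ.berwaldVec L ρ i • Φ.hor G i := by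
  have e0 := h.spray_berwaldVec hε hρ 0
  have e1 := h.spray_berwaldVec hε hρ 1
  rw [Fin.sum_univ_two] at e0 e1
  rw [add_eq_zero_iff_eq_neg] at e0 e1
  simp only [berwald, Fin.sum_univ_two, add_lie, derivation_smul_lie, lie_py_spray, e0, e1]
  module

/-- As v^i L_{.i} = 0, the flag form of the curvature gives R^j_i v^i = λ L v^j. The other terms
cancel because v is parallel. -/
lemma lie_spray_hor_berwald (h : Φ.IsMetricSpray G L) (hε : ε * ε = 1)
    (hρ : ρ * ρ * (ε * Φ.hessDet L) = 1)
    {lam : A}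
    (hR : ∀ i k, 2 * Φ.riem G i k
      = lam * (2 * L * (if i = k then 1 else 0) - Φ.y i * Φ.py k L)) :
    ⁅Φ.spray G, ∑ i, Φ.berwaldVec L ρ i • Φ.hor G i⁆ = (lam * L) • Φ.berwald L ρ := by
  have e0 := h.spray_berwaldVec hε hρ 0
  have e1 := h.spray_berwaldVec hε hρ 1
  rw [Fin.sum_univ_two] at e0 e1
  rw [add_eq_zero_iff_eq_neg] at e0 e1
  have r : ∀ j, Φ.berwaldVec L ρ 0 * Φ.riem G j 0 + Φ.berwaldVec L ρ 1 * Φ.riem G j 1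
      = lam * L * Φ.berwaldVec L ρ j := fun j => by
    apply eq_of_two_mul
    have h0 := hR j 0
    have h1 := hR j 1
    fin_cases j
    · simp [berwaldVec] at h0 h1 ⊢
      linear_combination (-(ρ * Φ.py 1 L)) * h0 + ρ * Φ.py 0 L * h1
    · simp [berwaldVec] at h0 h1 ⊢
      linear_combination (-(ρ * Φ.py 1 L)) * h0 + ρ * Φ.py 0 L * h1
  have r0 := r 0
  have r1 := r 1
  simp only [berwald, Fin.sum_univ_two, lie_add, derivation_lie_smul, lie_spray_hor, e0, e1,
    smul_add, smul_smul, ← r0, ← r1]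
  module

/-- By Euler's relation L_{.i} = L_{.i.j} y^j, so differentiating L_{.i} along V returns y times the
Hessian determinant, by Cramer's rule. The coefficient of v is the logarithmic derivative of ρ,
which is -I in `berwald_flag`. -/
lemma berwald_berwaldVec (h : Φ.IsMetricSpray G L) (hε : ε * ε = 1)
    (hρ : ρ * ρ * (ε * Φ.hessDet L) = 1)
    (i : Fin 2) : Φ.berwald L ρ (Φ.berwaldVec L ρ i) =
    -(ε * Φ.y i) + Φ.berwald L ρ ρ * (ρ * (ε * Φ.hessDet L)) * Φ.berwaldVec L ρ i := by
  have p0 := h.py_zero_eq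
  have p1 := h.py_one_eq
  have q0 : Φ.berwald L ρ (Φ.py 0 L) = -(ρ * Φ.hessDet L * Φ.y 1) := by
    rw [berwald_apply, hessDet, Φ.py_py_apply 1 0]
    linear_combination (-ρ * Φ.py 0 (Φ.py 0 L)) * p1 + (ρ * Φ.py 0 (Φ.py 1 L)) * p0
  have q1 : Φ.berwald L ρ (Φ.py 1 L) = ρ * Φ.hessDet L * Φ.y 0 := by
    rw [berwald_apply, hessDet]
    linear_combination (-ρ * Φ.py 0 (Φ.py 1 L)) * p1 + (ρ * Φ.py 1 (Φ.py 1 L)) * p0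
  have hd : ρ * ρ * Φ.hessDet L = ε := by
    linear_combination ε * hρ - ρ * ρ * Φ.hessDet L * hε
  fin_cases i
  · simp [berwaldVec, q1]
    linear_combination (-Φ.y 0) * hd + (Φ.py 1 L * Φ.berwald L ρ ρ) * hρ
  · simp [berwaldVec, q0]
    linear_combination (-Φ.y 1) * hd - (Φ.py 0 L * Φ.berwald L ρ ρ) * hρ

/-- The Bianchi identity on a surface with main scalar `I` constant along the geodesics. -/
lemma berwald_flag (h : Φ.IsMetricSpray G L) (hε : ε * ε = 1)
    (hρ : ρ * ρ * (ε * Φ.hessDet L) = 1)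
    (hG : ∀ i, Φ.euler (G i) = 2 * G i) {lam I Linv : A}
    (hR : ∀ i k, 2 * Φ.riem G i k
      = lam * (2 * L * (if i = k then 1 else 0) - Φ.y i * Φ.py k L))
    (hI : Φ.berwald L ρ ρ * (ρ * (ε * Φ.hessDet L)) = -I)
    (hSI : Φ.spray G I = 0) (hL : L * Linv = 1) :
    Φ.berwald L ρ lam = -(I * lam) := by
  set v := Φ.berwaldVec L ρ with hv
  set V := Φ.berwald L ρ with hV
  set S := Φ.spray G with hS
  set H := ∑ i, v i • Φ.hor G i with hH
  have e1 : ⁅V, S⁆ = H := h.lie_berwald_spray hε hρ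
  have e2 : ⁅S, H⁆ = (lam * L) • V := h.lie_spray_hor_berwald hε hρ hR
  -- The vertical part w of [V, H] need not be computed: the Jacobi identity below shows that it
  -- vanishes.
  have e3 : ∃ w : Fin 2 → A, ⁅V, H⁆ = -(ε • S) - I • H + ∑ k, w k • Φ.py k := by
    have b0 := h.berwald_berwaldVec hε hρ 0
    have b1 := h.berwald_berwaldVec hε hρ 1
    rw [hI, ← hV, ← hv] at b0 b1
    refine ⟨fun k => -(Φ.hor G 0 (v k) * v 0 + Φ.hor G 1 (v k) * v 1)
      - ∑ i, ∑ j, v i * v j * Φ.py j (Φ.py i (G k)), ?_⟩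
    have c : ∀ i, ⁅V, Φ.hor G i⁆ = ∑ j, (v j • (-∑ k, Φ.py j (Φ.py i (G k)) • Φ.py k)
        - Φ.hor G i (v j) • Φ.py j) := fun i => by
      simp only [hV, berwald, sum_lie, derivation_smul_lie, lie_py_hor, ← hv]
    rw [hS, Φ.euler_eq_sum_hor hG, hH, lie_sum]
    simp only [derivation_lie_smul, c, b0, b1, Fin.sum_univ_two]
    module
  obtain ⟨w, e3⟩ := e3
  -- Here [[V, S], H] = [H, H] = 0, so the identity reduces to V(λL) V = -I λ L V + [S, w^k ∂̇_k].
  have J := leibniz_lie V S H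
  rw [e2, e1, lie_self, zero_add, e3, derivation_lie_smul, lie_self, smul_zero, add_zero] at J
  simp only [lie_add, lie_sub, lie_neg, derivation_lie_smul, lie_self, smul_zero, add_zero,
    derivation_sign S hε, zero_smul, neg_zero, zero_sub, hSI, e2, zero_add] at J
  have hVx : ∀ k, V (Φ.x k) = 0 := fun k => by simp [hV, berwald_apply, Φ.py_x]
  have hSx : ∀ k, S (Φ.x k) = Φ.y k := fun k => by
    simp [hS, spray_apply, Φ.py_x, Φ.px_x]
  -- Both sides are evaluated on x^k: V x^k = 0 and S x^k = y^k, so only w^k survives.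
  have hw : w = 0 := by
    ext k
    have := congrArg (fun D => D (Φ.x k)) J
    simp [Derivation.commutator_apply, hVx, hSx, Φ.py_x, Φ.py_y] at this
    fin_cases k <;> simpa using this.symm
  have hvy : ∀ k, V (Φ.y k) = v k := fun k => by
    fin_cases k <;> simp [hV, berwald, Φ.py_y, ← hv]
  have J' : ∀ k, V (lam * L) * v k = -(I * (lam * L)) * v k := fun k => by
    have := congrArg (fun D => D (Φ.y k)) J
    simp only [hw, Derivation.smul_apply, Derivation.neg_apply, hvy,
      smul_eq_mul, Pi.zero_apply, zero_smul, Finset.sum_const_zero, lie_zero,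
      add_zero] at this
    rw [this]
    ring
  have hVL : V (lam * L) = L * V lam := by
    rw [Derivation.leibniz, hV, berwald_self]
    simp
  -- The determinant of (y, v) is 2Lρ, a unit, so the vector v can be cancelled from `J'`.
  have hunit : (Φ.y 0 * v 1 - Φ.y 1 * v 0) * (ρ * (ε * Φ.hessDet L)) = 2 * L := by
    simp [hv, berwaldVec]
    linear_combination (2 * L) * hρ - (ρ * ρ * (ε * Φ.hessDet L)) * h.two_mul_L
  apply eq_of_two_mul
  have j0 := J' 0
  have j1 := J' 1
  rw [hVL] at j0 j1
  linear_combination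
    (Φ.y 0 * j1 - Φ.y 1 * j0) * (ρ * (ε * Φ.hessDet L)) * Linv * Linv
    - (L * V lam + I * (lam * L)) * Linv * Linv * hunit
    - 2 * (V lam + I * lam) * (L * Linv + 1) * hL

/-- The `y`-derivatives of a function homogeneous of degree zero. -/
lemma two_mul_L_mul_py (h : Φ.IsMetricSpray G L)
    (hρ : ρ * ρ * (ε * Φ.hessDet L) = 1)
    {f : A} (hf : Φ.euler f = 0) :
    2 * L * Φ.py 0 f = -(Φ.y 1 * (ρ * (ε * Φ.hessDet L)) * Φ.berwald L ρ f) ∧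
      2 * L * Φ.py 1 f = Φ.y 0 * (ρ * (ε * Φ.hessDet L)) * Φ.berwald L ρ f := by
  rw [euler_apply, Fin.sum_univ_two] at hf
  have h2 := h.two_mul_L
  simp only [berwald_apply]
  constructor
  · linear_combination Φ.py 0 f * h2 + Φ.py 0 L * hf
      + (Φ.y 1 * (Φ.py 0 L * Φ.py 1 f - Φ.py 1 L * Φ.py 0 f)) * hρ
  · linear_combination Φ.py 1 f * h2 + Φ.py 1 L * hf
      - (Φ.y 0 * (Φ.py 0 L * Φ.py 1 f - Φ.py 1 L * Φ.py 0 f)) * hρ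

lemma euler_rho (h : Φ.IsMetricSpray G L) (hε : ε * ε = 1)
    (hρ : ρ * ρ * (ε * Φ.hessDet L) = 1) :
    Φ.euler ρ = 0 := by
  have := congrArg Φ.euler hρ
  simp only [hessDet, map_sub, Derivation.leibniz, smul_eq_mul, h.euler_py_py,
    derivation_sign _ hε, Derivation.map_one_eq_zero, mul_zero, add_zero, sub_self,
    zero_add] at this
  have h2 := eq_zero_of_two_mul (a := Φ.euler ρ * (ρ * (ε * Φ.hessDet L)))
    (by rw [hessDet]; linear_combination this)
  linear_combination ρ * h2 - Φ.euler ρ * hρ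

/-- A surface with constant main scalar `I` and flag curvature `lam`: the form
`½ I lam √|det L_{.i.j}| dx¹ ∧ dx²` does not depend on the direction and gives `L lam_{.i}`. -/
lemma form_of_constant_mainScalar (h : Φ.IsMetricSpray G L) (hε : ε * ε = 1)
    (hρ : ρ * ρ * (ε * Φ.hessDet L) = 1)
    (hG : ∀ i, Φ.euler (G i) = 2 * G i) {lam I Linv : A}
    (hR : ∀ i k, 2 * Φ.riem G i k
      = lam * (2 * L * (if i = k then 1 else 0) - Φ.y i * Φ.py k L))
    (hI : Φ.berwald L ρ ρ * (ρ * (ε * Φ.hessDet L)) = -I)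
    (hDI : ∀ D : Derivation ℝ A A, D I = 0) (hL : L * Linv = 1) (hlam : Φ.euler lam = 0) :
    ∃ w : A, (∀ i, Φ.py i w = 0) ∧ 2 * L * Φ.py 0 lam = w * Φ.y 1 ∧
      2 * L * Φ.py 1 lam = -(w * Φ.y 0) := by
  have hV := h.berwald_flag hε hρ hG hR hI (hDI _) hL
  set σ := ρ * (ε * Φ.hessDet L) with hσ
  have hσρ : ρ * σ = 1 := by rw [hσ, ← mul_assoc, hρ]
  have hDσ : ∀ D : Derivation ℝ A A, D σ = -(σ * σ * D ρ) := fun D => by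
    have := congrArg D hσρ
    rw [Derivation.leibniz, Derivation.map_one_eq_zero, smul_eq_mul, smul_eq_mul] at this
    linear_combination σ * this - D σ * hσρ
  -- σ = 1/ρ has logarithmic derivative I along V, and λ has -I by `berwald_flag`. So I λ σ is
  -- killed by V; being homogeneous of degree zero, it has no y-derivative at all.
  have hVσ : Φ.berwald L ρ σ = I * σ := by
    rw [hDσ]
    linear_combination (-σ) * hI
  have hEσ : Φ.euler σ = 0 := by rw [hDσ, h.euler_rho hε hρ]; simp
  have hw := h.two_mul_L_mul_py hρ (f := I * lam * σ)
    (by simp [Derivation.leibniz, hEσ, hlam, hDI])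
  have hVw : Φ.berwald L ρ (I * lam * σ) = 0 := by
    simp only [Derivation.leibniz, hVσ, hV, hDI, smul_eq_mul]
    ring
  rw [hVw, mul_zero, mul_zero, neg_zero] at hw
  have hlam' := h.two_mul_L_mul_py hρ hlam
  rw [hV, ← hσ] at hlam'
  have cancel : ∀ a : A, 2 * L * a = 0 → a = 0 := fun a ha => by
    apply eq_zero_of_two_mul
    linear_combination Linv * ha - 2 * a * hL
  refine ⟨I * lam * σ, fun i => ?_, ?_, ?_⟩
  · fin_cases i
    exacts [cancel _ hw.1, cancel _ hw.2]
  · rw [hlam'.1]; ring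
  · rw [hlam'.2]; ring

end IsMetricSpray

end CoordFrame

end Surface

/-! ### The ring of smooth functions on an open set of coordinates -/

section SmoothRing

open TopologicalSpace (Opens)

variable {n : ℕ}

/-- The smooth functions on the open set `U`. -/
def SmoothRing (U : Opens (Coord n)) : Subalgebra ℝ (U → ℝ) where
  carrier := {f | ∃ F : Coord n → ℝ, ContDiffOn ℝ ∞ F U ∧ ∀ u : U, f u = F u}
  mul_mem' := by
    rintro f g ⟨F, hF, hf⟩ ⟨G, hG, hg⟩
    exact ⟨fun p => F p * G p, hF.mul hG, fun u => by simp [hf, hg]⟩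
  add_mem' := by
    rintro f g ⟨F, hF, hf⟩ ⟨G, hG, hg⟩
    exact ⟨fun p => F p + G p, hF.add hG, fun u => by simp [hf, hg]⟩
  algebraMap_mem' r := ⟨fun _ => r, contDiffOn_const, fun u => rfl⟩

namespace SmoothRing

variable {U : Opens (Coord n)}

/-- The element of the ring given by a function that is smooth on `U`. -/
def ofFun (F : Coord n → ℝ) (hF : ContDiffOn ℝ ∞ F U) : SmoothRing U :=
  ⟨fun u => F u, F, hF, fun _ => rfl⟩

/-- Evaluation at a point. -/
def ev (u : U) : SmoothRing U →ₐ[ℝ] ℝ where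
  toFun f := f.1 u
  map_one' := rfl
  map_mul' _ _ := rfl
  map_zero' := rfl
  map_add' _ _ := rfl
  commutes' _ := rfl

lemma ev_mk (u : U) (F : Coord n → ℝ) (hF : ContDiffOn ℝ ∞ F U) : ev u (ofFun F hF) = F u := rfl

lemma ext_ev {f g : SmoothRing U} (h : ∀ u, ev u f = ev u g) : f = g :=
  Subtype.ext (funext h)

lemma mk_congr {F F' : Coord n → ℝ} (hF : ContDiffOn ℝ ∞ F U) (hF' : ContDiffOn ℝ ∞ F' U)
    (h : ∀ u ∈ U, F u = F' u) : ofFun F hF = ofFun F' hF' :=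
  ext_ev fun u => h u u.2

lemma exists_mk (f : SmoothRing U) : ∃ F hF, f = ofFun F hF := by
  obtain ⟨f, F, hF, h⟩ := f
  exact ⟨F, hF, Subtype.ext (funext h)⟩

lemma contDiffOn_fderiv {F : Coord n → ℝ} (hF : ContDiffOn ℝ ∞ F U) (v : Coord n) :
    ContDiffOn ℝ ∞ (fun p => fderiv ℝ F p v) U :=
  (hF.fderiv_of_isOpen U.isOpen (m := ∞) (by simp)).clm_apply contDiffOn_const

/-- A function that is smooth on `U` and represents `f`. -/
noncomputable def rep (f : SmoothRing U) : Coord n → ℝ := (exists_mk f).choose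

lemma contDiffOn_rep (f : SmoothRing U) : ContDiffOn ℝ ∞ (rep f) U :=
  (exists_mk f).choose_spec.choose

lemma mk_rep (f : SmoothRing U) : ofFun (rep f) (contDiffOn_rep f) = f :=
  (exists_mk f).choose_spec.choose_spec.symm

lemma rep_eq (f : SmoothRing U) (u : U) : rep f u = ev u f := by
  conv_rhs => rw [← mk_rep f]
  rfl

lemma differentiableAt {F : Coord n → ℝ} (hF : ContDiffOn ℝ ∞ F U) (u : U) :
    DifferentiableAt ℝ F u :=
  ((hF u u.2).contDiffAt (U.isOpen.mem_nhds u.2)).differentiableAt (by simp)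

/-- Because U is open, derivatives at its points do not depend on the choice made in `rep`. -/
lemma fderiv_congr {F F' : Coord n → ℝ} (h : ∀ u ∈ U, F u = F' u) (u : U) :
    fderiv ℝ F u = fderiv ℝ F' u :=
  Filter.EventuallyEq.fderiv_eq (Filter.eventuallyEq_of_mem (U.isOpen.mem_nhds u.2) h)

/-- The directional derivative, as a linear map. -/
noncomputable def derLinear (v : Coord n) : SmoothRing U →ₗ[ℝ] SmoothRing U where
  toFun f := ofFun (fun p => fderiv ℝ (rep f) p v) (contDiffOn_fderiv (contDiffOn_rep f) v)
  map_add' f g := ext_ev fun u => by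
    rw [map_add, ev_mk, ev_mk, ev_mk, fderiv_congr (F' := rep f + rep g), fderiv_add
      (differentiableAt (contDiffOn_rep f) u) (differentiableAt (contDiffOn_rep g) u)]
    · rfl
    · intro u hu
      have h := fun f => rep_eq f (⟨u, hu⟩ : U)
      simp only at h
      rw [Pi.add_apply, h, h, h, map_add]
  map_smul' r f := ext_ev fun u => by
    rw [RingHom.id_apply, map_smul, ev_mk, ev_mk, fderiv_congr (F' := r • rep f), fderiv_const_smul
      (differentiableAt (contDiffOn_rep f) u)]
    · rfl
    · intro u hu
      have h := fun f => rep_eq f (⟨u, hu⟩ : U)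
      simp only at h
      rw [Pi.smul_apply, h, h, map_smul]

lemma ev_derLinear (v : Coord n) (f : SmoothRing U) (u : U) :
    ev u (derLinear v f) = fderiv ℝ (rep f) u v := rfl

/-- The directional derivative, as a derivation. -/
noncomputable def der (v : Coord n) : Derivation ℝ (SmoothRing U) (SmoothRing U) :=
  Derivation.mk' (derLinear v) fun f g => ext_ev fun u => by
    rw [smul_eq_mul, smul_eq_mul, map_add, map_mul (ev u), map_mul (ev u), ev_derLinear,
      ev_derLinear, ev_derLinear, fderiv_congr (F' := rep f * rep g), fderiv_mul
      (differentiableAt (contDiffOn_rep f) u) (differentiableAt (contDiffOn_rep g) u)]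
    · simp [rep_eq]
    · intro u hu
      have h := fun f => rep_eq f (⟨u, hu⟩ : U)
      simp only at h
      rw [Pi.mul_apply, h, h, h, map_mul]

lemma der_mk (v : Coord n) {F : Coord n → ℝ} (hF : ContDiffOn ℝ ∞ F U) :
    der v (ofFun F hF) = ofFun (fun p => fderiv ℝ F p v) (contDiffOn_fderiv hF v) :=
  ext_ev fun u => by
    change fderiv ℝ (rep (ofFun F hF)) u v = fderiv ℝ F u v
    rw [fderiv_congr (F' := F)]
    intro u hu
    exact rep_eq (ofFun F hF) ⟨u, hu⟩

/-- Symmetry of second derivatives; it supplies the commutation axioms of `frame`. -/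
lemma lie_der (v w : Coord n) : ⁅der (U := U) v, der (U := U) w⁆ = 0 := by
  ext1 f
  obtain ⟨F, hF, rfl⟩ := exists_mk f
  refine ext_ev fun u => ?_
  have hat : ContDiffAt ℝ ∞ F u := (hF u u.2).contDiffAt (U.isOpen.mem_nhds u.2)
  have hd : DifferentiableAt ℝ (fderiv ℝ F) u :=
    (hat.fderiv_right (m := ∞) (by simp)).differentiableAt (by simp)
  have hsym : IsSymmSndFDerivAt ℝ F u := hat.isSymmSndFDerivAt (by simpa using ENat.LEInfty.out)
  have key : ∀ v w : Coord n, fderiv ℝ (fun p => fderiv ℝ F p w) u v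
      = fderiv ℝ (fderiv ℝ F) u v w := fun v w => by
    rw [fderiv_clm_apply hd (differentiableAt_const w)]
    simp
  rw [Derivation.commutator_apply, der_mk, der_mk, der_mk, der_mk, map_sub, ev_mk, ev_mk, key, key,
    hsym.eq v w]
  simp

lemma contDiffOn_fst (i : Fin n) : ContDiffOn ℝ ∞ (fun p : Coord n => p.1 i) U :=
  (contDiff_euclidean.1 contDiff_fst i).contDiffOn

lemma contDiffOn_snd (i : Fin n) : ContDiffOn ℝ ∞ (fun p : Coord n => p.2 i) U :=
  (contDiff_euclidean.1 contDiff_snd i).contDiffOn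

lemma fderiv_fst_apply (i : Fin n) (p v : Coord n) :
    fderiv ℝ (fun p : Coord n => p.1 i) p v = v.1 i := by
  have : (fun p : Coord n => p.1 i) =
    (EuclideanSpace.proj i : E n →L[ℝ] ℝ).comp (ContinuousLinearMap.fst ℝ (E n) (E n)) := rfl
  rw [this, ContinuousLinearMap.fderiv]
  rfl

lemma fderiv_snd_apply (i : Fin n) (p v : Coord n) :
    fderiv ℝ (fun p : Coord n => p.2 i) p v = v.2 i := by
  have : (fun p : Coord n => p.2 i) =
    (EuclideanSpace.proj i : E n →L[ℝ] ℝ).comp (ContinuousLinearMap.snd ℝ (E n) (E n)) := rfl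
  rw [this, ContinuousLinearMap.fderiv]
  rfl

lemma e_apply (i j : Fin n) : (e i : E n) j = if i = j then 1 else 0 := by
  simp [e, eq_comm]

lemma sum_smul_e (y : E n) : ∑ i, y i • (e i : E n) = y := by
  ext j
  simp [WithLp.ofLp_sum, Finset.sum_apply, e_apply]

/-- A linear form in the coordinates `y`. -/
lemma map_snd_eq_sum (T : Coord n →L[ℝ] ℝ) (y : E n) : T (0, y) = ∑ i, y i * T (0, e i) := by
  have : T (0, y) = (T.comp (ContinuousLinearMap.inr ℝ (E n) (E n))) y := rfl
  rw [this]
  conv_lhs => rw [← sum_smul_e y, map_sum]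
  simp

variable (U) in
/-- The coordinate frame of the ring of smooth functions. -/
noncomputable def frame : CoordFrame n (SmoothRing U) where
  px i := der (e i, 0)
  py i := der (0, e i)
  x i := ofFun (fun p => p.1 i) (contDiffOn_fst i)
  y i := ofFun (fun p => p.2 i) (contDiffOn_snd i)
  px_px _ _ := lie_der _ _
  px_py _ _ := lie_der _ _
  py_py _ _ := lie_der _ _
  px_x i j := ext_ev fun u => by
    rw [der_mk, ev_mk, fderiv_fst_apply, e_apply]
    split_ifs <;> simp
  py_x i j := ext_ev fun u => by
    rw [der_mk, ev_mk, fderiv_fst_apply]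
    simp
  px_y i j := ext_ev fun u => by
    rw [der_mk, ev_mk, fderiv_snd_apply]
    simp
  py_y i j := ext_ev fun u => by
    rw [der_mk, ev_mk, fderiv_snd_apply, e_apply]
    split_ifs <;> simp

lemma contDiffOn_dx {F : Coord n → ℝ} (hF : ContDiffOn ℝ ∞ F U) (i : Fin n) :
    ContDiffOn ℝ ∞ (dx i F) U := contDiffOn_fderiv hF _

lemma contDiffOn_dy {F : Coord n → ℝ} (hF : ContDiffOn ℝ ∞ F U) (i : Fin n) :
    ContDiffOn ℝ ∞ (dy i F) U := contDiffOn_fderiv hF _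

lemma px_mk (i : Fin n) {F : Coord n → ℝ} (hF : ContDiffOn ℝ ∞ F U) :
    (frame U).px i (ofFun F hF) = ofFun (dx i F) (contDiffOn_dx hF i) := der_mk _ hF

lemma py_mk (i : Fin n) {F : Coord n → ℝ} (hF : ContDiffOn ℝ ∞ F U) :
    (frame U).py i (ofFun F hF) = ofFun (dy i F) (contDiffOn_dy hF i) := der_mk _ hF

lemma ev_y (u : U) (i : Fin n) : ev u ((frame U).y i) = u.1.2 i := rfl

lemma ev_riem (G : Coord n → E n) (hG : ∀ i, ContDiffOn ℝ ∞ (fun p => G p i) U) (i k : Fin n)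
    (u : U) : ev u ((frame U).riem (fun i => ofFun (fun p => G p i) (hG i)) i k)
      = riemann G i k u := by
  simp only [CoordFrame.riem, riemann, px_mk, py_mk, map_sub, map_add, map_mul, map_sum, ev_mk,
    ev_y, map_ofNat]

/-- Euler's theorem: a positively homogeneous function. -/
lemma euler_mk {F : Coord n → ℝ} (hF : ContDiffOn ℝ ∞ F U) (d : ℕ)
    (hom : ∀ p ∈ U, ∀ t : ℝ, 0 < t → F (p.1, t • p.2) = t ^ d * F p) :
    (frame U).euler (ofFun F hF) = (d : SmoothRing U) * ofFun F hF := by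
  refine ext_ev fun u => ?_
  rw [CoordFrame.euler_apply]
  simp only [py_mk, map_sum, map_mul, ev_mk, ev_y, map_natCast, dy]
  have h1 : HasDerivAt (fun t : ℝ => F (u.1.1, t • u.1.2)) (fderiv ℝ F u (0, u.1.2)) 1 := by
    have hc : HasDerivAt (fun t : ℝ => ((u.1.1, t • u.1.2) : Coord n)) (0, u.1.2) 1 := by
      refine (hasDerivAt_const _ _).prodMk ?_
      simpa using (hasDerivAt_id (1 : ℝ)).smul_const u.1.2
    have hF' : HasFDerivAt F (fderiv ℝ F u) ((fun t : ℝ => ((u.1.1, t • u.1.2) : Coord n)) 1) := by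
      simpa using (differentiableAt hF u).hasFDerivAt
    exact hF'.comp_hasDerivAt 1 hc
  have h2 : HasDerivAt (fun t : ℝ => t ^ d * F u) (d * F u) 1 := by
    simpa using (hasDerivAt_pow d (1 : ℝ)).mul_const (F u)
  have h3 : (fun t : ℝ => F (u.1.1, t • u.1.2)) =ᶠ[nhds 1] fun t => t ^ d * F u := by
    filter_upwards [lt_mem_nhds (zero_lt_one (α := ℝ))] with t ht
    exact hom u u.2 t ht
  have h4 := (h1.congr_of_eventuallyEq h3.symm).unique h2
  rw [← h4, map_snd_eq_sum]

end SmoothRing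

end SmoothRing

/-! ### Metrics in coordinates -/

section LocalMetric

open TopologicalSpace (Opens)
open SmoothRing

variable {n : ℕ}

/-- The properties of the expression of a Finsler metric and of its spray in a chart. -/
structure IsLocalMetric (U : Opens (Coord n)) (L : Coord n → ℝ) : Prop where
  ne_zero : ∀ p ∈ U, p.2 ≠ 0
  cone : ∀ p ∈ U, ∀ t : ℝ, 0 < t → (p.1, t • p.2) ∈ U
  smooth : ContDiffOn ℝ ∞ L U
  hom : ∀ p ∈ U, ∀ t : ℝ, 0 < t → L (p.1, t • p.2) = t ^ 2 * L p
  nondeg : ∀ p ∈ U, (fundTensor L p).det ≠ 0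
  smooth_spray : ∀ i, ContDiffOn ℝ ∞ (fun p => sprayCoeff L p i) U
  hom_spray : ∀ i, ∀ p ∈ U, ∀ t : ℝ, 0 < t →
    sprayCoeff L (p.1, t • p.2) i = t ^ 2 * sprayCoeff L p i

/-- The spray of `L` has scalar curvature, in a chart. -/
structure IsLocalScalar (U : Opens (Coord n)) (L : Coord n → ℝ) (R : Coord n → ℝ)
    (τ : Fin n → Coord n → ℝ) : Prop where
  hom : ∀ p ∈ U, ∀ t : ℝ, 0 < t → R (p.1, t • p.2) = t ^ 2 * R p
  eq : ∀ p ∈ U, ∀ i k, riemann (sprayCoeff L) i k p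
    = R p * (if i = k then 1 else 0) - τ k p * p.2 i

/-- A 2-form on the base, with `R_{.i} - 2 τ_i = w_{ir} yʳ`, in a chart. -/
structure IsLocalForm (U : Opens (Coord n)) (R : Coord n → ℝ) (τ : Fin n → Coord n → ℝ)
    (w : Fin n → Fin n → E n → ℝ) : Prop where
  smooth : ∀ i j, ContDiffOn ℝ ∞ (fun p : Coord n => w i j p.1) U
  skew : ∀ i j, ∀ p ∈ U, w i j p.1 = -w j i p.1
  eq : ∀ i, ∀ p ∈ U, dy i R p - 2 * τ i p = ∑ r, w i r p.1 * p.2 r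

variable {U : Opens (Coord n)} {L R : Coord n → ℝ} {τ : Fin n → Coord n → ℝ}
  {w : Fin n → Fin n → E n → ℝ}

lemma dy_dy_comm {F : Coord n → ℝ} (hF : ContDiffOn ℝ ∞ F U) (i j : Fin n) {p : Coord n}
    (hp : p ∈ U) : dy i (dy j F) p = dy j (dy i F) p := by
  have := congrArg (ev ⟨p, hp⟩) ((frame U).py_py_apply i j (ofFun F hF))
  simpa only [py_mk, ev_mk] using this

lemma exists_ne_zero_of_ne_zero {y : E n} (hy : y ≠ 0) : ∃ i, y i ≠ 0 := by
  by_contra h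
  push Not at h
  exact hy (by ext i; simpa using h i)

namespace IsLocalMetric

/-- The metric, as an element of the ring of smooth functions. -/
noncomputable def metric (h : IsLocalMetric U L) : SmoothRing U := ofFun L h.smooth

/-- The spray coefficients, as elements of the ring of smooth functions. -/
noncomputable def coeff (h : IsLocalMetric U L) (i : Fin n) : SmoothRing U :=
  ofFun _ (h.smooth_spray i)

lemma euler_coeff (h : IsLocalMetric U L) (i : Fin n) :
    (frame U).euler (h.coeff i) = 2 * h.coeff i := by
  simpa [coeff] using euler_mk (h.smooth_spray i) 2 (h.hom_spray i)

lemma isMetricSpray (h : IsLocalMetric U L) : (frame U).IsMetricSpray h.coeff h.metric where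
  euler_L := by simpa [metric] using euler_mk h.smooth 2 h.hom
  lagrange l := ext_ev fun u => by
    have hsym : ∀ i l, dy i (dy l L) u = 2 * fundTensor L u l i := fun i l => by
      rw [dy_dy_comm h.smooth i l u.2]
      simp [fundTensor]
    simp only [metric, coeff, px_mk, py_mk, map_sub, map_mul, map_sum, map_ofNat, ev_mk, ev_y, hsym]
    have hdet : IsUnit (fundTensor L u).det := (h.nondeg u u.2).isUnit
    set b : Fin n → ℝ := fun l => (∑ k, dx k (dy l L) u * u.1.2 k) - dx l L u with hb
    have h1 : ∀ i, sprayCoeff L u i = (1 / 4) * ((fundTensor L u)⁻¹.mulVec b) i := fun i => rfl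
    have h2 : (fundTensor L u).mulVec ((fundTensor L u)⁻¹.mulVec b) = b := by
      rw [Matrix.mulVec_mulVec, Matrix.mul_nonsing_inv _ hdet, Matrix.one_mulVec]
    have h3 := congrFun h2 l
    rw [Matrix.mulVec, dotProduct] at h3
    simp only [h1]
    calc 2 * ∑ i, 1 / 4 * ((fundTensor L u)⁻¹.mulVec b) i * (2 * fundTensor L u l i)
        = ∑ i, fundTensor L u l i * ((fundTensor L u)⁻¹.mulVec b) i := by
          rw [Finset.mul_sum]
          exact Finset.sum_congr rfl fun i _ => by ring
      _ = _ := by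
          rw [h3, hb]
          simp only [mul_comm]

lemma ev_riem (h : IsLocalMetric U L) (i k : Fin n) (u : U) :
    ev u ((frame U).riem h.coeff i k) = riemann (sprayCoeff L) i k u :=
  SmoothRing.ev_riem (sprayCoeff L) h.smooth_spray i k u

lemma smooth_riemann (h : IsLocalMetric U L) (i k : Fin n) :
    ContDiffOn ℝ ∞ (riemann (sprayCoeff L) i k) U :=
  (contDiffOn_rep ((frame U).riem h.coeff i k)).congr fun u hu => by
    rw [← h.ev_riem i k ⟨u, hu⟩, ← rep_eq]

lemma nondegenerate (h : IsLocalMetric U L) (f : Fin n → SmoothRing U)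
    (hf : ∀ l, ∑ i, f i * (frame U).py i ((frame U).py l h.metric) = 0) : f = 0 := by
  ext1 i
  refine ext_ev fun u => ?_
  have hv : Matrix.vecMul (fun i => ev u (f i)) (fundTensor L u) = 0 := by
    ext l
    have := congrArg (ev u) (hf l)
    simp only [metric, py_mk, map_sum, map_mul, ev_mk, map_zero] at this
    simp only [Matrix.vecMul, dotProduct, fundTensor, Matrix.of_apply, Pi.zero_apply]
    calc ∑ i, ev u (f i) * (1 / 2 * dy i (dy l L) u)
        = 1 / 2 * ∑ i, ev u (f i) * dy i (dy l L) u := by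
          rw [Finset.mul_sum]; exact Finset.sum_congr rfl fun i _ => by ring
      _ = 0 := by rw [this, mul_zero]
  simpa using congrFun (Matrix.eq_zero_of_vecMul_eq_zero (h.nondeg u u.2) hv) i

lemma yLow_eq_sum (h : IsLocalMetric U L) (u : U) (i : Fin n) :
    yLow L i u = ∑ j, fundTensor L u i j * u.1.2 j := by
  have := congrArg (ev u) (h.isMetricSpray.sum_y_mul_py_py i)
  simp only [metric, py_mk, map_sum, map_mul, ev_mk, ev_y] at this
  rw [yLow, ← this, Finset.mul_sum]
  exact Finset.sum_congr rfl fun j _ => by simp only [fundTensor, Matrix.of_apply]; ring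

lemma sum_yLow_mul (h : IsLocalMetric U L) (u : U) : ∑ i, yLow L i u * u.1.2 i = L u := by
  have := congrArg (ev u) h.isMetricSpray.euler_L
  rw [CoordFrame.euler_apply] at this
  simp only [metric, py_mk, map_sum, map_mul, ev_mk, ev_y, map_ofNat] at this
  calc ∑ i, yLow L i u * u.1.2 i = 1 / 2 * ∑ i, u.1.2 i * dy i L u := by
        rw [Finset.mul_sum]; exact Finset.sum_congr rfl fun j _ => by simp only [yLow]; ring
    _ = L u := by rw [this]; ring

lemma exists_yLow_ne_zero (h : IsLocalMetric U L) (u : U) : ∃ i, yLow L i u ≠ 0 := by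
  by_contra hc
  push Not at hc
  have : (fundTensor L u).mulVec (u.1.2 : Fin n → ℝ) = 0 := by
    ext i
    rw [Matrix.mulVec, dotProduct, ← h.yLow_eq_sum, hc i, Pi.zero_apply]
  have := Matrix.eq_zero_of_mulVec_eq_zero (h.nondeg u u.2) this
  exact h.ne_zero u u.2 (by ext i; exact congrFun this i)

end IsLocalMetric

/-- A multiple of the identity of rank at most one is zero in dimension at least two. This makes the
flag curvature unique. -/
lemma eq_zero_of_mul_delta (hn : 2 ≤ n) {y : E n} (hy : y ≠ 0) {a : ℝ} {b : Fin n → ℝ}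
    (hab : ∀ i k : Fin n, a * (if i = k then 1 else 0) = b k * y i) : a = 0 ∧ ∀ k, b k = 0 := by
  obtain ⟨i, hi⟩ := exists_ne_zero_of_ne_zero hy
  have : Nontrivial (Fin n) := Fin.nontrivial_iff_two_le.2 hn
  have ha : a = 0 := by
    obtain ⟨k, hk⟩ := exists_ne i
    have h1 := hab i k
    rw [if_neg hk.symm, mul_zero] at h1
    have h2 : b k = 0 := (mul_eq_zero.1 h1.symm).resolve_right hi
    simpa [h2] using hab k k
  refine ⟨ha, fun k => ?_⟩
  have := hab i k
  rw [ha, zero_mul] at this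
  exact (mul_eq_zero.1 this.symm).resolve_right hi

namespace IsLocalScalar

/-- Contract the scalar form of the curvature with y^k: the left-hand side vanishes by
`CoordFrame.sum_riem_mul_y`, and some y^i is non-zero. -/
lemma sum_mul_y (hs : IsLocalScalar U L R τ) (h : IsLocalMetric U L) (u : U) :
    R u = ∑ k, τ k u * u.1.2 k := by
  obtain ⟨i, hi⟩ := exists_ne_zero_of_ne_zero (h.ne_zero u u.2)
  have := congrArg (ev u) ((frame U).sum_riem_mul_y h.euler_coeff i)
  simp only [map_sum, map_mul, h.ev_riem, ev_y, map_zero, hs.eq u u.2, sub_mul,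
    Finset.sum_sub_distrib] at this
  simp only [mul_ite, mul_one, mul_zero, ite_mul, zero_mul, Finset.sum_ite_eq, Finset.mem_univ,
    if_true] at this
  refine mul_right_cancel₀ hi ?_
  rw [Finset.sum_mul, sub_eq_zero.1 this]
  exact Finset.sum_congr rfl fun k _ => by ring

/-- Smoothness of R is not part of the definition; it follows from the trace R^i_i = (n - 1) R. -/
lemma smooth_R (hs : IsLocalScalar U L R τ) (h : IsLocalMetric U L) (hn : 2 ≤ n) :
    ContDiffOn ℝ ∞ R U := by
  have hn' : (n : ℝ) - 1 ≠ 0 := by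
    have : (2 : ℝ) ≤ n := by exact_mod_cast hn
    linarith
  have : ContDiffOn ℝ ∞ (fun p => (∑ i, riemann (sprayCoeff L) i i p) / ((n : ℝ) - 1)) U :=
    (ContDiffOn.sum fun i _ => h.smooth_riemann i i).div_const _
  refine this.congr fun p hp => ?_
  have e := hs.sum_mul_y h ⟨p, hp⟩
  simp only at e
  simp only [hs.eq p hp, Finset.sum_sub_distrib, ← e]
  simp
  field_simp

/-- τ_k is isolated by contracting R δ^i_k - R^i_k = τ_k y^i with y^i and dividing by the Euclidean
square of y. -/
lemma smooth_τ (hs : IsLocalScalar U L R τ) (h : IsLocalMetric U L) (hn : 2 ≤ n) (k : Fin n) :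
    ContDiffOn ℝ ∞ (τ k) U := by
  have hpos : ∀ p ∈ U, ∑ i, p.2 i * p.2 i ≠ 0 := fun p hp hc => by
    obtain ⟨i, hi⟩ := exists_ne_zero_of_ne_zero (h.ne_zero p hp)
    rw [Finset.sum_eq_zero_iff_of_nonneg fun i _ => mul_self_nonneg _] at hc
    exact hi (mul_self_eq_zero.1 (hc i (Finset.mem_univ i)))
  have : ContDiffOn ℝ ∞ (fun p : Coord n => (∑ i, (R p * (if i = k then 1 else 0)
      - riemann (sprayCoeff L) i k p) * p.2 i) / ∑ i, p.2 i * p.2 i) U :=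
    ContDiffOn.div (ContDiffOn.sum fun i _ => (((hs.smooth_R h hn).mul contDiffOn_const).sub
      (h.smooth_riemann i k)).mul (contDiffOn_snd i))
      (ContDiffOn.sum fun i _ => (contDiffOn_snd i).mul (contDiffOn_snd i)) hpos
  refine this.congr fun p hp => ?_
  rw [eq_div_iff (hpos p hp), Finset.mul_sum]
  exact Finset.sum_congr rfl fun i _ => by rw [hs.eq p hp]; ring

/-- A metric of scalar curvature has a flag curvature, which is smooth. -/
theorem exists_flag (hs : IsLocalScalar U L R τ) (h : IsLocalMetric U L) (hn : 2 ≤ n) :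
    ∃ lam : Coord n → ℝ, ContDiffOn ℝ ∞ lam U ∧ (∀ p ∈ U, R p = lam p * L p) ∧
      ∀ p ∈ U, ∀ k, τ k p = lam p * yLow L k p := by
  have hRs := hs.smooth_R h hn
  have hτs := hs.smooth_τ h hn
  have hmk : ∀ i k, (frame U).riem h.coeff i k = ofFun R hRs * (if i = k then 1 else 0)
      - ofFun (τ k) (hτs k) * (frame U).y i := fun i k => ext_ev fun u => by
    rw [h.ev_riem, hs.eq u u.2, map_sub, map_mul, map_mul, ev_mk, ev_mk, ev_y]
    split_ifs <;> simp
  have e1 : ∀ u : U, ∀ i, R u * yLow L i u = τ i u * L u := fun u i => by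
    have := congrArg (ev u) (h.isMetricSpray.scalar_mul_py hmk i)
    simp only [IsLocalMetric.metric, py_mk, map_mul, map_ofNat, ev_mk] at this
    rw [yLow]
    linear_combination (1 / 2) * this
  have e2 : ∀ u : U, ∀ i j, dy j R u * yLow L i u + R u * fundTensor L u j i
      = dy j (τ i) u * L u + 2 * τ i u * yLow L j u := fun u i j => by
    have := congrArg (ev u) (h.isMetricSpray.scalar_mul_py_py hmk i j)
    simp only [IsLocalMetric.metric, py_mk, map_add, map_mul, map_ofNat, ev_mk] at this
    simp only [yLow, fundTensor, Matrix.of_apply]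
    linear_combination (1 / 2) * this
  have key : ∀ u : U, ∃ c : ℝ, R u = c * L u ∧ ∀ k, τ k u = c * yLow L k u := fun u => by
    -- Where L = 0, the relation `e1` forces R = 0, and its derivative `e2` reduces to R_{.j} y_k =
    -- 2 τ_k y_j; an index j with y_j ≠ 0 provides the factor.
    by_cases hL : L u = 0
    · obtain ⟨j, hj⟩ := h.exists_yLow_ne_zero u
      have hR : R u = 0 := by
        have := e1 u j
        rw [hL, mul_zero] at this
        exact (mul_eq_zero.1 this).resolve_right hj
      refine ⟨dy j R u / (2 * yLow L j u), by rw [hL, hR, mul_zero], fun k => ?_⟩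
      have := e2 u k j
      rw [hL, hR] at this
      field_simp
      linear_combination -this
    · refine ⟨R u / L u, by field_simp, fun k => ?_⟩
      field_simp
      exact (e1 u k).symm
  have hpos : ∀ p ∈ U, ∑ i, yLow L i p * yLow L i p ≠ 0 := fun p hp hc => by
    obtain ⟨i, hi⟩ := h.exists_yLow_ne_zero ⟨p, hp⟩
    rw [Finset.sum_eq_zero_iff_of_nonneg fun i _ => mul_self_nonneg _] at hc
    exact hi (mul_self_eq_zero.1 (hc i (Finset.mem_univ i)))
  have hys : ∀ i, ContDiffOn ℝ ∞ (yLow L i) U := fun i =>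
    contDiffOn_const.mul (contDiffOn_dy h.smooth i)
  have hval : ∀ p ∈ U, ∀ c : ℝ, (∀ k, τ k p = c * yLow L k p) →
      (∑ i, τ i p * yLow L i p) / (∑ i, yLow L i p * yLow L i p) = c := fun p hp c hc => by
    rw [div_eq_iff (hpos p hp), Finset.mul_sum]
    exact Finset.sum_congr rfl fun i _ => by rw [hc]; ring
  -- The quotient R / L is not available at the zeros of L. Projecting τ onto y_i in the Euclidean
  -- sense gives the same factor and is visibly smooth.
  refine ⟨fun p => (∑ i, τ i p * yLow L i p) / ∑ i, yLow L i p * yLow L i p,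
    ContDiffOn.div (ContDiffOn.sum fun i _ => (hτs i).mul (hys i))
      (ContDiffOn.sum fun i _ => (hys i).mul (hys i)) hpos, fun p hp => ?_, fun p hp k => ?_⟩
  · obtain ⟨c, h1, h2⟩ := key ⟨p, hp⟩
    simp only [hval p hp c h2]
    exact h1
  · obtain ⟨c, h1, h2⟩ := key ⟨p, hp⟩
    simp only [hval p hp c h2]
    exact h2 k

end IsLocalScalar

end LocalMetric

/-! ### Contractions with the inverse of the fundamental tensor -/

section Contraction

variable {n : ℕ}

lemma sum_inv_mul {g : Matrix (Fin n) (Fin n) ℝ} (hdet : g.det ≠ 0) (j i : Fin n) :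
    ∑ k, g⁻¹ j k * g k i = if j = i then 1 else 0 := by
  have := congrFun (congrFun (Matrix.nonsing_inv_mul g hdet.isUnit) j) i
  rwa [Matrix.mul_apply, Matrix.one_apply] at this

lemma inv_comm_of_symm {g : Matrix (Fin n) (Fin n) ℝ} (hsym : ∀ i j, g i j = g j i)
    (i j : Fin n) : g⁻¹ i j = g⁻¹ j i := by
  have h : g.transpose = g := by ext i j; exact hsym j i
  have := congrFun (congrFun (Matrix.transpose_nonsing_inv g) j) i
  rwa [h, Matrix.transpose_apply] at this

/-- The contraction that shows that the form vanishes in dimension at least three. -/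
lemma form_contract (hn : 3 ≤ n) {g : Matrix (Fin n) (Fin n) ℝ} (hdet : g.det ≠ 0)
    (hsym : ∀ i j, g i j = g j i) {y Y W : Fin n → ℝ} {w : Fin n → Fin n → ℝ}
    (hY : ∀ i, Y i = ∑ j, g i j * y j) (hW : ∀ i, W i = ∑ r, w i r * y r)
    (hskew : ∀ i j, w i j = -w j i)
    (heq : ∀ i j k, 2 * Y k * w i j = g k j * W i + Y j * w i k - g k i * W j - Y i * w j k)
    (i : Fin n) : W i = 0 := by
  have hBY : ∀ j, ∑ k, g⁻¹ j k * Y k = y j := fun j => by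
    simp only [hY, Finset.mul_sum]
    rw [Finset.sum_comm]
    simp only [← mul_assoc, ← Finset.sum_mul, sum_inv_mul hdet]
    simp
  have hB := inv_comm_of_symm hsym
  have t1 : ∑ j, ∑ k, g⁻¹ j k * (2 * Y k * w i j) = 2 * W i := by
    rw [hW, Finset.mul_sum]
    refine Finset.sum_congr rfl fun j _ => ?_
    rw [← hBY j, Finset.mul_sum, Finset.mul_sum]
    exact Finset.sum_congr rfl fun k _ => by ring
  have t2 : ∑ j, ∑ k, g⁻¹ j k * (g k j * W i) = n * W i := by
    simp only [← mul_assoc, ← Finset.sum_mul, sum_inv_mul hdet]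
    simp
  have t3 : ∑ j, ∑ k, g⁻¹ j k * (Y j * w i k) = W i := by
    rw [hW, Finset.sum_comm]
    refine Finset.sum_congr rfl fun k _ => ?_
    rw [← hBY k, Finset.mul_sum]
    exact Finset.sum_congr rfl fun j _ => by rw [hB j k]; ring
  have t4 : ∑ j, ∑ k, g⁻¹ j k * (g k i * W j) = W i := by
    simp only [← mul_assoc, ← Finset.sum_mul, sum_inv_mul hdet]
    simp
  have t5 : ∑ j, ∑ k, g⁻¹ j k * (Y i * w j k) = 0 := by
    have : ∑ j, ∑ k, g⁻¹ j k * (Y i * w j k) = -∑ j, ∑ k, g⁻¹ j k * (Y i * w j k) := by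
      conv_lhs => rw [Finset.sum_comm]
      rw [← Finset.sum_neg_distrib]
      refine Finset.sum_congr rfl fun j _ => ?_
      rw [← Finset.sum_neg_distrib]
      exact Finset.sum_congr rfl fun k _ => by rw [hB k j, hskew k j]; ring
    linarith
  simp only [heq] at t1
  simp only [mul_add, mul_sub, Finset.sum_add_distrib, Finset.sum_sub_distrib] at t1
  rw [t2, t3, t4, t5] at t1
  have hn' : (3 : ℝ) ≤ n := by exact_mod_cast hn
  -- The contracted relation is 2W = nW + W - W - 0.
  have : ((n : ℝ) - 2) * W i = 0 := by linarith
  exact (mul_eq_zero.1 this).resolve_left (by linarith)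

/-- The contraction that shows that the form of a Riemann metric vanishes. -/
lemma symm_of_contract {g : Matrix (Fin n) (Fin n) ℝ} (hdet : g.det ≠ 0)
    (hsym : ∀ i j, g i j = g j i) {t : Fin n → Fin n → ℝ}
    (heq : ∀ i j k l, t i k * g l j + t i l * g k j = t j k * g l i + t j l * g k i)
    (i k : Fin n) : t i k = t k i := by
  have hB := inv_comm_of_symm hsym
  -- Contracting j with l shows that t is a multiple of the symmetric matrix g.
  have key : ∀ i k, n * t i k = (∑ j, ∑ l, g⁻¹ j l * t j l) * g k i := fun i k => by
    have t1 : ∑ j, ∑ l, g⁻¹ j l * (t i k * g l j) = n * t i k := by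
      simp only [mul_comm (t i k), ← mul_assoc, ← Finset.sum_mul, sum_inv_mul hdet]
      simp
    have t2 : ∑ j, ∑ l, g⁻¹ j l * (t i l * g k j) = t i k := by
      rw [Finset.sum_comm]
      have : ∀ l, ∑ j, g⁻¹ j l * (t i l * g k j) = if l = k then t i l else 0 := fun l => by
        rw [← mul_boole, ← sum_inv_mul hdet l k, Finset.mul_sum]
        exact Finset.sum_congr rfl fun j _ => by rw [hB j l, hsym k j]; ring
      simp [this]
    have t3 : ∑ j, ∑ l, g⁻¹ j l * (t j k * g l i) = t i k := by
      simp only [mul_comm (t _ k), ← mul_assoc, ← Finset.sum_mul, sum_inv_mul hdet]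
      simp
    have t4 : ∑ j, ∑ l, g⁻¹ j l * (t j l * g k i) = (∑ j, ∑ l, g⁻¹ j l * t j l) * g k i := by
      simp only [Finset.sum_mul, mul_assoc]
    have : ∑ j, ∑ l, g⁻¹ j l * (t i k * g l j + t i l * g k j)
        = ∑ j, ∑ l, g⁻¹ j l * (t j k * g l i + t j l * g k i) := by simp only [heq i _ k]
    simp only [mul_add, Finset.sum_add_distrib] at this
    rw [t1, t2, t3, t4] at this
    linarith
  have hn : (n : ℝ) ≠ 0 := by
    have := i.pos
    positivity
  refine mul_left_cancel₀ hn ?_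
  rw [key, key, hsym]

end Contraction

/-! ### The condition on the 2-form in a chart, and dimension at least three -/

section LocalMetric

open TopologicalSpace (Opens)
open SmoothRing

variable {n : ℕ} {U : Opens (Coord n)} {L R lam : Coord n → ℝ} {τ : Fin n → Coord n → ℝ}
  {w : Fin n → Fin n → E n → ℝ}

/-- `R = lam L` and `τ_k = lam y_k`, with `lam` smooth. -/
structure IsLocalFlag (U : Opens (Coord n)) (L R : Coord n → ℝ) (τ : Fin n → Coord n → ℝ)
    (lam : Coord n → ℝ) : Prop where
  smooth : ContDiffOn ℝ ∞ lam U
  eq_R : ∀ p ∈ U, R p = lam p * L p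
  eq_τ : ∀ p ∈ U, ∀ k, τ k p = lam p * yLow L k p

lemma dy_comp_fst {f : E n → ℝ} (hf : ContDiffOn ℝ ∞ (fun p : Coord n => f p.1) U) (k : Fin n)
    {p : Coord n} (hp : p ∈ U) : dy k (fun p : Coord n => f p.1) p = 0 := by
  have h1 := (differentiableAt hf ⟨p, hp⟩).hasFDerivAt
  have hc : HasDerivAt (fun t : ℝ => ((p.1, p.2 + t • e k) : Coord n)) (0, e k) 0 := by
    refine (hasDerivAt_const _ _).prodMk ?_
    simpa using ((hasDerivAt_id (0 : ℝ)).smul_const (e k)).const_add p.2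
  have h2 : HasFDerivAt (fun p : Coord n => f p.1) (fderiv ℝ (fun p : Coord n => f p.1) p)
      ((fun t : ℝ => ((p.1, p.2 + t • e k) : Coord n)) 0) := by simpa using h1
  have h3 := h2.comp_hasDerivAt (0 : ℝ) hc
  have h4 : HasDerivAt (fun _ : ℝ => f p.1) (dy k (fun p : Coord n => f p.1) p) 0 := h3
  exact h4.unique (hasDerivAt_const _ _)

namespace IsLocalForm

/-- The form, with coefficients in the ring of smooth functions. -/
def coeff (hf : IsLocalForm U R τ w) (i j : Fin n) : SmoothRing U := ofFun _ (hf.smooth i j)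

lemma py_coeff (hf : IsLocalForm U R τ w) (i j k : Fin n) :
    (frame U).py k (hf.coeff i j) = 0 := by
  refine ext_ev fun u => ?_
  rw [coeff, py_mk, ev_mk, dy_comp_fst (hf.smooth i j) k u.2, map_zero]

lemma coeff_skew (hf : IsLocalForm U R τ w) (i j : Fin n) : hf.coeff i j = -hf.coeff j i :=
  ext_ev fun u => hf.skew i j u u.2

/-- With R = λL and 2τ_i = λ L_{.i} the terms λ L_{.i} of R_{.i} - 2τ_i cancel. This is the form in
which (*) is used from here on. -/
lemma L_mul_py (hf : IsLocalForm U R τ w) (h : IsLocalMetric U L) (hl : IsLocalFlag U L R τ lam)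
    (i : Fin n) : h.metric * (frame U).py i (ofFun lam hl.smooth)
      = ∑ r, hf.coeff i r * (frame U).y r := by
  have hR : ContDiffOn ℝ ∞ R U := (hl.smooth.mul h.smooth).congr hl.eq_R
  have e : ofFun R hR = ofFun lam hl.smooth * h.metric :=
    ext_ev fun u => hl.eq_R u u.2
  have e2 := congrArg ((frame U).py i) e
  refine ext_ev fun u => ?_
  have e3 := congrArg (ev u) e2
  rw [Derivation.leibniz] at e3
  simp only [IsLocalMetric.metric, py_mk, map_add, map_mul, smul_eq_mul, ev_mk, map_sum, coeff,
    ev_y] at e3 ⊢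
  rw [← hf.eq i u u.2, hl.eq_τ u u.2, e3, yLow]
  ring

lemma L_mul_dy (hf : IsLocalForm U R τ w) (h : IsLocalMetric U L) (hl : IsLocalFlag U L R τ lam)
    (i : Fin n) {p : Coord n} (hp : p ∈ U) :
    L p * dy i lam p = ∑ r, w i r p.1 * p.2 r := by
  have := congrArg (ev ⟨p, hp⟩) (hf.L_mul_py h hl i)
  simpa only [IsLocalMetric.metric, py_mk, map_mul, ev_mk, map_sum, coeff, ev_y] using this

/-- If the form vanishes, then the flag curvature does not depend on the direction. -/
lemma dy_flag_eq_zero (hf : IsLocalForm U R τ w) (h : IsLocalMetric U L)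
    (hl : IsLocalFlag U L R τ lam) (hw : ∀ i j, ∀ p ∈ U, w i j p.1 = 0) (i : Fin n)
    {p : Coord n} (hp : p ∈ U) : dy i lam p = 0 := by
  -- At a zero of L the equation L λ_{.i} = 0 is empty, but its derivative still gives L_{.j} λ_{.i}
  -- = 0, and some L_{.j} is non-zero.
  by_cases hL : L p = 0
  · obtain ⟨j, hj⟩ := h.exists_yLow_ne_zero ⟨p, hp⟩
    have := congrArg (ev ⟨p, hp⟩) (CoordFrame.form_eq_hess hf.py_coeff (hf.L_mul_py h hl) i j)
    simp only [IsLocalMetric.metric, py_mk, map_add, map_mul, ev_mk, coeff, hw i j p hp, hL,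
      zero_mul, add_zero] at this
    simp only [yLow] at hj
    refine (mul_eq_zero.1 this.symm).resolve_left fun h0 => hj ?_
    rw [h0, mul_zero]
  · have := hf.L_mul_dy h hl i hp
    simp only [hw i _ p hp, zero_mul, Finset.sum_const_zero] at this
    exact (mul_eq_zero.1 this).resolve_left hL

/-- In dimension at least three, the form vanishes. -/
theorem eq_zero_of_three_le (hf : IsLocalForm U R τ w) (h : IsLocalMetric U L)
    (hl : IsLocalFlag U L R τ lam) (hn : 3 ≤ n) (i j : Fin n) {p : Coord n} (hp : p ∈ U) :
    w i j p.1 = 0 := by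
  have hW : ∑ r, hf.coeff i r * (frame U).y r = 0 := ext_ev fun u => by
    have hsym : ∀ i j, fundTensor L u i j = fundTensor L u j i := fun i j => by
      simp only [fundTensor, Matrix.of_apply, dy_dy_comm h.smooth i j u.2]
    have := form_contract hn (h.nondeg u u.2) hsym (fun i => h.yLow_eq_sum u i)
      (fun i => rfl) (fun i j => hf.skew i j u u.2) (fun i j k => ?_) i
    · simpa only [map_sum, map_mul, coeff, ev_mk, ev_y, map_zero] using this
    · have := congrArg (ev u)
        (CoordFrame.two_mul_py_mul_form hf.py_coeff hf.coeff_skew (hf.L_mul_py h hl) i j k)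
      simp only [IsLocalMetric.metric, py_mk, map_add, map_sub, map_mul, ev_mk, coeff, map_ofNat,
        map_sum, ev_y] at this
      simp only [yLow, fundTensor, Matrix.of_apply]
      linear_combination (1 / 2) * this
  -- The contraction only shows ω_{ir} y^r = 0; the y^j-derivative recovers ω_{ij}.
  have := congrArg ((frame U).py j) hW
  rw [CoordFrame.py_sum_form hf.py_coeff, map_zero] at this
  simpa only [coeff, ev_mk, map_zero] using congrArg (ev ⟨p, hp⟩) this

end IsLocalForm

lemma IsLocalFlag.two_mul_riem (hl : IsLocalFlag U L R τ lam) (h : IsLocalMetric U L)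
    (hs : IsLocalScalar U L R τ) (i k : Fin n) :
    2 * (frame U).riem h.coeff i k = ofFun lam hl.smooth *
      (2 * h.metric * (if i = k then 1 else 0) - (frame U).y i * (frame U).py k h.metric) := by
  refine ext_ev fun u => ?_
  simp only [IsLocalMetric.metric, py_mk, map_sub, map_mul, ev_mk, map_ofNat, ev_y, h.ev_riem,
    hs.eq u u.2, hl.eq_R u u.2, hl.eq_τ u u.2, yLow]
  split_ifs <;> simp <;> ring

/-- Schur's lemma in coordinates. -/
theorem IsLocalFlag.dx_eq_zero (hl : IsLocalFlag U L R τ lam) (h : IsLocalMetric U L)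
    (hs : IsLocalScalar U L R τ) (hn : 3 ≤ n) (hlam : ∀ i, ∀ p ∈ U, dy i lam p = 0) (i : Fin n)
    {p : Coord n} (hp : p ∈ U) : dx i lam p = 0 := by
  have := h.isMetricSpray.px_eq_zero hn h.nondegenerate (lam := ofFun lam hl.smooth)
    (fun i => ext_ev fun u => by rw [py_mk, ev_mk, hlam i u u.2, map_zero])
    (hl.two_mul_riem h hs) i
  simpa only [px_mk, ev_mk, map_zero] using congrArg (ev ⟨p, hp⟩) this

end LocalMetric

/-! ### Riemann metrics on surfaces -/

section Riemannian

open TopologicalSpace (Opens)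
open SmoothRing

variable {U : Opens (Coord 2)} {L R lam : Coord 2 → ℝ} {τ : Fin 2 → Coord 2 → ℝ}
  {w : Fin 2 → Fin 2 → E 2 → ℝ}

/-- The form of a Riemann metric on a surface vanishes. -/
theorem IsLocalForm.eq_zero_of_quadratic (hf : IsLocalForm U R τ w) (h : IsLocalMetric U L)
    (hs : IsLocalScalar U L R τ) (hl : IsLocalFlag U L R τ lam)
    (hq : ∀ i j k, ∀ p ∈ U, dy k (dy j (dy i L)) p = 0) (i j : Fin 2) {p : Coord 2}
    (hp : p ∈ U) : w i j p.1 = 0 := by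
  set Φ := frame U with hΦ
  have hR : ContDiffOn ℝ ∞ R U := (hl.smooth.mul h.smooth).congr hl.eq_R
  have hL2 : Φ.VertDeg 2 h.metric := fun i j k => ext_ev fun u => by
    rw [IsLocalMetric.metric, hΦ, py_mk, py_mk, py_mk, ev_mk, hq i j k u u.2, map_zero]
  have hG := fun i => h.isMetricSpray.vertDeg_two hL2 h.nondegenerate i
  have hR2 : Φ.VertDeg 2 (ofFun R hR) := by
    -- The trace of the curvature is (n - 1) R, which is R for n = 2.
    have : ofFun R hR = ∑ i, Φ.riem h.coeff i i := ext_ev fun u => by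
      have := hs.sum_mul_y h u
      rw [Fin.sum_univ_two] at this
      rw [ev_mk, map_sum, Fin.sum_univ_two, hΦ, h.ev_riem, h.ev_riem, hs.eq u u.2, hs.eq u u.2]
      simp
      linarith
    rw [this]
    exact CoordFrame.VertDeg.sum fun i _ => CoordFrame.VertDeg.riem hG i i
  -- `T i` is `2 τ_i`
  set T : Fin 2 → SmoothRing U := fun i => Φ.py i (ofFun R hR) - ∑ r, hf.coeff i r * Φ.y r with hT
  have hTeq : ∀ i, T i = ofFun lam hl.smooth * Φ.py i h.metric := fun i => ext_ev fun u => by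
    simp only [hT, IsLocalMetric.metric, IsLocalForm.coeff, hΦ, py_mk, map_sub, map_mul, map_sum,
      ev_mk, ev_y]
    rw [← hf.eq i u u.2, hl.eq_τ u u.2, yLow]
    ring
  have hTdeg : ∀ i j k, Φ.py k (Φ.py j (T i)) = 0 := fun i j k => by
    have h1 : Φ.py j (T i) = Φ.py j (Φ.py i (ofFun R hR)) - hf.coeff i j := by
      rw [hT, map_sub, CoordFrame.py_sum_form hf.py_coeff]
    rw [h1, map_sub, hf.py_coeff, hR2 i j k, sub_zero]
  have e0 : ∀ i j, T i * Φ.py j h.metric = T j * Φ.py i h.metric := fun i j => by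
    rw [hTeq, hTeq]; ring
  -- T_i and L_{.j} are both affine in y, so two derivatives of T_i L_{.j} = T_j L_{.i} leave only
  -- products of first derivatives. `symm_of_contract` then makes T_{i.j} = R_{.i.j} - ω_{ij}
  -- symmetric, and ω is skew.
  have e2 : ∀ i j k l, Φ.py k (T i) * Φ.py l (Φ.py j h.metric)
      + Φ.py l (T i) * Φ.py k (Φ.py j h.metric)
      = Φ.py k (T j) * Φ.py l (Φ.py i h.metric) + Φ.py l (T j) * Φ.py k (Φ.py i h.metric) :=
    fun i j k l => by
    have := congrArg (fun f => Φ.py l (Φ.py k f)) (e0 i j)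
    simp only [Derivation.leibniz, smul_eq_mul, map_add, hTdeg, hL2 _ k l, mul_zero,
      zero_add] at this
    linear_combination this
  have hsym : ∀ i j, fundTensor L p i j = fundTensor L p j i := fun i j => by
    simp only [fundTensor, Matrix.of_apply, dy_dy_comm h.smooth i j hp]
  have hTsym := symm_of_contract (h.nondeg p hp) hsym
    (t := fun i k => ev ⟨p, hp⟩ (Φ.py k (T i))) (fun i j k l => by
      have := congrArg (ev ⟨p, hp⟩) (e2 i j k l)
      simp only [IsLocalMetric.metric, hΦ, py_mk, map_add, map_mul, ev_mk] at this
      simp only [fundTensor, Matrix.of_apply]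
      linear_combination (1 / 2) * this) i j
  have h1 : ∀ i j, ev ⟨p, hp⟩ (Φ.py j (T i)) = dy j (dy i R) p - w i j p.1 := fun i j => by
    rw [hT, map_sub, CoordFrame.py_sum_form hf.py_coeff, map_sub, hΦ, py_mk, py_mk]
    rfl
  simp only [h1] at hTsym
  rw [dy_dy_comm hR i j hp, hf.skew j i p hp] at hTsym
  linarith

end Riemannian

/-! ### Area density, Cartan tensor and main scalar of a surface -/

section Surface

open TopologicalSpace (Opens)
open SmoothRing

variable {U : Opens (Coord 2)} {L R lam : Coord 2 → ℝ} {τ : Fin 2 → Coord 2 → ℝ}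
  {w : Fin 2 → Fin 2 → E 2 → ℝ}

/-- `√|det g|`. -/
noncomputable def rootDet (L : Coord 2 → ℝ) (p : Coord 2) : ℝ :=
  Real.sqrt (epsSign L p * (fundTensor L p).det)

namespace IsLocalMetric

lemma fundTensor_symm {n : ℕ} {U : Opens (Coord n)} {L : Coord n → ℝ} (h : IsLocalMetric U L)
    {p : Coord n} (hp : p ∈ U) (i j : Fin n) : fundTensor L p i j = fundTensor L p j i := by
  simp only [fundTensor, Matrix.of_apply, dy_dy_comm h.smooth i j hp]

lemma epsSign_mul_self (h : IsLocalMetric U L) {p : Coord 2} (hp : p ∈ U) :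
    epsSign L p * epsSign L p = 1 := by
  rcases Real.sign_apply_eq_of_ne_zero _ (h.nondeg p hp) with h1 | h1 <;> simp [epsSign, h1]

lemma epsSign_mul_det_pos (h : IsLocalMetric U L) {p : Coord 2} (hp : p ∈ U) :
    0 < epsSign L p * (fundTensor L p).det :=
  Real.sign_mul_pos_of_ne_zero _ (h.nondeg p hp)

lemma rootDet_pos (h : IsLocalMetric U L) {p : Coord 2} (hp : p ∈ U) : 0 < rootDet L p :=
  Real.sqrt_pos.2 (h.epsSign_mul_det_pos hp)

lemma rootDet_mul_self (h : IsLocalMetric U L) {p : Coord 2} (hp : p ∈ U) :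
    rootDet L p * rootDet L p = epsSign L p * (fundTensor L p).det :=
  Real.mul_self_sqrt (h.epsSign_mul_det_pos hp).le

lemma det_eq (h : IsLocalMetric U L) {p : Coord 2} (hp : p ∈ U) :
    (fundTensor L p).det = epsSign L p * (rootDet L p * rootDet L p) := by
  rw [h.rootDet_mul_self hp, ← mul_assoc, h.epsSign_mul_self hp, one_mul]

lemma smooth_fundTensor {n : ℕ} {U : Opens (Coord n)} {L : Coord n → ℝ} (h : IsLocalMetric U L)
    (i j : Fin n) : ContDiffOn ℝ ∞ (fun p => fundTensor L p i j) U :=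
  contDiffOn_const.mul (contDiffOn_dy (contDiffOn_dy h.smooth j) i)

lemma smooth_det (h : IsLocalMetric U L) : ContDiffOn ℝ ∞ (fun p => (fundTensor L p).det) U := by
  simp only [Matrix.det_fin_two]
  exact ((h.smooth_fundTensor 0 0).mul (h.smooth_fundTensor 1 1)).sub
    ((h.smooth_fundTensor 0 1).mul (h.smooth_fundTensor 1 0))

lemma smooth_epsSign (h : IsLocalMetric U L) : ContDiffOn ℝ ∞ (epsSign L) U := by
  intro p hp
  have hc : ContinuousAt (fun p => (fundTensor L p).det) p :=
    (h.smooth_det.continuousOn).continuousAt (U.isOpen.mem_nhds hp)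
  refine ContDiffAt.contDiffWithinAt ?_
  rcases lt_or_gt_of_ne (h.nondeg p hp) with hd | hd
  · refine (contDiffAt_const (c := (-1 : ℝ))).congr_of_eventuallyEq ?_
    filter_upwards [hc.eventually (gt_mem_nhds hd)] with q hq
    exact Real.sign_of_neg hq
  · refine (contDiffAt_const (c := (1 : ℝ))).congr_of_eventuallyEq ?_
    filter_upwards [hc.eventually (lt_mem_nhds hd)] with q hq
    exact Real.sign_of_pos hq

lemma smooth_rootDet (h : IsLocalMetric U L) : ContDiffOn ℝ ∞ (rootDet L) U :=
  (h.smooth_epsSign.mul h.smooth_det).sqrt fun _ hp => (h.epsSign_mul_det_pos hp).ne'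

lemma normF_mul_self {p : Coord 2} (hL : 0 < L p) : normF L p * normF L p = L p :=
  Real.mul_self_sqrt hL.le

lemma normF_pos {p : Coord 2} (hL : 0 < L p) : 0 < normF L p := Real.sqrt_pos.2 hL

lemma L_eq (h : IsLocalMetric U L) {p : Coord 2} (hp : p ∈ U) :
    L p = fundTensor L p 0 0 * p.2 0 ^ 2 + 2 * fundTensor L p 0 1 * p.2 0 * p.2 1
      + fundTensor L p 1 1 * p.2 1 ^ 2 := by
  have h1 := h.sum_yLow_mul ⟨p, hp⟩
  have h2 := h.fundTensor_symm hp 1 0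
  simp only [h.yLow_eq_sum ⟨p, hp⟩, Fin.sum_univ_two] at h1
  rw [← h1, h2]
  ring

/-- `m_i = ε √|g| (-y², y¹) / F`. -/
lemma mLow_eq (h : IsLocalMetric U L) {p : Coord 2} (hp : p ∈ U) (hL : 0 < L p) (i : Fin 2) :
    mLow L i p * normF L p = epsSign L p * rootDet L p * ![-p.2 1, p.2 0] i := by
  have hq := h.rootDet_pos hp
  have hF := normF_pos hL
  have hd := h.det_eq hp
  have h2 := h.fundTensor_symm hp 1 0
  have y0 := h.yLow_eq_sum ⟨p, hp⟩ 0
  have y1 := h.yLow_eq_sum ⟨p, hp⟩ 1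
  simp only [Fin.sum_univ_two] at y0 y1
  rw [Matrix.det_fin_two, h2] at hd
  rw [h2] at y1
  have hm : ∀ i, mUp L i p = (rootDet L p)⁻¹ * ![-ellLow L 1 p, ellLow L 0 p] i := fun i => rfl
  fin_cases i
  · simp [mLow, Fin.sum_univ_two, hm, ellLow, y0, y1]
    field_simp
    linear_combination (-p.2 1) * hd
  · simp [mLow, Fin.sum_univ_two, hm, ellLow, y0, y1, h2]
    field_simp
    linear_combination (p.2 0) * hd

lemma dy_rootDet_mul (h : IsLocalMetric U L) {p : Coord 2} (hp : p ∈ U) (i : Fin 2) :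
    rootDet L p * dy i (rootDet L) p = epsSign L p * (cartan L 0 0 i p * fundTensor L p 1 1
      + fundTensor L p 0 0 * cartan L 1 1 i p - 2 * fundTensor L p 0 1 * cartan L 0 1 i p) := by
  set g : Fin 2 → Fin 2 → SmoothRing U := fun i j => ofFun _ (h.smooth_fundTensor i j) with hg
  have hε : ofFun _ h.smooth_epsSign * ofFun _ h.smooth_epsSign = (1 : SmoothRing U) :=
    ext_ev fun u => h.epsSign_mul_self u.2
  have hsym : g 1 0 = g 0 1 := ext_ev fun u => h.fundTensor_symm u.2 1 0
  have e1 : ofFun _ h.smooth_rootDet * ofFun _ h.smooth_rootDet =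
      ofFun _ h.smooth_epsSign * (g 0 0 * g 1 1 - g 0 1 * g 0 1) := by
    rw [← hsym]
    conv_rhs => rw [hsym]
    refine ext_ev fun u => ?_
    rw [map_mul, ev_mk, h.rootDet_mul_self u.2, Matrix.det_fin_two, h.fundTensor_symm u.2 1 0]
    rfl
  have e2 := congrArg (fun f => ev ⟨p, hp⟩ ((frame U).py i f)) e1
  simp only [Derivation.leibniz, CoordFrame.derivation_sign _ hε, map_sub, map_add, map_mul,
    smul_eq_mul, hg, py_mk, ev_mk, mul_zero, add_zero] at e2
  simp only [cartan]
  linear_combination (1 / 2) * e2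

/-- The vertical derivative of `√|g|` in terms of the main scalar. -/
lemma dy_rootDet (h : IsLocalMetric U L) {p : Coord 2} (hp : p ∈ U) (hL : 0 < L p) {s : ℝ}
    (hs : IsMainScalarAt L p s) (i : Fin 2) :
    dy i (rootDet L) p * L p = s * (rootDet L p * rootDet L p) * ![-p.2 1, p.2 0] i := by
  have hq := (h.rootDet_pos hp).ne'
  have hF := (normF_pos hL).ne'
  have hFF := normF_mul_self hL
  have hε := h.epsSign_mul_self hp
  have m0 := h.mLow_eq hp hL 0
  have m1 := h.mLow_eq hp hL 1
  have mi := h.mLow_eq hp hL i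
  simp only [Matrix.cons_val_zero, Matrix.cons_val_one] at m0 m1
  set q := rootDet L p
  set F := normF L p
  set ε := epsSign L p
  -- Inserting F C_{ijk} = s m_i m_j m_k in the derivative of the determinant reproduces the
  -- quadratic form g_{ij} y^i y^j, which is L.
  have hLq := h.L_eq hp
  have c := h.dy_rootDet_mul hp i
  have c00 := hs 0 0 i
  have c11 := hs 1 1 i
  have c01 := hs 0 1 i
  set u := ![-p.2 1, p.2 0] i
  have hm0 : mLow L 0 p = ε * q * -p.2 1 / F := by rw [← m0]; field_simp
  have hm1 : mLow L 1 p = ε * q * p.2 0 / F := by rw [← m1]; field_simp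
  have hmi : mLow L i p = ε * q * u / F := by rw [← mi]; field_simp
  have k00 : cartan L 0 0 i p
      = s * (ε * q * -p.2 1 / F) * (ε * q * -p.2 1 / F) * (ε * q * u / F) / F := by
    rw [← hm0, ← hmi, eq_div_iff hF, mul_comm]; exact c00
  have k11 : cartan L 1 1 i p
      = s * (ε * q * p.2 0 / F) * (ε * q * p.2 0 / F) * (ε * q * u / F) / F := by
    rw [← hm1, ← hmi, eq_div_iff hF, mul_comm]; exact c11
  have k01 : cartan L 0 1 i p
      = s * (ε * q * -p.2 1 / F) * (ε * q * p.2 0 / F) * (ε * q * u / F) / F := by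
    rw [← hm0, ← hm1, ← hmi, eq_div_iff hF, mul_comm]; exact c01
  apply mul_left_cancel₀ hq
  have hF4 : F ^ 4 = L p * L p := by rw [← hFF]; ring
  have hL0 := hL.ne'
  calc q * (dy i (rootDet L) p * L p) = (q * dy i (rootDet L) p) * L p := by ring
    _ = (ε * ε) * (ε * ε) * s * q ^ 3 * u * (fundTensor L p 0 0 * p.2 0 ^ 2
        + 2 * fundTensor L p 0 1 * p.2 0 * p.2 1 + fundTensor L p 1 1 * p.2 1 ^ 2) * L p
          / F ^ 4 := by
        rw [c, k00, k11, k01]; field_simp; ring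
    _ = q * (s * (q * q) * u) := by
        rw [← hLq, hε, hF4]; field_simp

lemma ofFun_fundTensor (h : IsLocalMetric U L) (i j : Fin 2) : ofFun _ (h.smooth_fundTensor i j)
    = algebraMap ℝ _ (1 / 2) * (frame U).py i ((frame U).py j h.metric) := by
  refine ext_ev fun u => ?_
  rw [metric, py_mk, py_mk, map_mul, AlgHom.commutes]
  rfl

lemma cartan_mul_y (h : IsLocalMetric U L) {p : Coord 2} (hp : p ∈ U) (i j : Fin 2) :
    cartan L i j 0 p * p.2 0 + cartan L i j 1 p * p.2 1 = 0 := by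
  have e1 := h.ofFun_fundTensor i j
  have e2 : (frame U).euler (ofFun _ (h.smooth_fundTensor i j)) = 0 := by
    rw [e1, Derivation.leibniz, h.isMetricSpray.euler_py_py, Derivation.map_algebraMap]
    simp
  have e3 := congrArg (ev ⟨p, hp⟩) e2
  rw [CoordFrame.euler_apply, Fin.sum_univ_two] at e3
  simp only [py_mk, map_add, map_mul, ev_mk, ev_y, map_zero] at e3
  simp only [cartan]
  linear_combination (1 / 2) * e3

lemma cartan_eq (i j k : Fin 2) (p : Coord 2) (h : IsLocalMetric U L) (hp : p ∈ U) :
    cartan L i j k p = 1 / 4 * dy k (dy i (dy j L)) p := by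
  have e1 := h.ofFun_fundTensor i j
  have e3 := congrArg (fun f => ev ⟨p, hp⟩ ((frame U).py k f)) e1
  simp only [Derivation.leibniz, Derivation.map_algebraMap, py_mk, metric, smul_eq_mul, mul_zero,
    add_zero, map_mul, ev_mk, AlgHom.commutes] at e3
  rw [cartan, e3, Algebra.algebraMap_self_apply]
  ring

/-- On a surface, the main scalar exists. -/
lemma exists_mainScalar (h : IsLocalMetric U L) {p : Coord 2} (hp : p ∈ U) (hL : 0 < L p) :
    ∃ s, IsMainScalarAt L p s := by
  have s12 : ∀ i j k, cartan L i j k p = cartan L j i k p := fun i j k => by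
    have e := congrArg (fun f => ev ⟨p, hp⟩ ((frame U).py k f))
      ((frame U).py_py_apply i j h.metric)
    simp only [py_mk, metric, ev_mk] at e
    rw [cartan_eq i j k p h hp, cartan_eq j i k p h hp, e]
  have s23 : ∀ i j k, cartan L i j k p = cartan L k j i p := fun i j k => by
    rw [cartan_eq i j k p h hp, cartan_eq k j i p h hp,
      dy_dy_comm (contDiffOn_dy h.smooth j) k i hp]
  have e00 := h.cartan_mul_y hp 0 0
  have e01 := h.cartan_mul_y hp 0 1
  have e11 := h.cartan_mul_y hp 1 1
  have a1 : cartan L 0 1 0 p = cartan L 0 0 1 p := by rw [s12 0 1 0, s23 1 0 0]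
  have a2 : cartan L 1 0 0 p = cartan L 0 0 1 p := s23 1 0 0
  have a3 : cartan L 1 0 1 p = cartan L 0 1 1 p := s12 1 0 1
  have a4 : cartan L 1 1 0 p = cartan L 0 1 1 p := s23 1 1 0
  rw [a1] at e01
  rw [a4] at e11
  -- A symmetric tensor in two dimensions that is annihilated by y is a multiple of the cube of the
  -- covector (-y², y¹).
  have hc : ∃ c, ∀ i j k, cartan L i j k p
      = c * ![-p.2 1, p.2 0] i * ![-p.2 1, p.2 0] j * ![-p.2 1, p.2 0] k := by
    by_cases hy : p.2 1 = 0
    · have hy0 : p.2 0 ≠ 0 := fun h0 => h.ne_zero p hp (by ext i; fin_cases i <;> simp [hy, h0])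
      rw [hy, mul_zero, add_zero] at e00 e01 e11
      have b0 := (mul_eq_zero.1 e00).resolve_right hy0
      have b1 := (mul_eq_zero.1 e01).resolve_right hy0
      have b2 := (mul_eq_zero.1 e11).resolve_right hy0
      refine ⟨cartan L 1 1 1 p / p.2 0 ^ 3, fun i j k => ?_⟩
      fin_cases i <;> fin_cases j <;> fin_cases k <;>
        simp [a1, a2, a3, a4, b0, b1, b2, hy]
      field_simp
    · have b1 : cartan L 0 0 1 p = -cartan L 0 0 0 p * p.2 0 / p.2 1 := by
        field_simp; linear_combination e00
      have b2 : cartan L 0 1 1 p = -cartan L 0 0 1 p * p.2 0 / p.2 1 := by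
        field_simp; linear_combination e01
      have b3 : cartan L 1 1 1 p = -cartan L 0 1 1 p * p.2 0 / p.2 1 := by
        field_simp; linear_combination e11
      refine ⟨-cartan L 0 0 0 p / p.2 1 ^ 3, fun i j k => ?_⟩
      fin_cases i <;> fin_cases j <;> fin_cases k <;>
        simp [a1, a2, a3, a4, b1, b2, b3] <;> field_simp
  obtain ⟨c, hc⟩ := hc
  have hq := (h.rootDet_pos hp).ne'
  have hF := (normF_pos hL).ne'
  have hε := h.epsSign_mul_self hp
  have hε0 : epsSign L p ≠ 0 := fun h0 => by simp [h0] at hε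
  have hm : ∀ i, ![-p.2 1, p.2 0] i = mLow L i p * normF L p / (epsSign L p * rootDet L p) :=
    fun i => by rw [h.mLow_eq hp hL i]; field_simp
  refine ⟨normF L p * c * (normF L p / (epsSign L p * rootDet L p)) ^ 3, fun i j k => ?_⟩
  rw [hc, hm i, hm j, hm k]
  field_simp

end IsLocalMetric

end Surface

/-! ### Homogeneity, constant main scalar, and regular metrics on surfaces -/

section Surface

open TopologicalSpace (Opens)
open SmoothRing

variable {U : Opens (Coord 2)} {L R lam : Coord 2 → ℝ} {τ : Fin 2 → Coord 2 → ℝ}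
  {w : Fin 2 → Fin 2 → E 2 → ℝ}

/-- A function killed by the Euler field is constant along the rays. -/
lemma SmoothRing.ray_const {n : ℕ} {U : Opens (Coord n)} {F : Coord n → ℝ}
    (hF : ContDiffOn ℝ ∞ F U) (hE : (frame U).euler (ofFun F hF) = 0)
    (hcone : ∀ p ∈ U, ∀ t : ℝ, 0 < t → (p.1, t • p.2) ∈ U) {p : Coord n} (hp : p ∈ U) {t : ℝ}
    (ht : 0 < t) : F (p.1, t • p.2) = F p := by
  have hd : ∀ s ∈ Set.Ioi (0 : ℝ), HasDerivAt (fun s : ℝ => F (p.1, s • p.2)) 0 s := by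
    intro s hs
    have hu := hcone p hp s hs
    have hc : HasDerivAt (fun t : ℝ => ((p.1, t • p.2) : Coord n)) (0, p.2) s := by
      refine (hasDerivAt_const _ _).prodMk ?_
      simpa using (hasDerivAt_id s).smul_const p.2
    have hF' := (differentiableAt hF ⟨_, hu⟩).hasFDerivAt
    have h1 := hF'.comp_hasDerivAt s hc
    have h2 := congrArg (ev ⟨_, hu⟩) hE
    rw [CoordFrame.euler_apply] at h2
    simp only [map_sum, map_mul, py_mk, ev_mk, ev_y, map_zero] at h2
    have h3 : s * fderiv ℝ F (p.1, s • p.2) (0, p.2) = 0 := by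
      rw [map_snd_eq_sum, ← h2, Finset.mul_sum]
      exact Finset.sum_congr rfl fun i _ => by simp [dy]; ring
    have h4 := (mul_eq_zero.1 h3).resolve_left (ne_of_gt hs)
    rw [h4] at h1
    exact h1
  have := (convex_Ioi (0 : ℝ)).is_const_of_fderivWithin_eq_zero (𝕜 := ℝ)
    (f := fun s : ℝ => F (p.1, s • p.2))
    (fun s hs => (hd s hs).differentiableAt.differentiableWithinAt)
    (fun s hs => by
      rw [fderivWithin_of_isOpen isOpen_Ioi hs, ← toSpanSingleton_deriv, (hd s hs).deriv]
      simp) ht (Set.mem_Ioi.2 one_pos)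
  simpa using this

namespace IsLocalMetric

lemma smooth_rho (h : IsLocalMetric U L) : ContDiffOn ℝ ∞ (fun p => (2 * rootDet L p)⁻¹) U :=
  (contDiffOn_const.mul h.smooth_rootDet).inv fun p hp => by
    have := h.rootDet_pos hp
    positivity

/-- `ε`, as an element of the ring of smooth functions. -/
noncomputable def eps (h : IsLocalMetric U L) : SmoothRing U := ofFun _ h.smooth_epsSign

/-- `√|g|`, as an element of the ring of smooth functions. -/
noncomputable def root (h : IsLocalMetric U L) : SmoothRing U := ofFun _ h.smooth_rootDet

/-- `1 / (2 √|g|)`, as an element of the ring of smooth functions. -/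
noncomputable def rho (h : IsLocalMetric U L) : SmoothRing U := ofFun _ h.smooth_rho

lemma eps_mul_self (h : IsLocalMetric U L) : h.eps * h.eps = 1 :=
  ext_ev fun u => h.epsSign_mul_self u.2

lemma rho_mul_root (h : IsLocalMetric U L) : h.rho * (2 * h.root) = 1 := by
  refine ext_ev fun u => ?_
  rw [map_mul, map_mul, map_ofNat, map_one]
  have := (h.rootDet_pos u.2).ne'
  change (2 * rootDet L u)⁻¹ * (2 * rootDet L u) = 1
  field_simp

lemma eps_mul_hessDet (h : IsLocalMetric U L) :
    h.eps * (frame U).hessDet h.metric = 2 * h.root * (2 * h.root) := by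
  refine ext_ev fun u => ?_
  have := h.rootDet_mul_self u.2
  rw [Matrix.det_fin_two, h.fundTensor_symm u.2 1 0] at this
  simp only [CoordFrame.hessDet, metric, py_mk, map_mul, map_sub, map_ofNat, ev_mk, eps, root]
  simp only [fundTensor, Matrix.of_apply] at this
  linear_combination (-4) * this

lemma rho_mul_rho (h : IsLocalMetric U L) :
    h.rho * h.rho * (h.eps * (frame U).hessDet h.metric) = 1 := by
  rw [h.eps_mul_hessDet]
  linear_combination (h.rho * (2 * h.root) + 1) * h.rho_mul_root

lemma rho_mul_hessDet (h : IsLocalMetric U L) :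
    h.rho * (h.eps * (frame U).hessDet h.metric) = 2 * h.root := by
  rw [h.eps_mul_hessDet]
  linear_combination (2 * h.root) * h.rho_mul_root

/-- The main scalar, as an element of the ring of smooth functions. -/
noncomputable def scalar (h : IsLocalMetric U L) : SmoothRing U :=
  2 * h.rho * (frame U).berwald h.metric h.rho h.root

lemma berwald_rho (h : IsLocalMetric U L) :
    (frame U).berwald h.metric h.rho h.rho *
      (h.rho * (h.eps * (frame U).hessDet h.metric)) = -h.scalar := by
  rw [h.rho_mul_hessDet, scalar]
  have := congrArg ((frame U).berwald h.metric h.rho) h.rho_mul_root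
  simp only [Derivation.leibniz, derivation_two, smul_eq_mul, mul_zero, add_zero,
    Derivation.map_one_eq_zero] at this
  linear_combination this

/-- The value of the main scalar. -/
lemma ev_scalar (h : IsLocalMetric U L) (u : U) (hL : 0 < L u) {s : ℝ}
    (hs : IsMainScalarAt L u s) : ev u h.scalar = s := by
  have d0 := h.dy_rootDet u.2 hL hs 0
  have d1 := h.dy_rootDet u.2 hL hs 1
  have e1 := congrArg (ev u) h.rho_mul_root
  have e2 := congrArg (ev u) h.isMetricSpray.two_mul_L
  rw [scalar, CoordFrame.berwald_apply]
  simp only [metric, rho, root, py_mk, map_mul, map_add, map_neg, map_ofNat, ev_mk, ev_y,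
    map_one] at e1 e2 ⊢
  simp only [Matrix.cons_val_zero, Matrix.cons_val_one] at d0 d1
  apply mul_right_cancel₀ hL.ne'
  set r := (2 * rootDet L u)⁻¹
  set q := rootDet L u
  linear_combination (-2 * r * r * dy 1 L u) * d0 + (2 * r * r * dy 0 L u) * d1
    - 2 * r * r * s * q * q * e2 + s * L u * (r * (2 * q) + 1) * e1

lemma isMainScalarAt_scalar (h : IsLocalMetric U L) (u : U) (hL : 0 < L u) :
    IsMainScalarAt L u (ev u h.scalar) := by
  obtain ⟨s, hs⟩ := h.exists_mainScalar u.2 hL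
  rwa [h.ev_scalar u hL hs]

lemma euler_root (h : IsLocalMetric U L) : (frame U).euler h.root = 0 := by
  have h1 := h.isMetricSpray.euler_rho h.eps_mul_self h.rho_mul_rho
  have := congrArg (frame U).euler h.rho_mul_root
  simp only [Derivation.leibniz, derivation_two, smul_eq_mul, mul_zero, add_zero, h1,
    Derivation.map_one_eq_zero] at this
  linear_combination h.root * this - (frame U).euler h.root * h.rho_mul_root

lemma euler_scalar (h : IsLocalMetric U L) : (frame U).euler h.scalar = 0 := by
  have h1 := h.isMetricSpray.euler_rho h.eps_mul_self h.rho_mul_rho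
  have h2 : ∀ i, (frame U).euler ((frame U).py i h.root) = -(frame U).py i h.root := fun i => by
    have := congrArg (fun D => D h.root) ((frame U).lie_py_euler i)
    rw [Derivation.commutator_apply, h.euler_root, map_zero] at this
    linear_combination -this
  rw [scalar, CoordFrame.berwald_apply]
  simp only [Derivation.leibniz, derivation_two, smul_eq_mul, map_add, map_neg, h1, h2,
    h.isMetricSpray.euler_py]
  ring

lemma euler_flag (h : IsLocalMetric U L) (hpos : ∀ p ∈ U, 0 < L p)
    (hs : IsLocalScalar U L R τ) (hl : IsLocalFlag U L R τ lam) :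
    (frame U).euler (ofFun lam hl.smooth) = 0 := by
  have hR : ContDiffOn ℝ ∞ R U := (hl.smooth.mul h.smooth).congr hl.eq_R
  have e : ofFun R hR = ofFun lam hl.smooth * h.metric := ext_ev fun u => hl.eq_R u u.2
  have e2 := congrArg (frame U).euler e
  have e3 : (frame U).euler (ofFun R hR) = 2 * ofFun R hR := by
    simpa using euler_mk hR 2 hs.hom
  rw [e3, Derivation.leibniz, h.isMetricSpray.euler_L, e, smul_eq_mul, smul_eq_mul] at e2
  refine ext_ev fun u => ?_
  have e4 := congrArg (ev u) e2
  simp only [map_mul, map_add, map_ofNat] at e4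
  have hL : ev u h.metric ≠ 0 := (hpos u u.2).ne'
  apply mul_left_cancel₀ hL
  rw [map_zero, mul_zero]
  linear_combination -e4

/-- A surface with constant main scalar. -/
theorem exists_form (h : IsLocalMetric U L) (hpos : ∀ p ∈ U, 0 < L p)
    (hs : IsLocalScalar U L R τ) (hl : IsLocalFlag U L R τ lam) {c : ℝ}
    (hc : ∀ p ∈ U, IsMainScalarAt L p c ∨ IsMainScalarAt L p (-c)) :
    ∃ w : Coord 2 → ℝ, ContDiffOn ℝ ∞ w U ∧ (∀ i, ∀ p ∈ U, dy i w p = 0) ∧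
      (∀ p ∈ U, L p * dy 0 lam p = w p * p.2 1) ∧
      ∀ p ∈ U, L p * dy 1 lam p = -(w p * p.2 0) := by
  have hsq : ∀ u, ev u h.scalar = c ∨ ev u h.scalar = -c := fun u =>
    (hc u u.2).imp (h.ev_scalar u (hpos u u.2)) (h.ev_scalar u (hpos u u.2))
  -- The sign of I may differ between components of the chart domain, so I itself need not be
  -- constant there. But I² = c² is, and 2 I D I = 0 yields c² D I = 0.
  have hDI : ∀ D : Derivation ℝ (SmoothRing U) (SmoothRing U), D h.scalar = 0 := fun D => by
    have e : h.scalar * h.scalar = algebraMap ℝ _ (c * c) := ext_ev fun u => by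
      rw [map_mul, AlgHom.commutes]
      rcases hsq u with h1 | h1 <;> simp [h1]
    by_cases hc0 : c = 0
    · have : h.scalar = 0 := ext_ev fun u => by
        rcases hsq u with h1 | h1 <;> simp [h1, hc0]
      rw [this, map_zero]
    · have e2 := congrArg D e
      rw [Derivation.leibniz, Derivation.map_algebraMap, smul_eq_mul, ← two_mul] at e2
      have e3 := eq_zero_of_two_mul e2
      have e4 : algebraMap ℝ (SmoothRing U) (c * c) * D h.scalar = 0 := by
        rw [← e]; linear_combination h.scalar * e3
      have e5 : algebraMap ℝ (SmoothRing U) (c * c)⁻¹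
          * algebraMap ℝ (SmoothRing U) (c * c) = 1 := by
        rw [← map_mul, inv_mul_cancel₀ (mul_ne_zero hc0 hc0), map_one]
      calc D h.scalar = algebraMap ℝ (SmoothRing U) (c * c)⁻¹ *
          (algebraMap ℝ (SmoothRing U) (c * c) * D h.scalar) := by rw [← mul_assoc, e5, one_mul]
        _ = 0 := by rw [e4, mul_zero]
  have hLinv : ContDiffOn ℝ ∞ (fun p => (L p)⁻¹) U :=
    h.smooth.inv fun p hp => (hpos p hp).ne'
  have hL : h.metric * ofFun _ hLinv = 1 := ext_ev fun u => by
    rw [map_mul, map_one]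
    exact mul_inv_cancel₀ (hpos u u.2).ne'
  obtain ⟨W, hW, h0, h1⟩ := h.isMetricSpray.form_of_constant_mainScalar h.eps_mul_self
    h.rho_mul_rho h.euler_coeff (hl.two_mul_riem h hs) h.berwald_rho hDI hL
    (h.euler_flag hpos hs hl)
  obtain ⟨F, hF, rfl⟩ := exists_mk W
  -- The factor ½ passes from the relations for 2L λ_{.i} to those for L λ_{.i}.
  refine ⟨fun p => (1 / 2) * F p, contDiffOn_const.mul hF, fun i p hp => ?_, fun p hp => ?_,
    fun p hp => ?_⟩
  · have := congrArg (ev ⟨p, hp⟩) (hW i)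
    rw [py_mk, ev_mk, map_zero] at this
    simp only [dy] at this ⊢
    rw [fderiv_const_mul (differentiableAt hF ⟨p, hp⟩)]
    simp [this]
  · have := congrArg (ev ⟨p, hp⟩) h0
    simp only [metric, py_mk, map_mul, map_ofNat, ev_mk, ev_y] at this
    linear_combination (1 / 2) * this
  · have := congrArg (ev ⟨p, hp⟩) h1
    simp only [metric, py_mk, map_mul, map_neg, map_ofNat, ev_mk, ev_y] at this
    linear_combination (1 / 2) * this

end IsLocalMetric

lemma hasFDerivAt_fibre {n : ℕ} {U : Opens (Coord n)} {F : Coord n → ℝ}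
    (hF : ContDiffOn ℝ ∞ F U) {x y : E n} (hp : (x, y) ∈ U) :
    HasFDerivAt (fun y => F (x, y))
      ((fderiv ℝ F (x, y)).comp (ContinuousLinearMap.inr ℝ (E n) (E n))) y :=
  (differentiableAt hF ⟨_, hp⟩).hasFDerivAt.comp y (hasFDerivAt_prodMk_right x y)

/-- The form of a regular Finsler metric on a surface vanishes. -/
theorem IsLocalForm.eq_zero_of_regular (hf : IsLocalForm U R τ w) (h : IsLocalMetric U L)
    (hl : IsLocalFlag U L R τ lam) {x : E 2} (hx : ∀ y : E 2, y ≠ 0 → (x, y) ∈ U) :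
    w 0 1 x = 0 := by
  set c : ℝ → E 2 := fun t => !₂[Real.cos t, Real.sin t] with hc
  have hc0 : ∀ t, c t ≠ 0 := fun t h0 => by
    have h1 := congrArg (fun y : E 2 => y 0) h0
    have h2 := congrArg (fun y : E 2 => y 1) h0
    simp [hc] at h1 h2
    have := Real.sin_sq_add_cos_sq t
    rw [h1, h2] at this
    norm_num at this
  have hcd : ∀ t, HasDerivAt c (!₂[-Real.sin t, Real.cos t]) t := fun t => by
    have h1 : ∀ a b : ℝ, (!₂[a, b] : E 2) = a • e 0 + b • e 1 := fun a b => by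
      ext i
      fin_cases i <;> simp [e_apply]
    simp only [hc, h1]
    exact ((Real.hasDerivAt_cos t).smul_const _).add ((Real.hasDerivAt_sin t).smul_const _)
  have hd : ∀ t, HasDerivAt (fun t => lam (x, c t))
      (-Real.sin t * dy 0 lam (x, c t) + Real.cos t * dy 1 lam (x, c t)) t := fun t => by
    have h1 := (hasFDerivAt_fibre hl.smooth (hx (c t) (hc0 t))).comp_hasDerivAt t (hcd t)
    refine h1.congr_deriv ?_
    rw [ContinuousLinearMap.comp_apply, ContinuousLinearMap.inr_apply, map_snd_eq_sum,
      Fin.sum_univ_two]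
    simp [dy]
  -- Rolle's theorem on the full circle of directions. L times the derivative of λ along the circle
  -- is -ω_{12} (sin² + cos²), so a single critical point suffices.
  obtain ⟨t, -, ht⟩ := exists_hasDerivAt_eq_zero (f := fun t => lam (x, c t))
    (a := 0) (b := 2 * Real.pi) Real.two_pi_pos
    (fun t _ => (hd t).continuousAt.continuousWithinAt) (by simp [hc]) fun t _ => hd t
  have hp := hx (c t) (hc0 t)
  have e0 := hf.L_mul_dy h hl 0 hp
  have e1 := hf.L_mul_dy h hl 1 hp
  have s0 := hf.skew 0 0 _ hp
  have s1 := hf.skew 1 1 _ hp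
  have s2 := hf.skew 1 0 _ hp
  simp only [Fin.sum_univ_two] at e0 e1
  simp only [hc] at *
  simp at e0 e1 ht
  have s0' : w 0 0 x = 0 := by linarith
  have s1' : w 1 1 x = 0 := by linarith
  rw [s0'] at e0
  rw [s1', s2] at e1
  have hsc := Real.sin_sq_add_cos_sq t
  linear_combination (-w 0 1 x) * hsc - Real.sin t * e0 + Real.cos t * e1
    - L (x, !₂[Real.cos t, Real.sin t]) * ht

end Surface

/-! ### The Landsberg angle and the differential equation for the flag curvature -/

section Angle

open TopologicalSpace (Opens)
open SmoothRing

variable {U : Opens (Coord 2)} {L R lam : Coord 2 → ℝ} {τ : Fin 2 → Coord 2 → ℝ}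
  {w : Fin 2 → Fin 2 → E 2 → ℝ}

/-- The density `ε √|g| / L` of the Landsberg angle. -/
noncomputable def angleDensity (L : Coord 2 → ℝ) (p : Coord 2) : ℝ :=
  epsSign L p * rootDet L p / L p

/-- The area form `y¹ dy² - y² dy¹`. -/
noncomputable def areaForm (y : E 2) : E 2 →L[ℝ] ℝ :=
  y 0 • EuclideanSpace.proj 1 - y 1 • EuclideanSpace.proj 0

lemma areaForm_apply (y v : E 2) : areaForm y v = y 0 * v 1 - y 1 * v 0 := by
  simp [areaForm]

lemma areaForm_e (y : E 2) (i : Fin 2) : areaForm y (e i) = ![-y 1, y 0] i := by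
  fin_cases i <;> simp [areaForm_apply, e_apply]

lemma continuous_areaForm : Continuous areaForm := by
  unfold areaForm
  fun_prop

lemma areaForm_ne_zero {y : E 2} (hy : y ≠ 0) : ∃ i, areaForm y (e i) ≠ 0 := by
  by_contra hc
  push Not at hc
  have h0 := hc 0
  have h1 := hc 1
  simp [areaForm_e] at h0 h1
  exact hy (by ext i; fin_cases i <;> simp [h0, h1])

lemma clm_ext_e {n : ℕ} {A B : E n →L[ℝ] ℝ} (h : ∀ i, A (e i) = B (e i)) : A = B := by
  ext v
  rw [← sum_smul_e v, map_sum, map_sum]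
  simp [h]

lemma IsLocalMetric.mLow_div (h : IsLocalMetric U L) {p : Coord 2} (hp : p ∈ U) (hL : 0 < L p)
    (i : Fin 2) : mLow L i p / normF L p = angleDensity L p * areaForm p.2 (e i) := by
  have h1 := h.mLow_eq hp hL i
  have h2 := IsLocalMetric.normF_mul_self hL
  have hF := (IsLocalMetric.normF_pos hL).ne'
  rw [areaForm_e, angleDensity, ← h2]
  field_simp
  rw [h1]

lemma IsLocalMetric.angleDensity_ne_zero (h : IsLocalMetric U L) {p : Coord 2} (hp : p ∈ U)
    (hL : 0 < L p) : angleDensity L p ≠ 0 := by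
  have hε := h.epsSign_mul_self hp
  have hε0 : epsSign L p ≠ 0 := fun h0 => by simp [h0] at hε
  exact div_ne_zero (mul_ne_zero hε0 (h.rootDet_pos hp).ne') hL.ne'

lemma IsLocalMetric.smooth_angleDensity (h : IsLocalMetric U L) (hpos : ∀ p ∈ U, 0 < L p) :
    ContDiffOn ℝ ∞ (angleDensity L) U :=
  (h.smooth_epsSign.mul h.smooth_rootDet).div h.smooth fun p hp => (hpos p hp).ne'

/-- `θ` is a Landsberg angle if and only if `dθ = (ε √|g| / L) (y¹ dy² - y² dy¹)`. -/
lemma IsLocalMetric.isLandsbergAngle_iff (h : IsLocalMetric U L) (hpos : ∀ p ∈ U, 0 < L p)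
    {x : E 2} {V : Set (E 2)} (hVo : IsOpen V) (hV : ∀ y ∈ V, (x, y) ∈ U) {θ : E 2 → ℝ} :
    IsLandsbergAngle L x V θ ↔
      ∀ y ∈ V, HasFDerivAt θ (angleDensity L (x, y) • areaForm y) y := by
  constructor
  · intro ha y hy
    have hd := (ha.differentiable.differentiableAt (hVo.mem_nhds hy)).hasFDerivAt
    convert hd using 1
    refine clm_ext_e fun i => ?_
    have hL := hpos _ (hV y hy)
    have := ha.eq y hy i
    have hF := (IsLocalMetric.normF_pos hL).ne'
    rw [smul_apply, smul_eq_mul]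
    rw [← h.mLow_div (hV y hy) hL i, ← this]
    field_simp
  · intro ha
    refine ⟨fun y hy => (ha y hy).differentiableAt.differentiableWithinAt, fun y hy i => ?_⟩
    have hL := hpos _ (hV y hy)
    have hF := (IsLocalMetric.normF_pos hL).ne'
    rw [(ha y hy).fderiv, smul_apply, smul_eq_mul,
      ← h.mLow_div (hV y hy) hL i]
    field_simp

/-- dθ never vanishes, so θ is open. Hence `l`, known to be smooth only on the image of θ, has
genuine derivatives there. -/
lemma IsLocalMetric.image_mem_nhds (h : IsLocalMetric U L) (hpos : ∀ p ∈ U, 0 < L p)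
    {x : E 2} {V : Set (E 2)} (hVo : IsOpen V) (hV : ∀ y ∈ V, (x, y) ∈ U) {θ : E 2 → ℝ}
    (hθ : ∀ y ∈ V, HasFDerivAt θ (angleDensity L (x, y) • areaForm y) y) {y : E 2} (hy : y ∈ V) :
    θ '' V ∈ nhds (θ y) := by
  have hV' := hVo.mem_nhds hy
  have hc : ContinuousAt (fun y => angleDensity L (x, y) • areaForm y) y := by
    have h1 := (hasFDerivAt_fibre (h.smooth_angleDensity hpos) (hV y hy)).continuousAt
    exact h1.smul continuous_areaForm.continuousAt
  have hs : HasStrictFDerivAt θ (angleDensity L (x, y) • areaForm y) y :=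
    hasStrictFDerivAt_of_hasFDerivAt_of_continuousAt
      (Filter.eventually_of_mem hV' fun y hy => hθ y hy) hc
  have hne : (angleDensity L (x, y) • areaForm y).toLinearMap ≠ 0 := fun h0 => by
    obtain ⟨i, hi⟩ := areaForm_ne_zero (h.ne_zero _ (hV y hy))
    have := LinearMap.congr_fun h0 (e i)
    simp only [ContinuousLinearMap.coe_coe, smul_apply, smul_eq_mul,
      LinearMap.zero_apply] at this
    exact mul_ne_zero (h.angleDensity_ne_zero (hV y hy) (hpos _ (hV y hy))) hi this
  have hmap := hs.map_nhds_eq_of_surj (LinearMap.range_eq_top.2 (LinearMap.surjective hne))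
  rw [← hmap]
  exact Filter.image_mem_map hV'

/-- The differential equation for the flag curvature as a function of the Landsberg angle. -/
theorem IsLocalForm.landsberg_ode (hf : IsLocalForm U R τ w) (h : IsLocalMetric U L)
    (hpos : ∀ p ∈ U, 0 < L p) (hl : IsLocalFlag U L R τ lam) {lam' : Coord 2 → ℝ}
    (hlam : ∀ p ∈ U, lam' p = lam p) {x : E 2} {V : Set (E 2)} (hV : ∀ y ∈ V, (x, y) ∈ U)
    {θ : E 2 → ℝ} {l I : ℝ → ℝ} (hA : InLandsbergAngle L lam' x V θ l I) {y : E 2} (hy : y ∈ V) :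
    deriv (deriv l) (θ y) + epsSign L (x, y) * I (θ y) * deriv l (θ y) = 0 := by
  have hθ := (h.isLandsbergAngle_iff hpos hA.isOpen hV).1 hA.angle
  have hsm : ∀ y ∈ V, ContDiffAt ℝ ∞ l (θ y) := fun y hy =>
    (hA.smooth_l _ (Set.mem_image_of_mem θ hy)).contDiffAt
      (h.image_mem_nhds hpos hA.isOpen hV hθ hy)
  -- Through dθ = (ε √|g| / L)(y¹ dy² - y² dy¹), the equation L λ_{.i} = ω_{ir} y^r becomes a first
  -- integral of the differential equation.
  have key : ∀ y ∈ V, deriv l (θ y) * (epsSign L (x, y) * rootDet L (x, y)) = -w 0 1 x := by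
    intro y hy
    have hp := hV y hy
    have hL := (hpos _ hp).ne'
    have hd : HasFDerivAt (fun y => lam (x, y))
        (deriv l (θ y) • (angleDensity L (x, y) • areaForm y)) y := by
      have h1 := ((hsm y hy).differentiableAt (by simp)).hasDerivAt.comp_hasFDerivAt y (hθ y hy)
      refine h1.congr_of_eventuallyEq ?_
      filter_upwards [hA.isOpen.mem_nhds hy] with z hz
      rw [← hlam _ (hV z hz), hA.eq_l z hz]
      rfl
    have hdy : ∀ i, dy i lam (x, y) = deriv l (θ y) * (angleDensity L (x, y) * areaForm y (e i)) :=
      fun i => by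
        have := congrArg (fun A => A (e i)) ((hasFDerivAt_fibre hl.smooth hp).unique hd)
        simpa [dy] using this
    obtain ⟨i, hi⟩ := areaForm_ne_zero (h.ne_zero _ hp)
    apply mul_right_cancel₀ hi
    have e1 := hf.L_mul_dy h hl i hp
    have s2 := hf.skew 1 0 _ hp
    have s0 : w 0 0 x = 0 := by have := hf.skew 0 0 _ hp; simp only at this; linarith
    have s1 : w 1 1 x = 0 := by have := hf.skew 1 1 _ hp; simp only at this; linarith
    have e2 : ∑ r, w i r x * y r = -w 0 1 x * areaForm y (e i) := by
      rw [areaForm_e, Fin.sum_univ_two]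
      simp only at s2
      fin_cases i <;> simp [s0, s1, s2]
    rw [hdy, e2, angleDensity] at e1
    rw [← e1]
    field_simp
  have hp := hV y hy
  have hL := (hpos _ hp).ne'
  have hd2 : HasDerivAt (deriv l) (deriv (deriv l) (θ y)) (θ y) := by
    have h1 : ContDiffAt ℝ ∞ (fderiv ℝ l) (θ y) := (hsm y hy).fderiv_right (by simp)
    have h2 : DifferentiableAt ℝ (deriv l) (θ y) :=
      (h1.differentiableAt (by simp)).clm_apply (differentiableAt_const (1 : ℝ))
    exact h2.hasDerivAt
  set r : Coord 2 → ℝ := fun p => epsSign L p * rootDet L p with hr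
  have hrs : ContDiffOn ℝ ∞ r U := h.smooth_epsSign.mul h.smooth_rootDet
  have hdr : ∀ i, dy i r (x, y) = epsSign L (x, y) * dy i (rootDet L) (x, y) := fun i => by
    have e1 : ofFun r hrs = h.eps * h.root := rfl
    have e2 := congrArg (fun f => ev ⟨_, hp⟩ ((frame U).py i f)) e1
    simp only [Derivation.leibniz, CoordFrame.derivation_sign _ h.eps_mul_self, map_mul,
      smul_eq_mul, mul_zero, add_zero] at e2
    simpa only [IsLocalMetric.eps, IsLocalMetric.root, py_mk, ev_mk] using e2
  -- The first integral is differentiated along the fibre. The derivative of √|g| contributes the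
  -- main scalar, by `dy_rootDet`.
  have hprod : HasFDerivAt (fun z => deriv l (θ z) * r (x, z)) _ y :=
    (hd2.comp_hasFDerivAt y (hθ y hy)).mul (hasFDerivAt_fibre hrs hp)
  have hconst : HasFDerivAt (fun z => deriv l (θ z) * r (x, z)) (0 : E 2 →L[ℝ] ℝ) y := by
    refine (hasFDerivAt_const (-w 0 1 x) y).congr_of_eventuallyEq ?_
    filter_upwards [hA.isOpen.mem_nhds hy] with z hz
    exact key z hz
  obtain ⟨i, hi⟩ := areaForm_ne_zero (h.ne_zero _ hp)
  have e := congrArg (fun A => A (e i)) (hprod.unique hconst)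
  simp only [add_apply, smul_apply, smul_eq_mul,
    ContinuousLinearMap.comp_apply, ContinuousLinearMap.inr_apply,
    zero_apply, Function.comp_apply] at e
  have e2 : fderiv ℝ r (x, y) (0, SprayGeometry.e i) = dy i r (x, y) := rfl
  have e3 := h.dy_rootDet hp (hpos _ hp) (hA.eq_I y hy) i
  have e4 : ![-y 1, y 0] i = areaForm y (SprayGeometry.e i) := (areaForm_e y i).symm
  simp only at e3
  rw [e4] at e3
  have e5 : dy i (rootDet L) (x, y) = I (θ y) * (rootDet L (x, y) * rootDet L (x, y))
      * areaForm y (SprayGeometry.e i) / L (x, y) := by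
    rw [eq_div_iff hL, e3]
  rw [e2, hdr, e5] at e
  simp only [hr, angleDensity] at e
  have hq := (h.rootDet_pos hp).ne'
  have hε := h.epsSign_mul_self hp
  set ε := epsSign L (x, y)
  set q := rootDet L (x, y)
  set a := areaForm y (SprayGeometry.e i)
  have hne : q * q * a / L (x, y) ≠ 0 := div_ne_zero (mul_ne_zero (mul_ne_zero hq hq) hi) hL
  apply mul_right_cancel₀ hne
  rw [zero_mul, ← e]
  field_simp
  linear_combination (-deriv (deriv l) (θ y)) * hε

end Angle

/-! ### Existence of a Landsberg angle -/

section Angle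

open TopologicalSpace (Opens)
open SmoothRing

/-- A non-vanishing smooth function has, locally, a primitive with a smooth inverse. -/
lemma exists_primitive_inverse {κ : ℝ → ℝ} {T : Set ℝ} (hT : IsOpen T) (h0 : (0 : ℝ) ∈ T)
    (hκ : ContDiffOn ℝ ∞ κ T) (hne : ∀ t ∈ T, κ t ≠ 0) :
    ∃ (B : Set ℝ) (Θ Ψ : ℝ → ℝ), IsOpen B ∧ 0 ∈ B ∧ B ⊆ T ∧
      (∀ t ∈ B, HasDerivAt Θ (κ t) t) ∧ (∀ t ∈ B, Ψ (Θ t) = t) ∧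
      ∀ t ∈ B, ContDiffAt ℝ ∞ Ψ (Θ t) := by
  obtain ⟨δ, hδ, hball⟩ := Metric.isOpen_iff.1 hT 0 h0
  set Θ : ℝ → ℝ := fun t => ∫ s in (0 : ℝ)..t, κ s with hΘ
  have hκb : ContDiffOn ℝ ∞ κ (Metric.ball 0 δ) := hκ.mono hball
  have h0b : (0 : ℝ) ∈ Metric.ball (0 : ℝ) δ := Metric.mem_ball_self hδ
  have hd : ∀ t ∈ Metric.ball (0 : ℝ) δ, HasDerivAt Θ (κ t) t := fun t ht => by
    refine intervalIntegral.integral_hasDerivAt_right ?_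
      (hκb.continuousOn.stronglyMeasurableAtFilter Metric.isOpen_ball t ht)
      (hκb.continuousOn.continuousAt (Metric.isOpen_ball.mem_nhds ht))
    refine (hκb.continuousOn.mono ?_).intervalIntegrable
    rw [← segment_eq_uIcc]
    exact (convex_ball _ _).segment_subset h0b ht
  have hs : ContDiffOn ℝ ∞ Θ (Metric.ball 0 δ) := by
    rw [contDiffOn_infty_iff_deriv_of_isOpen Metric.isOpen_ball]
    exact ⟨fun t ht => (hd t ht).differentiableAt.differentiableWithinAt,
      hκb.congr fun t ht => (hd t ht).deriv⟩
  have hat : ∀ t ∈ Metric.ball (0 : ℝ) δ, ContDiffAt ℝ ∞ Θ t := fun t ht =>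
    (hs t ht).contDiffAt (Metric.isOpen_ball.mem_nhds ht)
  have hst : HasStrictFDerivAt Θ _ (0 : ℝ) :=
    (hat 0 h0b).hasStrictFDerivAt' ((hd 0 h0b).hasFDerivAt_equiv (hne 0 h0)) (by simp)
  set f := hst.toOpenPartialHomeomorph Θ
  have hf : ∀ t, f t = Θ t := fun t => rfl
  refine ⟨f.source ∩ Metric.ball 0 δ, Θ, f.symm, f.open_source.inter Metric.isOpen_ball,
    ⟨hst.mem_toOpenPartialHomeomorph_source, h0b⟩, fun t ht => hball ht.2, fun t ht => hd t ht.2,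
    fun t ht => f.left_inv ht.1, fun t ht => ?_⟩
  have ht' : f.symm (Θ t) = t := f.left_inv ht.1
  refine f.contDiffAt_symm_deriv (hne t (hball ht.2)) (f.map_source ht.1) ?_ ?_
  · rw [ht']; exact hd t ht.2
  · rw [ht']; exact hat t ht.2

variable {U : Opens (Coord 2)} {L R lam : Coord 2 → ℝ}

lemma IsLocalMetric.angleDensity_smul (h : IsLocalMetric U L) {p : Coord 2} (hp : p ∈ U) {s : ℝ}
    (hs : 0 < s) : angleDensity L (p.1, s • p.2) = angleDensity L p / s ^ 2 := by
  have h1 : epsSign L (p.1, s • p.2) = epsSign L p :=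
    ray_const h.smooth_epsSign (CoordFrame.derivation_sign _ h.eps_mul_self) h.cone hp hs
  have h2 : rootDet L (p.1, s • p.2) = rootDet L p :=
    ray_const h.smooth_rootDet h.euler_root h.cone hp hs
  rw [angleDensity, h1, h2, h.hom p hp s hs, angleDensity, div_div, mul_comm (s ^ 2)]

/-- Near every direction there is a Landsberg angle, and the functions homogeneous of degree zero
are smooth functions of it. -/
theorem IsLocalMetric.exists_inLandsbergAngle (h : IsLocalMetric U L) (hpos : ∀ p ∈ U, 0 < L p)
    (hlam : ContDiffOn ℝ ∞ lam U) (hE : (frame U).euler (ofFun lam hlam) = 0)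
    {lam' : Coord 2 → ℝ} (hlam' : ∀ p ∈ U, lam' p = lam p) {x v : E 2} (hp : (x, v) ∈ U) :
    ∃ (V : Set (E 2)) (θ : E 2 → ℝ) (l I : ℝ → ℝ), v ∈ V ∧ (∀ y ∈ V, (x, y) ∈ U) ∧
      InLandsbergAngle L lam' x V θ l I := by
  -- An affine line through v, orthogonal to v: it meets each nearby ray exactly once, so functions
  -- homogeneous of degree zero are determined by their values on it.
  set c : ℝ → E 2 := fun t => v + t • !₂[-v 1, v 0] with hc
  have hc0 : ∀ t, c t 0 = v 0 - t * v 1 := fun t => by simp [hc]; ring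
  have hc1 : ∀ t, c t 1 = v 1 + t * v 0 := fun t => by simp [hc]
  have hcs : ContDiff ℝ ∞ (fun t => ((x, c t) : Coord 2)) :=
    contDiff_const.prodMk (contDiff_const.add (contDiff_id.smul contDiff_const))
  set N : ℝ := v 0 ^ 2 + v 1 ^ 2 with hN
  have hNpos : 0 < N := by
    obtain ⟨i, hi⟩ := exists_ne_zero_of_ne_zero (h.ne_zero _ hp)
    fin_cases i
    · have : 0 < v 0 ^ 2 := by simp at hi; positivity
      positivity
    · have : 0 < v 1 ^ 2 := by simp at hi; positivity
      positivity
  set T : Set ℝ := {t | (x, c t) ∈ U} with hT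
  have hTo : IsOpen T := U.isOpen.preimage hcs.continuous
  have hT0 : (0 : ℝ) ∈ T := by simpa [hT, hc] using hp
  have hmaps : Set.MapsTo (fun t => ((x, c t) : Coord 2)) T U := fun t ht => ht
  -- The integrand is dθ pulled back to the line, where y¹ dy² - y² dy¹ restricts to N dt. Θ is the
  -- angle as a function of t, and Ψ its inverse.
  obtain ⟨B, Θ, Ψ, hBo, hB0, hBT, hΘ, hΨ, hΨs⟩ := exists_primitive_inverse hTo hT0
    (κ := fun t => N * angleDensity L (x, c t))
    (contDiffOn_const.mul ((h.smooth_angleDensity hpos).comp hcs.contDiffOn hmaps))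
    (fun t ht => mul_ne_zero hNpos.ne' (h.angleDensity_ne_zero ht (hpos _ ht)))
  set ip : E 2 →L[ℝ] ℝ := v 0 • EuclideanSpace.proj 0 + v 1 • EuclideanSpace.proj 1 with hip
  have hipa : ∀ y, ip y = v 0 * y 0 + v 1 * y 1 := fun y => by simp [hip]
  -- The parameter of the point where the ray through y meets the line; `ip y / N` is the scaling
  -- factor from that point to y.
  set tt : E 2 → ℝ := fun y => areaForm v y / ip y with htt
  have httd : ∀ y, 0 < ip y → HasFDerivAt tt ((N / ip y ^ 2) • areaForm y) y := fun y hy => by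
    have h1 := (areaForm v).hasFDerivAt (x := y)
    have h2 : HasFDerivAt (fun y => areaForm v y / ip y) _ y :=
      h1.mul ((hasDerivAt_inv hy.ne').comp_hasFDerivAt y ip.hasFDerivAt)
    refine h2.congr_fderiv (clm_ext_e fun i => ?_)
    have hne := hy.ne'
    simp only [smul_apply, add_apply, smul_eq_mul, areaForm_apply, hipa] at hne ⊢
    fin_cases i <;> simp [e_apply] <;> field_simp <;> ring
  set V : Set (E 2) := {y | 0 < ip y} ∩ tt ⁻¹' B with hV
  have hVo : IsOpen V := by
    refine ContinuousOn.isOpen_inter_preimage (fun y hy => ?_)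
      (isOpen_lt continuous_const ip.continuous) hBo
    exact (httd y hy).continuousAt.continuousWithinAt
  have hdec : ∀ y ∈ V, 0 < ip y / N ∧ y = (ip y / N) • c (tt y) := fun y hy => by
    refine ⟨div_pos hy.1 hNpos, ?_⟩
    have hne : ip y ≠ 0 := ne_of_gt hy.1
    ext i
    fin_cases i
    · simp only [Fin.zero_eta, PiLp.smul_apply, hc0, smul_eq_mul, htt]
      field_simp
      rw [hipa, areaForm_apply, hN]
      ring
    · simp only [Fin.mk_one, PiLp.smul_apply, hc1, smul_eq_mul, htt]
      field_simp
      rw [hipa, areaForm_apply, hN]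
      ring
  have hVU : ∀ y ∈ V, (x, y) ∈ U := fun y hy => by
    have := h.cone (x, c (tt y)) (hBT hy.2) _ (hdec y hy).1
    rwa [← (hdec y hy).2] at this
  have hconst : ∀ (F : Coord 2 → ℝ) (hF : ContDiffOn ℝ ∞ F U), (frame U).euler (ofFun F hF) = 0 →
      ∀ y ∈ V, F (x, y) = F (x, c (tt y)) := fun F hF hFE y hy => by
    have := ray_const hF hFE h.cone (hBT hy.2 : (x, c (tt y)) ∈ U) (hdec y hy).1
    rwa [← (hdec y hy).2] at this
  have hsm : ∀ F : Coord 2 → ℝ, ContDiffOn ℝ ∞ F U →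
      ContDiffOn ℝ ∞ (fun a => F (x, c (Ψ a))) ((fun y => Θ (tt y)) '' V) := by
    rintro F hF _ ⟨y, hy, rfl⟩
    have h1 : ContDiffAt ℝ ∞ (fun t => F (x, c t)) (Ψ (Θ (tt y))) := by
      rw [hΨ _ hy.2]
      exact ((hF.comp hcs.contDiffOn hmaps) _ (hBT hy.2)).contDiffAt
        (hTo.mem_nhds (hBT hy.2))
    exact (h1.comp (Θ (tt y)) (hΨs _ hy.2)).contDiffWithinAt
  refine ⟨V, fun y => Θ (tt y), fun a => lam (x, c (Ψ a)), fun a => rep h.scalar (x, c (Ψ a)),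
    ⟨?_, ?_⟩, hVU, ⟨hVo, ?_, hsm lam hlam, hsm _ (contDiffOn_rep _), fun y hy => ?_,
    fun y hy => ?_⟩⟩
  · change 0 < ip v
    rw [hipa]
    nlinarith
  · change areaForm v v / ip v ∈ B
    rw [areaForm_apply, mul_comm (v 1), sub_self, zero_div]
    exact hB0
  · refine (h.isLandsbergAngle_iff hpos hVo hVU).2 fun y hy => ?_
    have h1 := (hΘ _ hy.2).comp_hasFDerivAt y (httd y hy.1)
    refine h1.congr_fderiv ?_
    have h2 := h.angleDensity_smul (hBT hy.2 : (x, c (tt y)) ∈ U) (hdec y hy).1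
    simp only [← (hdec y hy).2] at h2
    rw [h2, smul_smul]
    have hne : ip y ≠ 0 := ne_of_gt hy.1
    congr 1
    field_simp
  · rw [hlam' _ (hVU y hy), hconst lam hlam hE y hy, hΨ _ hy.2]
  · have h1 := h.isMainScalarAt_scalar ⟨_, hVU y hy⟩ (hpos _ (hVU y hy))
    have h2 : (frame U).euler (ofFun (rep h.scalar) (contDiffOn_rep _)) = 0 := by
      rw [mk_rep, h.euler_scalar]
    rw [hΨ _ hy.2, ← hconst _ _ h2 y hy]
    rwa [← rep_eq] at h1

end Angle

/-! ### Charts of the manifold -/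

section Charts

open TopologicalSpace (Opens)
open SmoothRing

variable {n : ℕ} {M : Type*} [TopologicalSpace M] [ChartedSpace (E n) M]

lemma vec_smul (φ : OpenPartialHomeomorph M (E n)) (x u : E n) (t : ℝ) :
    vec φ x (t • u) = t • vec φ x u :=
  (mfderiv (𝓡 n) (𝓡 n) φ.symm x).map_smul t u

lemma vec_zero (φ : OpenPartialHomeomorph M (E n)) (x : E n) : vec φ x 0 = 0 :=
  (mfderiv (𝓡 n) (𝓡 n) φ.symm x).map_zero

lemma vec_eq_sum (φ : OpenPartialHomeomorph M (E n)) (x u : E n) :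
    vec φ x u = ∑ i, u i • vec φ x (e i) := by
  conv_lhs => rw [← sum_smul_e u]
  exact (map_sum (mfderiv (𝓡 n) (𝓡 n) φ.symm x) _ _).trans
    (Finset.sum_congr rfl fun i _ => vec_smul φ x (e i) (u i))

lemma lift_smul (φ : OpenPartialHomeomorph M (E n)) (p : Coord n) (t : ℝ) :
    lift φ (p.1, t • p.2) = ⟨(lift φ p).1, t • (lift φ p).2⟩ :=
  congrArg (Bundle.TotalSpace.mk (φ.symm p.1)) (vec_smul φ p.1 p.2 t)

/-- The coordinate domain of a conical region, as an open set. -/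
def ConicalRegion.opens (C : ConicalRegion n M) {φ : OpenPartialHomeomorph M (E n)}
    (hφ : φ ∈ atlas (E n) M) : Opens (Coord n) := ⟨C.coords φ, C.isOpen φ hφ⟩

lemma riemann_congr {U : Opens (Coord n)} {G G' : Coord n → E n}
    (hG : ∀ i, ContDiffOn ℝ ∞ (fun p => G p i) U) (h : ∀ p ∈ U, G p = G' p) (i k : Fin n)
    {p : Coord n} (hp : p ∈ U) : riemann G i k p = riemann G' i k p := by
  have hG' : ∀ i, ContDiffOn ℝ ∞ (fun p => G' p i) U := fun i =>
    (hG i).congr fun p hp => by rw [h p hp]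
  rw [← ev_riem G hG i k ⟨p, hp⟩, ← ev_riem G' hG' i k ⟨p, hp⟩]
  congr 2
  ext1 j
  exact mk_congr _ _ fun u hu => by rw [h u hu]

variable {C : ConicalRegion n M} {G : Spray C} {R : TangentBundle (𝓡 n) M → ℝ}
  {τ : SprayCovector n M} {Ω : TwoForm n M} {L : FinslerMetric C}
  {φ : OpenPartialHomeomorph M (E n)}

lemma ContDiffOn.coord {F : Coord n → E n} {s : Set (Coord n)} (hF : ContDiffOn ℝ ∞ F s)
    (i : Fin n) : ContDiffOn ℝ ∞ (fun p => F p i) s :=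
  (EuclideanSpace.proj (𝕜 := ℝ) i).contDiff.comp_contDiffOn hF

/-- Smoothness and homogeneity of the coefficients of `L` are inherited from the given spray, with
no computation on the inverse matrix. -/
lemma Spray.IsInducedBy.isLocalMetric (h : G.IsInducedBy L) (hφ : φ ∈ atlas (E n) M) :
    IsLocalMetric (C.opens hφ) (L.loc φ) where
  ne_zero p hp h0 := C.ne_zero _ hp.2 (by
    change vec φ p.1 p.2 = 0
    rw [h0, vec_zero])
  cone p hp t ht := ⟨hp.1, by
    rw [lift_smul]
    exact C.cone _ hp.2 t ht⟩
  smooth := L.smooth φ hφ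
  hom p hp t ht := by
    rw [FinslerMetric.loc, lift_smul]
    exact L.homogeneous _ hp.2 t ht
  nondeg := L.nondegenerate φ hφ
  smooth_spray i := (ContDiffOn.coord (G.smooth φ hφ) i).congr fun p hp => by rw [h φ hφ p hp]
  hom_spray i p hp t ht := by
    have hp' : (p.1, t • p.2) ∈ C.coords φ := ⟨hp.1, by
      rw [lift_smul]
      exact C.cone _ hp.2 t ht⟩
    rw [← h φ hφ p hp, ← h φ hφ _ hp', G.homogeneous φ hφ p hp t ht, PiLp.smul_apply, smul_eq_mul]

lemma Spray.IsOfScalarCurvature.isLocalScalar (hs : G.IsOfScalarCurvature R τ)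
    (h : G.IsInducedBy L) (hφ : φ ∈ atlas (E n) M) :
    IsLocalScalar (C.opens hφ) (L.loc φ) (fun q => R (lift φ q))
      (fun k p => τ (lift φ p) (vec φ p.1 (e k))) where
  hom p hp t ht := by
    simp only [lift_smul]
    exact hs.homogeneous_R _ hp.2 t ht
  eq p hp i k := by
    rw [← hs.eq φ hφ p hp i k]
    exact riemann_congr (U := C.opens hφ) (h.isLocalMetric hφ).smooth_spray
      (fun q hq => (h φ hφ q hq).symm) i k hp

lemma update_pair {V : Type*} (u v w : V) : Function.update ![u, v] 1 w = ![u, w] := by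
  ext i
  fin_cases i <;> simp

lemma alternating_right_add {V : Type*} [AddCommGroup V] [Module ℝ V] [TopologicalSpace V]
    (f : V [⋀^Fin 2]→L[ℝ] ℝ) (u v w : V) : f ![u, v + w] = f ![u, v] + f ![u, w] := by
  have := f.toMultilinearMap.map_update_add ![u, 0] 1 v w
  simp only [update_pair] at this
  exact this

lemma alternating_right_smul {V : Type*} [AddCommGroup V] [Module ℝ V] [TopologicalSpace V]
    (f : V [⋀^Fin 2]→L[ℝ] ℝ) (u v : V) (t : ℝ) : f ![u, t • v] = t * f ![u, v] := by
  have := f.toMultilinearMap.map_update_smul ![u, 0] 1 t v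
  simp only [update_pair] at this
  exact this

lemma alternating_swap {V : Type*} [AddCommGroup V] [Module ℝ V] [TopologicalSpace V]
    (f : V [⋀^Fin 2]→L[ℝ] ℝ) (u v : V) : f ![u, v] = -f ![v, u] := by
  have := f.map_swap ![v, u] (i := 0) (j := 1) (by decide)
  refine Eq.trans (congrArg f ?_) this
  ext i
  fin_cases i <;> simp

lemma alternating_right_sum {V : Type*} [AddCommGroup V] [Module ℝ V] [TopologicalSpace V]
    (f : V [⋀^Fin 2]→L[ℝ] ℝ) (u : V) (c : Fin n → ℝ) (v : Fin n → V) :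
    f ![u, ∑ i, c i • v i] = ∑ i, f ![u, v i] * c i := by
  let g : V →ₗ[ℝ] ℝ :=
    { toFun := fun v => f ![u, v]
      map_add' := alternating_right_add f u
      map_smul' := fun t v => alternating_right_smul f u v t }
  have : g (∑ i, c i • v i) = ∑ i, g (v i) * c i := by
    simp only [map_sum, map_smul, smul_eq_mul, mul_comm]
  exact this

/-- The components of a 2-form in a chart. -/
noncomputable def TwoForm.comp (Ω : TwoForm n M) (φ : OpenPartialHomeomorph M (E n))
    (i j : Fin n) (x : E n) : ℝ := Ω.toFun (φ.symm x) ![vec φ x (e i), vec φ x (e j)]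

lemma WeakIsotropy.isLocalForm (hw : WeakIsotropy C R τ Ω) (hφ : φ ∈ atlas (E n) M) :
    IsLocalForm (C.opens hφ) (fun q => R (lift φ q))
      (fun k p => τ (lift φ p) (vec φ p.1 (e k))) (Ω.comp φ) where
  smooth i j := (Ω.smooth φ hφ (e i) (e j)).comp contDiff_fst.contDiffOn fun p hp => hp.1
  skew i j p _ := alternating_swap _ _ _
  eq i p hp := by
    rw [hw φ hφ p hp i, vec_eq_sum φ p.1 p.2]
    exact alternating_right_sum _ _ _ _

variable [IsManifold (𝓡 n) ∞ M]

/-- The identification of `ℝⁿ` with a tangent space given by a chart. -/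
noncomputable def vecEquiv (hφ : φ ∈ atlas (E n) M) {x : E n} (hx : x ∈ φ.target) :
    E n ≃L[ℝ] TangentSpace (𝓡 n) (φ.symm x) :=
  haveI : IsManifold (𝓡 n) 1 M := inferInstance
  (mdifferentiable_of_mem_atlas (I := 𝓡 n) hφ).symm.mfderiv hx

lemma vec_surjective (hφ : φ ∈ atlas (E n) M) {x : E n} (hx : x ∈ φ.target) :
    Function.Surjective (vec φ x) := (vecEquiv hφ hx).surjective

lemma exists_lift_eq (hφ : φ ∈ atlas (E n) M) {v : TangentBundle (𝓡 n) M}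
    (hv : v ∈ C.carrier) (hs : v.1 ∈ φ.source) : ∃ p ∈ C.coords φ, lift φ p = v := by
  obtain ⟨x, y⟩ := v
  obtain ⟨x', hx', rfl⟩ : ∃ x' ∈ φ.target, φ.symm x' = x := ⟨φ x, φ.map_source hs, φ.left_inv hs⟩
  obtain ⟨u, rfl⟩ := vec_surjective hφ hx' y
  exact ⟨(x', u), ⟨hx', hv⟩, rfl⟩

lemma exists_mem_coords (C : ConicalRegion n M) (hφ : φ ∈ atlas (E n) M) {x : E n}
    (hx : x ∈ φ.target) : ∃ y, (x, y) ∈ C.coords φ := by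
  obtain ⟨y, hy⟩ := (C.fibre (φ.symm x)).nonempty
  obtain ⟨u, rfl⟩ := vec_surjective hφ hx y
  exact ⟨u, hx, hy⟩

lemma isPreconnected_fibre (C : ConicalRegion n M) (hφ : φ ∈ atlas (E n) M) {x : E n}
    (hx : x ∈ φ.target) : IsPreconnected {y | (x, y) ∈ C.coords φ} := by
  have h := ((vecEquiv hφ hx).toHomeomorph.isConnected_preimage.2
    (C.fibre (φ.symm x))).isPreconnected
  convert h using 1
  ext y
  exact ⟨fun h => h.2, fun h => ⟨hx, h⟩⟩

/-- The fibres of a conical region are open and connected, so a vanishing vertical derivative means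
dependence on x alone. -/
lemma eq_on_fibre (hφ : φ ∈ atlas (E n) M) {F : Coord n → ℝ}
    (hF : ContDiffOn ℝ ∞ F (C.coords φ)) (h0 : ∀ i, ∀ p ∈ C.coords φ, dy i F p = 0)
    {x y y' : E n} (hy : (x, y) ∈ C.coords φ) (hy' : (x, y') ∈ C.coords φ) :
    F (x, y) = F (x, y') := by
  have ho : IsOpen {y | (x, y) ∈ C.coords φ} :=
    (C.isOpen φ hφ).preimage (Continuous.prodMk_right x)
  have hd : ∀ y, (x, y) ∈ C.coords φ → HasFDerivAt (fun y => F (x, y)) 0 y := fun y hy => by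
    refine (hasFDerivAt_fibre (U := C.opens hφ) hF hy).congr_fderiv (clm_ext_e fun i => ?_)
    exact h0 i _ hy
  exact ho.is_const_of_fderiv_eq_zero (𝕜 := ℝ) (isPreconnected_fibre C hφ hy.1)
    (fun y hy => (hd y hy).differentiableAt.differentiableWithinAt)
    (fun y hy => (hd y hy).fderiv) hy hy'

lemma clm_ext_vec (hφ : φ ∈ atlas (E n) M) {x : E n} (hx : x ∈ φ.target)
    {A B : TangentSpace (𝓡 n) (φ.symm x) →L[ℝ] ℝ}
    (h : ∀ i, A (vec φ x (e i)) = B (vec φ x (e i))) : A = B := by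
  have : A.comp (vecEquiv hφ hx : E n →L[ℝ] _) = B.comp (vecEquiv hφ hx : E n →L[ℝ] _) :=
    clm_ext_e h
  ext v
  obtain ⟨u, rfl⟩ := (vecEquiv hφ hx).surjective v
  exact congrArg (fun f : E n →L[ℝ] ℝ => f u) this

/-- The derivative of a function on the tangent bundle along the fibre. -/
noncomputable def fibreDeriv (f : TangentBundle (𝓡 n) M → ℝ) (v : TangentBundle (𝓡 n) M) :
    TangentSpace (𝓡 n) v.1 →L[ℝ] ℝ :=
  fderiv ℝ (fun y : TangentSpace (𝓡 n) v.1 => f ⟨v.1, y⟩) v.2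

/-- `fibreDeriv` involves no chart, so this is the means of comparing and gluing local data. -/
lemma fibreDeriv_lift (hφ : φ ∈ atlas (E n) M) {f : TangentBundle (𝓡 n) M → ℝ}
    (hf : ContDiffOn ℝ ∞ (fun p => f (lift φ p)) (C.coords φ)) {p : Coord n}
    (hp : p ∈ C.coords φ) (i : Fin n) :
    fibreDeriv f (lift φ p) (vec φ p.1 (e i)) = dy i (fun q => f (lift φ q)) p := by
  have h1 := (hasFDerivAt_fibre (U := C.opens hφ) hf (x := p.1) (y := p.2) hp).fderiv
  let A : E n ≃L[ℝ] E n := vecEquiv hφ hp.1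
  have h2 : fderiv ℝ ((fun y : E n => f ⟨φ.symm p.1, y⟩) ∘ A) p.2
      = (fderiv ℝ (fun y : E n => f ⟨φ.symm p.1, y⟩) (A p.2)).comp (A : E n →L[ℝ] E n) :=
    A.comp_right_fderiv
  have h3 := h1.symm.trans h2
  exact (congrArg (fun T : E n →L[ℝ] ℝ => T (e i)) h3).symm

end Charts

/-! ### The flag curvature on the manifold -/

section GlobalFlag

open TopologicalSpace (Opens)
open SmoothRing

variable {n : ℕ} {M : Type*} [TopologicalSpace M] [ChartedSpace (E n) M]
  {C : ConicalRegion n M} {G : Spray C} {R : TangentBundle (𝓡 n) M → ℝ}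
  {τ : SprayCovector n M} {Ω : TwoForm n M} {L : FinslerMetric C}
  {φ : OpenPartialHomeomorph M (E n)} {lam : TangentBundle (𝓡 n) M → ℝ}

/-- `R = lam L` and `τ_k = lam y_k` in every chart, with `lam` smooth. -/
def IsFlag (L : FinslerMetric C) (R : TangentBundle (𝓡 n) M → ℝ) (τ : SprayCovector n M)
    (lam : TangentBundle (𝓡 n) M → ℝ) : Prop :=
  ∀ φ, ∀ hφ : φ ∈ atlas (E n) M, IsLocalFlag (C.opens hφ) (L.loc φ) (fun q => R (lift φ q))
    (fun k p => τ (lift φ p) (vec φ p.1 (e k))) (fun q => lam (lift φ q))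

lemma IsFlag.hasFlagCurvature (hl : IsFlag L R τ lam) (hs : G.IsOfScalarCurvature R τ)
    (h : G.IsInducedBy L) : L.HasFlagCurvature lam := fun φ hφ p hp i k => by
  rw [(hs.isLocalScalar h hφ).eq p hp i k, (hl φ hφ).eq_R p hp, (hl φ hφ).eq_τ p hp]
  ring

/-- The differential equation concerns an arbitrary flag curvature K; by uniqueness K is the smooth
λ already constructed. -/
lemma IsFlag.eq_of_hasFlagCurvature (hl : IsFlag L R τ lam) (hs : G.IsOfScalarCurvature R τ)
    (h : G.IsInducedBy L) (hn : 2 ≤ n) {K : TangentBundle (𝓡 n) M → ℝ}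
    (hK : L.HasFlagCurvature K) (hφ : φ ∈ atlas (E n) M) {p : Coord n} (hp : p ∈ C.coords φ) :
    K (lift φ p) = lam (lift φ p) := by
  have hm := h.isLocalMetric hφ
  obtain ⟨k, hk⟩ := hm.exists_yLow_ne_zero ⟨p, hp⟩
  have h1 := eq_zero_of_mul_delta hn (hm.ne_zero p hp)
    (a := (K (lift φ p) - lam (lift φ p)) * L.loc φ p)
    (b := fun k => (K (lift φ p) - lam (lift φ p)) * yLow (L.loc φ) k p) fun i k => by
      have := (hK φ hφ p hp i k).symm.trans (hl.hasFlagCurvature hs h φ hφ p hp i k)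
      linear_combination this
  exact sub_eq_zero.1 ((mul_eq_zero.1 (h1.2 k)).resolve_right hk)

lemma IsFlag.dy_eq_zero (hl : IsFlag L R τ lam) (h : G.IsInducedBy L)
    (hw : WeakIsotropy C R τ Ω) (hΩ : Ω.IsZero) (hφ : φ ∈ atlas (E n) M) (i : Fin n)
    {p : Coord n} (hp : p ∈ C.coords φ) : dy i (fun q => lam (lift φ q)) p = 0 :=
  (hw.isLocalForm hφ).dy_flag_eq_zero (h.isLocalMetric hφ) (hl φ hφ)
    (fun i j p _ => by
      rw [TwoForm.comp, hΩ]
      rfl) i hp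

lemma IsFlag.hasFlagCurvature_base (hl : IsFlag L R τ lam) (hs : G.IsOfScalarCurvature R τ)
    (h : G.IsInducedBy L) {k : M → ℝ}
    (hk : ∀ φ ∈ atlas (E n) M, ∀ p ∈ C.coords φ, lam (lift φ p) = k (φ.symm p.1)) :
    L.HasFlagCurvature (fun v => k v.1) := fun φ hφ p hp i j => by
  rw [hl.hasFlagCurvature hs h φ hφ p hp i j, hk φ hφ p hp]
  rfl

lemma hasFDerivAt_base {U : Opens (Coord n)} {F : Coord n → ℝ}
    (hF : ContDiffOn ℝ ∞ F U) {x y : E n} (hp : (x, y) ∈ U) :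
    HasFDerivAt (fun x => F (x, y))
      ((fderiv ℝ F (x, y)).comp (ContinuousLinearMap.inl ℝ (E n) (E n))) x :=
  (differentiableAt hF ⟨_, hp⟩).hasFDerivAt.comp x (hasFDerivAt_prodMk_left x y)

lemma dy_eq_of_fibre {U : Opens (Coord n)} {F : Coord n → ℝ} (hF : ContDiffOn ℝ ∞ F U)
    {x y : E n} (hp : (x, y) ∈ U) {g : E n → ℝ} {g' : E n →L[ℝ] ℝ}
    (hg : ∀ z, (x, z) ∈ U → F (x, z) = g z) (hg' : HasFDerivAt g g' y) (i : Fin n) :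
    dy i F (x, y) = g' (e i) := by
  have ho : IsOpen {z | (x, z) ∈ U} := U.isOpen.preimage (Continuous.prodMk_right x)
  have h1 : HasFDerivAt (fun z => F (x, z)) g' y :=
    hg'.congr_of_eventuallyEq (Filter.mem_of_superset (ho.mem_nhds hp) hg)
  exact congrArg (fun T : E n →L[ℝ] ℝ => T (e i)) ((hasFDerivAt_fibre hF hp).unique h1)

variable [IsManifold (𝓡 n) ∞ M]

/-- The relation τ = (λ/2) × (fibre derivative of L) mentions no chart and determines λ, the fibre
derivative being non-zero. So the smooth local factors are values of one function on the conical
region. -/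
theorem exists_isFlag (hs : G.IsOfScalarCurvature R τ) (h : G.IsInducedBy L) (hn : 2 ≤ n) :
    ∃ lam, IsFlag L R τ lam := by
  have hd : ∀ φ ∈ atlas (E n) M, ∀ p ∈ C.coords φ, ∀ i,
      fibreDeriv L.toFun (lift φ p) (vec φ p.1 (e i)) = 2 * yLow (L.loc φ) i p :=
    fun φ hφ p hp i => by
      rw [fibreDeriv_lift hφ (L.smooth φ hφ) hp, yLow]
      change dy i (L.loc φ) p = _
      ring
  have hloc : ∀ φ ∈ atlas (E n) M, ∀ p ∈ C.coords φ,
      ∃ c : ℝ, τ (lift φ p) = (c / 2) • fibreDeriv L.toFun (lift φ p) := fun φ hφ p hp => by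
    obtain ⟨l, -, -, h2⟩ := (hs.isLocalScalar h hφ).exists_flag (h.isLocalMetric hφ) hn
    refine ⟨l p, clm_ext_vec hφ hp.1 fun i => (h2 p hp i).trans ?_⟩
    change _ = l p / 2 * fibreDeriv L.toFun (lift φ p) (vec φ p.1 (e i))
    rw [hd φ hφ p hp]
    ring
  have key : ∀ v ∈ C.carrier, ∃ c : ℝ, τ v = (c / 2) • fibreDeriv L.toFun v := fun v hv => by
    obtain ⟨p, hp, hpv⟩ := exists_lift_eq (C := C) (chart_mem_atlas (E n) v.1) hv
      (mem_chart_source (E n) v.1)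
    have := hloc _ (chart_mem_atlas (E n) v.1) p hp
    rwa [hpv] at this
  choose! lam hlam using key
  refine ⟨lam, fun φ hφ => ?_⟩
  have hm := h.isLocalMetric hφ
  obtain ⟨l, h0, h1, h2⟩ := (hs.isLocalScalar h hφ).exists_flag hm hn
  have hll : ∀ p ∈ C.opens hφ, lam (lift φ p) = l p := fun p hp => by
    obtain ⟨k, hk⟩ := hm.exists_yLow_ne_zero ⟨p, hp⟩
    refine mul_right_cancel₀ hk ((h2 p hp k).symm.trans ?_).symm
    rw [hlam _ hp.2]
    change lam (lift φ p) / 2 * fibreDeriv L.toFun (lift φ p) (vec φ p.1 (e k)) = _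
    rw [hd φ hφ p hp]
    ring
  exact ⟨h0.congr hll, fun p hp => by rw [hll p hp]; exact h1 p hp,
    fun p hp k => by rw [hll p hp]; exact h2 p hp k⟩

lemma TwoForm.isZero_of_comp
    (h : ∀ φ ∈ atlas (E n) M, ∀ x ∈ φ.target, ∀ i j, Ω.comp φ i j x = 0) : Ω.IsZero := by
  have key : ∀ φ ∈ atlas (E n) M, ∀ x ∈ φ.target, Ω.toFun (φ.symm x) = 0 := fun φ hφ x hx => by
    ext m
    obtain ⟨u, hu⟩ := vec_surjective hφ hx (m 0)
    obtain ⟨w, hw⟩ := vec_surjective hφ hx (m 1)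
    have hm : m = ![vec φ x u, vec φ x w] := by
      ext i
      fin_cases i
      · exact hu.symm
      · exact hw.symm
    have h1 : ∀ i, Ω.toFun (φ.symm x) ![vec φ x (e i), vec φ x w] = 0 := fun i => by
      rw [vec_eq_sum φ x w, alternating_right_sum]
      exact Finset.sum_eq_zero fun j _ => by
        rw [show Ω.toFun (φ.symm x) ![vec φ x (e i), vec φ x (e j)] = 0 from h φ hφ x hx i j,
          zero_mul]
    rw [hm, alternating_swap, vec_eq_sum φ x u, alternating_right_sum]
    rw [Finset.sum_eq_zero fun i _ => by rw [alternating_swap, h1, neg_zero, zero_mul], neg_zero]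
    rfl
  intro x
  have := key _ (chart_mem_atlas (E n) x) _ (mem_chart_target (E n) x)
  rwa [(chartAt (E n) x).left_inv (mem_chart_source (E n) x)] at this

/-- If the form vanishes then the flag curvature is a function on the manifold. -/
lemma IsFlag.exists_base (hl : IsFlag L R τ lam) (h : G.IsInducedBy L)
    (hw : WeakIsotropy C R τ Ω) (hΩ : Ω.IsZero) :
    ∃ k : M → ℝ, ∀ φ ∈ atlas (E n) M, ∀ p ∈ C.coords φ, lam (lift φ p) = k (φ.symm p.1) := by
  refine ⟨fun x => lam ⟨x, (C.fibre x).nonempty.some⟩, fun φ hφ p hp => ?_⟩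
  obtain ⟨u, hu⟩ := vec_surjective hφ hp.1 (C.fibre (φ.symm p.1)).nonempty.some
  have hmem : (p.1, u) ∈ C.coords φ := ⟨hp.1, by
    change (⟨φ.symm p.1, vec φ p.1 u⟩ : TangentBundle (𝓡 n) M) ∈ C.carrier
    rw [hu]
    exact (C.fibre (φ.symm p.1)).nonempty.some_mem⟩
  refine (eq_on_fibre hφ (hl φ hφ).smooth (fun i q hq => hl.dy_eq_zero h hw hΩ hφ i hq)
    (y := p.2) (y' := u) hp hmem).trans ?_
  simp only [lift, hu]

/-- Schur's lemma. -/
theorem IsFlag.isLocallyConstant_base (hl : IsFlag L R τ lam) (hs : G.IsOfScalarCurvature R τ)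
    (h : G.IsInducedBy L) (hn : 3 ≤ n) (hw : WeakIsotropy C R τ Ω) (hΩ : Ω.IsZero) {k : M → ℝ}
    (hk : ∀ φ ∈ atlas (E n) M, ∀ p ∈ C.coords φ, lam (lift φ p) = k (φ.symm p.1)) :
    IsLocallyConstant k := by
  rw [IsLocallyConstant.iff_eventually_eq]
  intro x
  set φ := chartAt (E n) x with hφd
  have hφ : φ ∈ atlas (E n) M := chart_mem_atlas (E n) x
  have hxs : x ∈ φ.source := mem_chart_source (E n) x
  -- The components y of one direction at x are kept fixed; by openness they remain in the region
  -- over a ball, on which λ has zero x-derivative.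
  obtain ⟨y, hy⟩ := exists_mem_coords C hφ (φ.map_source hxs)
  have ho : IsOpen {z | (z, y) ∈ C.coords φ} :=
    (C.isOpen φ hφ).preimage (Continuous.prodMk_left y)
  obtain ⟨r, hr, hball⟩ := Metric.isOpen_iff.1 ho _ hy
  have hd : ∀ z ∈ Metric.ball (φ x) r, HasFDerivAt (fun z => lam (lift φ (z, y))) 0 z :=
    fun z hz => by
      refine (hasFDerivAt_base (U := C.opens hφ) (hl φ hφ).smooth (hball hz)).congr_fderiv
        (clm_ext_e fun i => ?_)
      exact (hl φ hφ).dx_eq_zero (h.isLocalMetric hφ) (hs.isLocalScalar h hφ) hn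
        (fun i p hp => hl.dy_eq_zero h hw hΩ hφ i hp) i (hball hz)
  have hconst : ∀ z ∈ Metric.ball (φ x) r, lam (lift φ (z, y)) = lam (lift φ (φ x, y)) :=
    fun z hz => Metric.isOpen_ball.is_const_of_fderiv_eq_zero (𝕜 := ℝ)
      (convex_ball (φ x) r).isPreconnected
      (fun y hy => (hd y hy).differentiableAt.differentiableWithinAt)
      (fun y hy => (hd y hy).fderiv) hz (Metric.mem_ball_self hr)
  filter_upwards [φ.open_source.mem_nhds hxs,
    (φ.continuousAt hxs).preimage_mem_nhds (Metric.ball_mem_nhds (φ x) hr)] with z hz hzb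
  have h1 := hconst _ hzb
  rw [hk φ hφ _ (hball hzb), hk φ hφ _ hy] at h1
  simpa only [φ.left_inv hz, φ.left_inv hxs] using h1

theorem isZero_of_three_le (hs : G.IsOfScalarCurvature R τ) (h : G.IsInducedBy L) (hn : 3 ≤ n)
    (hw : WeakIsotropy C R τ Ω) : Ω.IsZero := by
  obtain ⟨lam, hl⟩ := exists_isFlag hs h (by omega)
  refine TwoForm.isZero_of_comp fun φ hφ x hx i j => ?_
  obtain ⟨y, hy⟩ := exists_mem_coords C hφ hx
  exact (hw.isLocalForm hφ).eq_zero_of_three_le (h.isLocalMetric hφ) (hl φ hφ) hn i j hy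

theorem exists_constant_flagCurvature [ConnectedSpace M] (hs : G.IsOfScalarCurvature R τ)
    (h : G.IsInducedBy L) (hn : 3 ≤ n) (hw : WeakIsotropy C R τ Ω) :
    ∃ c : ℝ, L.HasFlagCurvature (fun _ => c) := by
  obtain ⟨lam, hl⟩ := exists_isFlag hs h (by omega)
  have hΩ := isZero_of_three_le hs h hn hw
  obtain ⟨k, hk⟩ := hl.exists_base h hw hΩ
  obtain ⟨c, rfl⟩ := (hl.isLocallyConstant_base hs h hn hw hΩ hk).exists_eq_const
  exact ⟨c, hl.hasFlagCurvature_base hs h hk⟩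

/-- The third fibre derivatives of a Riemann metric vanish. -/
lemma FinslerMetric.IsRiemannian.dy_dy_dy_eq_zero (hL : L.IsRiemannian)
    (hφ : φ ∈ atlas (E n) M) (i j k : Fin n) {p : Coord n} (hp : p ∈ C.coords φ) :
    dy k (dy j (dy i (L.loc φ))) p = 0 := by
  obtain ⟨b, -, hb⟩ := hL
  have hsm : ContDiffOn ℝ ∞ (L.loc φ) (C.opens hφ) := L.smooth φ hφ
  obtain ⟨x, y⟩ := p
  let A : E n →L[ℝ] E n := (vecEquiv hφ hp.1 : E n →L[ℝ] TangentSpace (𝓡 n) (φ.symm x))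
  let B : E n →L[ℝ] E n →L[ℝ] ℝ := b (φ.symm x)
  let D : E n →L[ℝ] E n →L[ℝ] ℝ := B.bilinearComp A A
  have h0 : ∀ z, (x, z) ∈ C.opens hφ → L.loc φ (x, z) = D z z := fun z hz => hb _ hz.2
  have h1 : ∀ z, (x, z) ∈ C.opens hφ → dy i (L.loc φ) (x, z) = (D.flip (e i) + D (e i)) z :=
    fun z hz => (dy_eq_of_fibre hsm hz h0 (D.hasFDerivAt.clm_apply (hasFDerivAt_id z)) i).trans (by
      simp [add_comm])
  have h2 : ∀ z, (x, z) ∈ C.opens hφ →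
      dy j (dy i (L.loc φ)) (x, z) = (D.flip (e i) + D (e i)) (e j) :=
    fun z hz => dy_eq_of_fibre (contDiffOn_dy hsm i) hz h1
      (D.flip (e i) + D (e i)).hasFDerivAt j
  exact dy_eq_of_fibre (contDiffOn_dy (contDiffOn_dy hsm i) j) hp h2 (hasFDerivAt_const _ y) k

end GlobalFlag

/-! ### Vanishing of the form for Riemann and regular metrics on surfaces -/

section Surface

variable {M : Type*} [TopologicalSpace M] [ChartedSpace (E 2) M] [IsManifold (𝓡 2) ∞ M]
  {C : ConicalRegion 2 M} {G : Spray C} {R : TangentBundle (𝓡 2) M → ℝ}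
  {τ : SprayCovector 2 M} {Ω : TwoForm 2 M} {L : FinslerMetric C}

theorem isZero_of_isRiemannian (hs : G.IsOfScalarCurvature R τ) (h : G.IsInducedBy L)
    (hw : WeakIsotropy C R τ Ω) (hL : L.IsRiemannian) : Ω.IsZero := by
  obtain ⟨lam, hl⟩ := exists_isFlag hs h le_rfl
  refine TwoForm.isZero_of_comp fun φ hφ x hx i j => ?_
  obtain ⟨y, hy⟩ := exists_mem_coords C hφ hx
  exact (hw.isLocalForm hφ).eq_zero_of_quadratic (h.isLocalMetric hφ) (hs.isLocalScalar h hφ)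
    (hl φ hφ) (fun i j k p hp => hL.dy_dy_dy_eq_zero hφ i j k hp) i j hy

theorem isZero_of_isRegular (hs : G.IsOfScalarCurvature R τ) (h : G.IsInducedBy L)
    (hw : WeakIsotropy C R τ Ω) (hL : L.IsRegular) : Ω.IsZero := by
  obtain ⟨lam, hl⟩ := exists_isFlag hs h le_rfl
  refine TwoForm.isZero_of_comp fun φ hφ x hx i j => ?_
  have h01 : Ω.comp φ 0 1 x = 0 :=
    (hw.isLocalForm hφ).eq_zero_of_regular (h.isLocalMetric hφ) (hl φ hφ) fun y hy => ⟨hx, by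
      rw [hL.1]
      exact fun h0 => hy ((vecEquiv hφ hx).map_eq_zero_iff.1 h0)⟩
  have hsk : ∀ i j, Ω.comp φ i j x = -Ω.comp φ j i x := fun i j => alternating_swap _ _ _
  have := hsk i j
  fin_cases i <;> fin_cases j
  · exact self_eq_neg.1 this
  · exact h01
  · exact (hsk 1 0).trans (by rw [h01, neg_zero])
  · exact self_eq_neg.1 this

end Surface

/-! ### The form of a metric of constant main scalar -/

section ConstantMainScalar

open SmoothRing

/-- The area form of the plane, as an alternating map. -/
noncomputable def areaAlt : E 2 [⋀^Fin 2]→L[ℝ] ℝ where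
  toFun m := m 0 0 * m 1 1 - m 0 1 * m 1 0
  map_update_add' m i x y := by
    fin_cases i <;> simp <;> ring
  map_update_smul' m i c x := by
    fin_cases i <;> simp <;> ring
  cont := by fun_prop
  map_eq_zero_of_eq' m i j hij hne := by
    have h01 : m 0 = m 1 := by
      fin_cases i <;> fin_cases j <;> first | exact absurd rfl hne | exact hij | exact hij.symm
    simp only [h01]
    ring

variable {M : Type*} [TopologicalSpace M] [ChartedSpace (E 2) M]
  {C : ConicalRegion 2 M} {G : Spray C} {R : TangentBundle (𝓡 2) M → ℝ}
  {τ : SprayCovector 2 M} {L : FinslerMetric C} {φ : OpenPartialHomeomorph M (E 2)}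
  {lam : TangentBundle (𝓡 2) M → ℝ}

/-- `R_{.i} - 2 τ_i = L lam_{.i}`. -/
lemma IsFlag.dy_sub (hl : IsFlag L R τ lam) (hφ : φ ∈ atlas (E 2) M)
    (i : Fin 2) {p : Coord 2} (hp : p ∈ C.coords φ) :
    dy i (fun q => R (lift φ q)) p - 2 * τ (lift φ p) (vec φ p.1 (e i))
      = L.loc φ p * dy i (fun q => lam (lift φ q)) p := by
  have hd1 := differentiableAt (hl φ hφ).smooth ⟨p, hp⟩
  have hd2 := differentiableAt (U := C.opens hφ) (L.smooth φ hφ) ⟨p, hp⟩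
  have h1 : fderiv ℝ (fun q => R (lift φ q)) p
      = fderiv ℝ (fun q => lam (lift φ q) * L.loc φ q) p :=
    fderiv_congr (U := C.opens hφ) (hl φ hφ).eq_R ⟨p, hp⟩
  have h2 := (hl φ hφ).eq_τ p hp i
  have h3 : fderiv ℝ (fun q => lam (lift φ q) * L.loc φ q) p
      = lam (lift φ p) • fderiv ℝ (L.loc φ) p + L.loc φ p • fderiv ℝ (fun q => lam (lift φ q)) p :=
    fderiv_fun_mul hd1 hd2
  have h4 : dy i (fun q => R (lift φ q)) p
      = lam (lift φ p) * dy i (L.loc φ) p + L.loc φ p * dy i (fun q => lam (lift φ q)) p :=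
    congrArg (fun T : Coord 2 →L[ℝ] ℝ => T (0, e i)) (h1.trans h3)
  rw [yLow] at h2
  linear_combination h4 - 2 * h2

lemma alternating_vec {x : E 2} (f : TangentSpace (𝓡 2) (φ.symm x) [⋀^Fin 2]→L[ℝ] ℝ) (u v : E 2) :
    f ![vec φ x u, vec φ x v]
      = f ![vec φ x (e 0), vec φ x (e 1)] * (u 0 * v 1 - u 1 * v 0) := by
  have hz : ∀ a, f ![a, a] = 0 := fun a => self_eq_neg.1 (alternating_swap f a a)
  have hr : ∀ a w, f ![a, vec φ x w]
      = f ![a, vec φ x (e 0)] * w 0 + f ![a, vec φ x (e 1)] * w 1 := fun a w => by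
    rw [vec_eq_sum φ x w, alternating_right_sum, Fin.sum_univ_two]
  have h0 := hr (vec φ x (e 0)) u
  have h1 := hr (vec φ x (e 1)) u
  rw [hz] at h0 h1
  rw [alternating_swap f (vec φ x (e 1)) (vec φ x (e 0))] at h1
  rw [hr (vec φ x u) v, alternating_swap f (vec φ x u) (vec φ x (e 0)),
    alternating_swap f (vec φ x u) (vec φ x (e 1)), h0, h1]
  ring

variable [IsManifold (𝓡 2) ∞ M]

/-- An alternating form on a tangent space with given component. -/
noncomputable def chartForm (hφ : φ ∈ atlas (E 2) M) {x : E 2} (hx : x ∈ φ.target) (c : ℝ) :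
    TangentSpace (𝓡 2) (φ.symm x) [⋀^Fin 2]→L[ℝ] ℝ :=
  c • areaAlt.compContinuousLinearMap
    ((vecEquiv hφ hx).symm : TangentSpace (𝓡 2) (φ.symm x) →L[ℝ] E 2)

lemma chartForm_apply (hφ : φ ∈ atlas (E 2) M) {x : E 2} (hx : x ∈ φ.target) (c : ℝ)
    (u v : E 2) :
    chartForm hφ hx c ![vec φ x u, vec φ x v] = c * (u 0 * v 1 - u 1 * v 0) := by
  have h : ∀ u, (vecEquiv hφ hx).symm (vec φ x u) = u := (vecEquiv hφ hx).symm_apply_apply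
  change c * ((vecEquiv hφ hx).symm (vec φ x u) 0 * (vecEquiv hφ hx).symm (vec φ x v) 1
    - (vecEquiv hφ hx).symm (vec φ x u) 1 * (vecEquiv hφ hx).symm (vec φ x v) 0) = _
  rw [h, h]

/-- Each chart gives a coefficient w that depends on x only. The forms so obtained fit together
because (*), written with fibre derivatives, characterizes the form at each point without reference
to a chart. -/
theorem exists_twoForm (hs : G.IsOfScalarCurvature R τ) (h : G.IsInducedBy L)
    (hpos : L.IsPositive) (hc : L.HasConstantMainScalar) :
    ∃ Ω : TwoForm 2 M, WeakIsotropy C R τ Ω := by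
  obtain ⟨lam, hl⟩ := exists_isFlag hs h le_rfl
  obtain ⟨c, hc⟩ := hc
  have hw : ∀ φ ∈ atlas (E 2) M, ∃ w : Coord 2 → ℝ, ContDiffOn ℝ ∞ w (C.coords φ) ∧
      (∀ i, ∀ p ∈ C.coords φ, dy i w p = 0) ∧
      ∀ p ∈ C.coords φ, ∀ i, dy i (fun q => R (lift φ q)) p - 2 * τ (lift φ p) (vec φ p.1 (e i))
        = w p * (e i 0 * p.2 1 - e i 1 * p.2 0) := fun φ hφ => by
    obtain ⟨w, h1, h2, h3, h4⟩ := (h.isLocalMetric hφ).exists_form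
      (fun p hp => hpos _ hp.2) (hs.isLocalScalar h hφ) (hl φ hφ) (hc φ hφ)
    refine ⟨w, h1, h2, fun p hp i => ?_⟩
    rw [hl.dy_sub hφ i hp]
    fin_cases i
    · exact (h3 p hp).trans (by simp [e_apply])
    · exact (h4 p hp).trans (by simp [e_apply])
  have hR : ∀ φ, ∀ hφ : φ ∈ atlas (E 2) M,
      ContDiffOn ℝ ∞ (fun q => R (lift φ q)) (C.coords φ) := fun φ hφ =>
    (hs.isLocalScalar h hφ).smooth_R (h.isLocalMetric hφ) le_rfl
  have hloc : ∀ φ ∈ atlas (E 2) M, ∀ x ∈ φ.target,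
      ∃ f : TangentSpace (𝓡 2) (φ.symm x) [⋀^Fin 2]→L[ℝ] ℝ, ∀ y,
        (⟨φ.symm x, y⟩ : TangentBundle (𝓡 2) M) ∈ C.carrier → ∀ a,
          fibreDeriv R ⟨φ.symm x, y⟩ a - 2 * τ ⟨φ.symm x, y⟩ a = f ![a, y] := fun φ hφ x hx => by
    obtain ⟨w, hws, h2, h3⟩ := hw φ hφ
    obtain ⟨y₀, hy₀⟩ := exists_mem_coords C hφ hx
    refine ⟨chartForm hφ hx (w (x, y₀)), fun y hy a => ?_⟩
    obtain ⟨u, rfl⟩ := vec_surjective hφ hx y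
    obtain ⟨b, rfl⟩ := vec_surjective hφ hx a
    have hu : (x, u) ∈ C.coords φ := ⟨hx, hy⟩
    let D : TangentSpace (𝓡 2) (φ.symm x) →L[ℝ] ℝ :=
      fibreDeriv R (lift φ (x, u)) - (2 : ℝ) • τ (lift φ (x, u))
    have hD : ∀ i, D (vec φ x (e i)) = w (x, y₀) * (e i 0 * u 1 - e i 1 * u 0) := fun i => by
      rw [← eq_on_fibre hφ hws h2 hu hy₀]
      refine Eq.trans ?_ (h3 (x, u) hu i)
      rw [← fibreDeriv_lift hφ (hR φ hφ) hu]
      rfl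
    change D (vec φ x b) = _
    rw [chartForm_apply, vec_eq_sum φ x b, map_sum, Fin.sum_univ_two, map_smul, map_smul, hD, hD]
    simp only [e_apply, smul_eq_mul]
    simp
    ring
  have hex : ∀ x : M, ∃ f : TangentSpace (𝓡 2) x [⋀^Fin 2]→L[ℝ] ℝ, ∀ y,
      (⟨x, y⟩ : TangentBundle (𝓡 2) M) ∈ C.carrier → ∀ a,
        fibreDeriv R ⟨x, y⟩ a - 2 * τ ⟨x, y⟩ a = f ![a, y] := fun x => by
    have := hloc _ (chart_mem_atlas (E 2) x) _ (mem_chart_target (E 2) x)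
    rwa [(chartAt (E 2) x).left_inv (mem_chart_source (E 2) x)] at this
  -- The form is chosen point by point; its smoothness is recovered afterwards by comparison with
  -- the coefficient w of each chart.
  choose f hf using hex
  have hf' : ∀ φ, ∀ hφ : φ ∈ atlas (E 2) M, ∀ p ∈ C.coords φ, ∀ i,
      dy i (fun q => R (lift φ q)) p - 2 * τ (lift φ p) (vec φ p.1 (e i))
        = f (φ.symm p.1) ![vec φ p.1 (e i), vec φ p.1 p.2] := fun φ hφ p hp i => by
    rw [← fibreDeriv_lift hφ (hR φ hφ) hp]
    exact hf _ _ hp.2 _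
  refine ⟨⟨f, fun φ hφ u v x hx => ?_⟩, hf'⟩
  obtain ⟨w, hws, -, h3⟩ := hw φ hφ
  obtain ⟨y, hy⟩ := exists_mem_coords C hφ hx
  -- With y fixed, z ↦ w(z, y) is a smooth coefficient near x. Condition (*) at (z, y) identifies it
  -- with the component of f, as y ≠ 0.
  have hval : ∀ z, (z, y) ∈ C.coords φ →
      f (φ.symm z) ![vec φ z u, vec φ z v] = w (z, y) * (u 0 * v 1 - u 1 * v 0) := fun z hz => by
    rw [alternating_vec]
    congr 1
    have h4 : ∀ i, w (z, y) * (e i 0 * y 1 - e i 1 * y 0)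
        = f (φ.symm z) ![vec φ z (e 0), vec φ z (e 1)] * (e i 0 * y 1 - e i 1 * y 0) := fun i => by
      rw [← alternating_vec]
      exact (h3 _ hz i).symm.trans (hf' φ hφ _ hz i)
    obtain ⟨i, hi⟩ := exists_ne_zero_of_ne_zero ((h.isLocalMetric hφ).ne_zero _ hz)
    have h40 := h4 0
    have h41 := h4 1
    simp only [e_apply] at h40 h41
    fin_cases i
    · exact (mul_right_cancel₀ hi (by simpa using h41)).symm
    · exact (mul_right_cancel₀ hi (by simpa using h40)).symm
  have ho : IsOpen {z | (z, y) ∈ C.coords φ} :=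
    (C.isOpen φ hφ).preimage (Continuous.prodMk_left y)
  have h5 : ContDiffAt ℝ ∞ (fun z => w (z, y) * (u 0 * v 1 - u 1 * v 0)) x :=
    ((hws.contDiffAt ((C.isOpen φ hφ).mem_nhds hy)).comp (f := fun z : E 2 => (z, y)) x
      (contDiff_prodMk_left y).contDiffAt).mul contDiffAt_const
  exact (h5.congr_of_eventuallyEq
    (Filter.mem_of_superset (ho.mem_nhds hy) hval)).contDiffWithinAt

end ConstantMainScalar

/-! ### A metric with a non-vanishing form -/

section Model

open TopologicalSpace (Opens)
open SmoothRing

/-- The coordinate region `y¹, y² > 0`. -/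
def quadrant : Opens (Coord 2) :=
  ⟨{p | 0 < p.2 0 ∧ 0 < p.2 1},
    (isOpen_lt continuous_const (by fun_prop)).and (isOpen_lt continuous_const (by fun_prop))⟩

/-- The function `c exp (s x¹x²) (x¹)ᵃ (x²)ᵇ (y¹)ᵐ (y²)ᵏ`. -/
noncomputable def expMono (s c : ℝ) (a b : ℕ) (m k : ℤ) (p : Coord 2) : ℝ :=
  c * Real.exp (s * (p.1 0 * p.1 1)) * p.1 0 ^ a * p.1 1 ^ b * p.2 0 ^ m * p.2 1 ^ k

lemma contDiffOn_zpow {f : Coord 2 → ℝ} {s : Set (Coord 2)} (hf : ContDiffOn ℝ ∞ f s)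
    (h0 : ∀ p ∈ s, f p ≠ 0) (m : ℤ) : ContDiffOn ℝ ∞ (fun p => f p ^ m) s := by
  cases m with
  | ofNat k => simpa using hf.pow k
  | negSucc k =>
    simp only [zpow_negSucc]
    exact (hf.pow (k + 1)).inv fun p hp => pow_ne_zero _ (h0 p hp)

variable (s c : ℝ) (a b : ℕ) (m k : ℤ) {p : Coord 2}

lemma contDiffOn_expMono : ContDiffOn ℝ ∞ (expMono s c a b m k) quadrant := by
  have h1 : ContDiffOn ℝ ∞ (fun p : Coord 2 => c * Real.exp (s * (p.1 0 * p.1 1))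
      * p.1 0 ^ a * p.1 1 ^ b) quadrant :=
    ((contDiffOn_const.mul (contDiffOn_const.mul
      ((SmoothRing.contDiffOn_fst 0).mul (SmoothRing.contDiffOn_fst 1))).exp).mul
      ((SmoothRing.contDiffOn_fst 0).pow a)).mul
      ((SmoothRing.contDiffOn_fst 1).pow b)
  exact (h1.mul (contDiffOn_zpow (SmoothRing.contDiffOn_snd 0)
    (fun p (hp : p ∈ quadrant) => hp.1.ne') m)).mul
    (contDiffOn_zpow (SmoothRing.contDiffOn_snd 1) (fun p (hp : p ∈ quadrant) => hp.2.ne') k)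

lemma fderiv_expMono (hp : p ∈ quadrant) {v : Coord 2} {d : ℝ}
    (h : HasDerivAt (fun t : ℝ => expMono s c a b m k (p + t • v)) d 0) :
    fderiv ℝ (expMono s c a b m k) p v = d := by
  rw [← (differentiableAt (contDiffOn_expMono s c a b m k) ⟨p, hp⟩).lineDeriv_eq_fderiv]
  exact HasLineDerivAt.lineDeriv h

/-- The family `expMono` is stable under vertical derivatives, and horizontal ones give sums of two
members. All computations for the example are thereby reduced to algebra. -/
lemma dy_zero_expMono (hp : p ∈ quadrant) :
    dy 0 (expMono s c a b m k) p = expMono s (c * m) a b (m - 1) k p := by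
  refine fderiv_expMono s c a b m k hp ?_
  have h1 : HasDerivAt (fun t : ℝ => (p.2 0 + t) ^ m) (m * p.2 0 ^ (m - 1)) 0 := by
    have := (hasDerivAt_zpow m (p.2 0 + 0) (Or.inl (by simpa using hp.1.ne'))).comp_const_add
      (p.2 0) 0
    simpa using this
  refine HasDerivAt.congr_of_eventuallyEq (HasDerivAt.congr_deriv
    ((h1.const_mul (c * Real.exp (s * (p.1 0 * p.1 1)) * p.1 0 ^ a * p.1 1 ^ b)).mul_const
    (p.2 1 ^ k)) ?_)
    (Filter.Eventually.of_forall fun t => by simp [expMono, e_apply])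
  simp only [expMono]
  ring

lemma dy_one_expMono (hp : p ∈ quadrant) :
    dy 1 (expMono s c a b m k) p = expMono s (c * k) a b m (k - 1) p := by
  refine fderiv_expMono s c a b m k hp ?_
  have h1 : HasDerivAt (fun t : ℝ => (p.2 1 + t) ^ k) (k * p.2 1 ^ (k - 1)) 0 := by
    have := (hasDerivAt_zpow k (p.2 1 + 0) (Or.inl (by simpa using hp.2.ne'))).comp_const_add
      (p.2 1) 0
    simpa using this
  refine HasDerivAt.congr_of_eventuallyEq (HasDerivAt.congr_deriv
    ((h1.const_mul (c * Real.exp (s * (p.1 0 * p.1 1)) * p.1 0 ^ a * p.1 1 ^ b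
    * p.2 0 ^ m))) ?_)
    (Filter.Eventually.of_forall fun t => by simp [expMono, e_apply])
  simp only [expMono]
  ring

/-- The truncated exponent `a - 1` is harmless for a = 0, since its coefficient `c * a` is then
zero. -/
lemma dx_zero_expMono (hp : p ∈ quadrant) :
    dx 0 (expMono s c a b m k) p
      = expMono s (c * a) (a - 1) b m k p + expMono s (c * s) a (b + 1) m k p := by
  refine fderiv_expMono s c a b m k hp ?_
  have h0 : HasDerivAt (fun t : ℝ => p.1 0 + t) 1 0 := (hasDerivAt_id 0).const_add _
  have h1 := h0.fun_pow a
  have h2 := ((h0.mul_const (p.1 1)).const_mul s).exp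
  refine HasDerivAt.congr_of_eventuallyEq (HasDerivAt.congr_deriv
    (((((h2.const_mul c).mul h1).mul_const (p.1 1 ^ b)).mul_const (p.2 0 ^ m)).mul_const
    (p.2 1 ^ k)) ?_)
    (Filter.Eventually.of_forall fun t => by simp [expMono, e_apply])
  simp only [expMono, add_zero]
  ring

lemma dx_one_expMono (hp : p ∈ quadrant) :
    dx 1 (expMono s c a b m k) p
      = expMono s (c * b) a (b - 1) m k p + expMono s (c * s) (a + 1) b m k p := by
  refine fderiv_expMono s c a b m k hp ?_
  have h0 : HasDerivAt (fun t : ℝ => p.1 1 + t) 1 0 := (hasDerivAt_id 0).const_add _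
  have h1 := h0.fun_pow b
  have h2 := ((h0.const_mul (p.1 0)).const_mul s).exp
  refine HasDerivAt.congr_of_eventuallyEq (HasDerivAt.congr_deriv
    (((((h2.const_mul c).mul_const (p.1 0 ^ a)).mul h1).mul_const (p.2 0 ^ m)).mul_const
    (p.2 1 ^ k)) ?_)
    (Filter.Eventually.of_forall fun t => by simp [expMono, e_apply])
  simp only [expMono, add_zero]
  ring

lemma dy_congr {n : ℕ} {U : Opens (Coord n)} {f g : Coord n → ℝ} (h : ∀ p ∈ U, f p = g p)
    {p : Coord n} (hp : p ∈ U) (i : Fin n) : dy i f p = dy i g p := by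
  rw [dy, dy, fderiv_congr h ⟨p, hp⟩]

lemma dx_congr {n : ℕ} {U : Opens (Coord n)} {f g : Coord n → ℝ} (h : ∀ p ∈ U, f p = g p)
    {p : Coord n} (hp : p ∈ U) (i : Fin n) : dx i f p = dx i g p := by
  rw [dx, dx, fderiv_congr h ⟨p, hp⟩]

lemma dy_dy_zero_expMono (hp : p ∈ quadrant) (i : Fin 2) :
    dy i (dy 0 (expMono s c a b m k)) p = dy i (expMono s (c * m) a b (m - 1) k) p :=
  dy_congr (U := quadrant) (fun _ hq => dy_zero_expMono s c a b m k hq) hp i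

lemma dy_dy_one_expMono (hp : p ∈ quadrant) (i : Fin 2) :
    dy i (dy 1 (expMono s c a b m k)) p = dy i (expMono s (c * k) a b m (k - 1)) p :=
  dy_congr (U := quadrant) (fun _ hq => dy_one_expMono s c a b m k hq) hp i

lemma dx_dy_zero_expMono (hp : p ∈ quadrant) (i : Fin 2) :
    dx i (dy 0 (expMono s c a b m k)) p = dx i (expMono s (c * m) a b (m - 1) k) p :=
  dx_congr (U := quadrant) (fun _ hq => dy_zero_expMono s c a b m k hq) hp i

lemma dx_dy_one_expMono (hp : p ∈ quadrant) (i : Fin 2) :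
    dx i (dy 1 (expMono s c a b m k)) p = dx i (expMono s (c * k) a b m (k - 1)) p :=
  dx_congr (U := quadrant) (fun _ hq => dy_one_expMono s c a b m k hq) hp i

/-- The metric `exp (2 x¹x²) (y¹)³ / y²`. -/
noncomputable def modelL : Coord 2 → ℝ := expMono 2 1 0 0 3 (-1)

/-- The spray coefficients of `modelL`. -/
noncomputable def modelG (p : Coord 2) : E 2 :=
  !₂[expMono 0 (1 / 3) 0 1 2 0 p, expMono 0 (-1) 1 0 0 2 p]

lemma modelL_apply (p : Coord 2) :
    modelL p = Real.exp (2 * (p.1 0 * p.1 1)) * p.2 0 ^ 3 / p.2 1 := by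
  simp only [modelL, expMono, zpow_neg_one, pow_zero, div_eq_mul_inv]
  norm_cast
  ring

lemma modelL_pos (hp : p ∈ quadrant) : 0 < modelL p := by
  rw [modelL_apply]
  have h0 := hp.1
  have h1 := hp.2
  positivity

lemma modelG_zero (p : Coord 2) : modelG p 0 = p.1 1 * p.2 0 ^ 2 / 3 := by
  simp [modelG, expMono]
  norm_cast
  ring

lemma modelG_one (p : Coord 2) : modelG p 1 = -(p.1 0 * p.2 1 ^ 2) := by
  simp [modelG, expMono]

/-- The fundamental tensor of `modelL`. -/
lemma fundTensor_modelL (hp : p ∈ quadrant) :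
    fundTensor modelL p = (Real.exp (2 * (p.1 0 * p.1 1)) * p.2 0 / p.2 1 ^ 3) •
      !![3 * p.2 1 ^ 2, -(3 / 2 * p.2 0 * p.2 1); -(3 / 2 * p.2 0 * p.2 1), p.2 0 ^ 2] := by
  have h0 := hp.1.ne'
  have h1 := hp.2.ne'
  ext i j
  fin_cases i <;> fin_cases j <;>
  · simp [fundTensor, modelL, dy_dy_zero_expMono, dy_dy_one_expMono, dy_zero_expMono,
      dy_one_expMono, hp, expMono]
    norm_num [zpow_neg]
    norm_cast
    field_simp
    try norm_num

lemma det_fundTensor_modelL (hp : p ∈ quadrant) :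
    (fundTensor modelL p).det
      = 3 / 4 * (Real.exp (2 * (p.1 0 * p.1 1)) * p.2 0 ^ 2 / p.2 1 ^ 2) ^ 2 := by
  have h1 := hp.2.ne'
  rw [fundTensor_modelL hp, Matrix.det_smul, Matrix.det_fin_two_of]
  simp
  field_simp
  ring

lemma sprayCoeff_modelL (hp : p ∈ quadrant) : sprayCoeff modelL p = modelG p := by
  have h0 := hp.1.ne'
  have h1 := hp.2.ne'
  have hE := (Real.exp_pos (2 * (p.1 0 * p.1 1))).ne'
  have hdet : IsUnit (fundTensor modelL p).det := by
    rw [det_fundTensor_modelL hp, isUnit_iff_ne_zero]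
    positivity
  set v : Fin 2 → ℝ := fun l => (∑ k, dx k (dy l modelL) p * p.2 k) - dx l modelL p with hv
  -- The spray is verified by multiplying 4G by the fundamental tensor, which avoids computing the
  -- inverse matrix.
  have key : (fundTensor modelL p).mulVec (fun i => 4 * modelG p i) = v := by
    ext l
    rw [fundTensor_modelL hp, hv]
    fin_cases l <;>
    · simp [Matrix.mulVec, dotProduct, Fin.sum_univ_two, modelG_zero, modelG_one, modelL,
        dx_dy_zero_expMono, dx_dy_one_expMono, dx_zero_expMono, dx_one_expMono, hp]
      simp only [expMono]
      norm_num [zpow_neg]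
      norm_cast
      field_simp
      ring
  have h2 : (fundTensor modelL p)⁻¹.mulVec v = fun i => 4 * modelG p i := by
    rw [← key, Matrix.mulVec_mulVec, Matrix.nonsing_inv_mul _ hdet, Matrix.one_mulVec]
  ext i
  have h3 : sprayCoeff modelL p i = 1 / 4 * (fundTensor modelL p)⁻¹.mulVec v i := rfl
  rw [h3, h2]
  ring

/-- The curvature of the spray of `modelL`. -/
lemma riemann_modelG (hp : p ∈ quadrant) (i k : Fin 2) :
    riemann modelG i k p = 4 / 3 * (p.2 0 * p.2 1) * (if i = k then 1 else 0)
      - ![2 * p.2 1, -(2 / 3 * p.2 0)] k * p.2 i := by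
  have h0 := hp.1.ne'
  have h1 := hp.2.ne'
  have g0 : (fun q => modelG q 0) = expMono 0 (1 / 3) 0 1 2 0 := rfl
  have g1 : (fun q => modelG q 1) = expMono 0 (-1) 1 0 0 2 := rfl
  revert i k
  simp only [Fin.forall_fin_two, riemann, Fin.sum_univ_two, g0, g1]
  refine ⟨⟨?_, ?_⟩, ⟨?_, ?_⟩⟩ <;>
  · simp [modelG_zero, modelG_one, dy_dy_zero_expMono,
      dy_dy_one_expMono, dy_zero_expMono, dy_one_expMono, dx_dy_zero_expMono, dx_dy_one_expMono,
      dx_zero_expMono, dx_one_expMono, hp]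
    simp only [expMono]
    norm_num [zpow_neg]
    norm_cast
    try field_simp
    try ring

lemma cartan_modelL (hp : p ∈ quadrant) (i j k : Fin 2) :
    cartan modelL i j k p = -(3 / 2 * Real.exp (2 * (p.1 0 * p.1 1)) / p.2 1 ^ 4)
      * ![-p.2 1, p.2 0] i * ![-p.2 1, p.2 0] j * ![-p.2 1, p.2 0] k := by
  have h0 := hp.1.ne'
  have h1 := hp.2.ne'
  have h00 : ∀ q ∈ quadrant, fundTensor modelL q 0 0 = expMono 2 3 0 0 1 (-1) q := fun q hq => by
    simp [fundTensor, modelL, dy_dy_zero_expMono, dy_zero_expMono, hq, expMono]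
    ring_nf
  have h01 : ∀ q ∈ quadrant, fundTensor modelL q 0 1 = expMono 2 (-3 / 2) 0 0 2 (-2) q :=
    fun q hq => by
      simp [fundTensor, modelL, dy_dy_one_expMono, dy_zero_expMono, hq, expMono]
      ring_nf
  have h10 : ∀ q ∈ quadrant, fundTensor modelL q 1 0 = expMono 2 (-3 / 2) 0 0 2 (-2) q :=
    fun q hq => by
      simp [fundTensor, modelL, dy_dy_zero_expMono, dy_one_expMono, hq, expMono]
      ring_nf
  have h11 : ∀ q ∈ quadrant, fundTensor modelL q 1 1 = expMono 2 1 0 0 3 (-3) q := fun q hq => by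
    simp [fundTensor, modelL, dy_dy_one_expMono, dy_one_expMono, hq, expMono]
    ring_nf
  revert i j k
  simp only [Fin.forall_fin_two, cartan, dy_congr h00 hp, dy_congr h01 hp, dy_congr h10 hp,
    dy_congr h11 hp, dy_zero_expMono _ _ _ _ _ _ hp, dy_one_expMono _ _ _ _ _ _ hp]
  refine ⟨⟨⟨?_, ?_⟩, ⟨?_, ?_⟩⟩, ⟨⟨?_, ?_⟩, ⟨?_, ?_⟩⟩⟩ <;>
  · simp [expMono]
    norm_num [zpow_neg]
    norm_cast
    field_simp
    try norm_num

/-! The same metric, as a metric on a conical region of the tangent bundle of the plane. -/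

lemma vec_refl (x u : E 2) : vec (OpenPartialHomeomorph.refl (E 2)) x u = u := by
  have : mfderiv (𝓡 2) (𝓡 2) (OpenPartialHomeomorph.refl (E 2)).symm x
      = ContinuousLinearMap.id ℝ (TangentSpace (𝓡 2) x) := mfderiv_id
  rw [vec, this]
  rfl

lemma lift_refl (p : Coord 2) :
    lift (OpenPartialHomeomorph.refl (E 2)) p = ⟨p.1, p.2⟩ :=
  congrArg (Bundle.TotalSpace.mk p.1) (vec_refl p.1 p.2)

/-- The coordinates of a tangent vector of the plane. -/
def planeCoord (v : TangentBundle (𝓡 2) (E 2)) : Coord 2 := (v.1, v.2)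

lemma planeCoord_lift (p : Coord 2) :
    planeCoord (lift (OpenPartialHomeomorph.refl (E 2)) p) = p := by
  rw [lift_refl]
  rfl

/-- The conical region `y¹, y² > 0` of the plane. -/
def modelRegion : ConicalRegion 2 (E 2) where
  carrier := {v | planeCoord v ∈ quadrant}
  isOpen φ hφ := by
    rw [chartedSpaceSelf_atlas] at hφ
    subst hφ
    convert quadrant.isOpen using 1
    ext p
    simp [planeCoord_lift]
  ne_zero v hv h0 := by
    have h1 : 0 < (planeCoord v).2 0 := hv.1
    have h2 : (planeCoord v).2 = 0 := h0
    rw [h2] at h1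
    exact lt_irrefl _ h1
  cone v hv t ht := ⟨mul_pos ht hv.1, mul_pos ht hv.2⟩
  fibre x := by
    change IsConnected {y : E 2 | 0 < y 0 ∧ 0 < y 1}
    refine ⟨⟨!₂[1, 1], by simp⟩, Convex.isPreconnected fun y hy z hz a b ha hb hab => ?_⟩
    have : ∀ i, 0 < y i → 0 < z i → 0 < a * y i + b * z i := fun i h1 h2 => by
      rcases ha.eq_or_lt with rfl | ha
      · rw [zero_add] at hab
        simpa [hab] using h2
      · have := mul_pos ha h1
        have := mul_nonneg hb h2.le
        linarith
    exact ⟨this 0 hy.1 hz.1, this 1 hy.2 hz.2⟩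

lemma coords_modelRegion :
    modelRegion.coords (OpenPartialHomeomorph.refl (E 2)) = quadrant := by
  ext p
  simp [ConicalRegion.coords, modelRegion, planeCoord_lift]

/-- The spray of the model metric. -/
noncomputable def modelSpray : Spray modelRegion where
  coeff _ := modelG
  smooth φ hφ := by
    rw [chartedSpaceSelf_atlas] at hφ
    subst hφ
    rw [coords_modelRegion, contDiffOn_euclidean]
    intro i
    fin_cases i
    · exact contDiffOn_expMono 0 (1 / 3) 0 1 2 0
    · exact contDiffOn_expMono 0 (-1) 1 0 0 2
  homogeneous φ _ p _ t _ := by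
    ext i
    fin_cases i
    · simp [modelG_zero]
      ring
    · simp [modelG_one]
      ring
  compatible φ hφ ψ hψ p _ _ := by
    rw [chartedSpaceSelf_atlas] at hφ hψ
    subst hφ hψ
    have h1 : fderiv ℝ (OpenPartialHomeomorph.refl (E 2) ∘ (OpenPartialHomeomorph.refl (E 2)).symm)
        = fun _ => ContinuousLinearMap.id ℝ (E 2) := by
      ext1 x
      exact fderiv_id
    rw [h1]
    simp

/-- The model metric. -/
noncomputable def modelMetric : FinslerMetric modelRegion where
  toFun v := modelL (planeCoord v)
  smooth φ hφ := by
    rw [chartedSpaceSelf_atlas] at hφ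
    subst hφ
    simp only [coords_modelRegion, planeCoord_lift]
    exact contDiffOn_expMono 2 1 0 0 3 (-1)
  homogeneous v hv t ht := by
    have h2 : 0 < (planeCoord v).2 1 := hv.2
    have h3 : planeCoord ⟨v.1, t • v.2⟩ = ((planeCoord v).1, t • (planeCoord v).2) := rfl
    rw [h3, modelL_apply, modelL_apply]
    simp only [PiLp.smul_apply, smul_eq_mul]
    field_simp
  nondegenerate φ hφ p hp := by
    rw [chartedSpaceSelf_atlas] at hφ
    subst hφ
    rw [coords_modelRegion] at hp
    simp only [planeCoord_lift]
    have h0 := hp.1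
    have h1 := hp.2
    rw [show (fun q => modelL q) = modelL from rfl, det_fundTensor_modelL hp]
    positivity

lemma loc_modelMetric : modelMetric.loc (OpenPartialHomeomorph.refl (E 2)) = modelL := by
  ext p
  exact congrArg modelL (planeCoord_lift p)

lemma modelSpray_isInducedBy : modelSpray.IsInducedBy modelMetric := fun φ hφ p hp => by
  rw [chartedSpaceSelf_atlas] at hφ
  subst hφ
  rw [coords_modelRegion] at hp
  rw [loc_modelMetric, sprayCoeff_modelL hp]
  rfl

/-- The curvature `R` of the model spray. -/
noncomputable def modelR (v : TangentBundle (𝓡 2) (E 2)) : ℝ :=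
  4 / 3 * ((planeCoord v).2 0 * (planeCoord v).2 1)

/-- The curvature covector `τ` of the model spray. -/
noncomputable def modelTau : SprayCovector 2 (E 2) := fun v =>
  ((2 * (planeCoord v).2 1) • EuclideanSpace.proj (𝕜 := ℝ) 0
    - (2 / 3 * (planeCoord v).2 0) • EuclideanSpace.proj (𝕜 := ℝ) 1 : E 2 →L[ℝ] ℝ)

lemma modelTau_apply (v : TangentBundle (𝓡 2) (E 2)) (u : E 2) :
    modelTau v u = 2 * (planeCoord v).2 1 * u 0 - 2 / 3 * (planeCoord v).2 0 * u 1 := rfl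

lemma modelTau_lift (p : Coord 2) (k : Fin 2) :
    modelTau (lift (OpenPartialHomeomorph.refl (E 2)) p)
      (vec (OpenPartialHomeomorph.refl (E 2)) p.1 (e k)) = ![2 * p.2 1, -(2 / 3 * p.2 0)] k := by
  refine (modelTau_apply _ _).trans ?_
  rw [planeCoord_lift, vec_refl]
  fin_cases k <;> simp [e_apply]

lemma modelSpray_isOfScalarCurvature : modelSpray.IsOfScalarCurvature modelR modelTau where
  homogeneous_R v _ t _ := by
    have h3 : planeCoord ⟨v.1, t • v.2⟩ = ((planeCoord v).1, t • (planeCoord v).2) := rfl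
    simp only [modelR, h3, PiLp.smul_apply, smul_eq_mul]
    ring
  homogeneous_τ v _ t _ u := by
    have h3 : planeCoord ⟨v.1, t • v.2⟩ = ((planeCoord v).1, t • (planeCoord v).2) := rfl
    rw [modelTau_apply v u]
    refine (modelTau_apply _ u).trans ?_
    simp only [h3, PiLp.smul_apply, smul_eq_mul]
    ring
  eq φ hφ p hp i k := by
    rw [chartedSpaceSelf_atlas] at hφ
    subst hφ
    rw [coords_modelRegion] at hp
    rw [modelTau_lift, modelR, planeCoord_lift]
    exact riemann_modelG hp i k

lemma modelMetric_isPositive : modelMetric.IsPositive := fun _ hv => modelL_pos hv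

lemma modelMetric_hasConstantMainScalar : modelMetric.HasConstantMainScalar := by
  -- The constant is -(3/2) / (√3/2)³: the coefficient of the Cartan tensor over the cube of that of
  -- √|g|, all dependence on (x, y) cancelling.
  refine ⟨-(4 / Real.sqrt 3), fun φ hφ p hp => Or.inl fun i j k => ?_⟩
  have hm := modelSpray_isInducedBy.isLocalMetric hφ
  have hpc := hp
  rw [chartedSpaceSelf_atlas] at hφ
  subst hφ
  rw [coords_modelRegion] at hp
  rw [loc_modelMetric] at hm ⊢
  have h0 := hp.1
  have h1 := hp.2
  have hL := modelL_pos hp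
  have hF := IsLocalMetric.normF_pos hL
  have hFF := IsLocalMetric.normF_mul_self hL
  have hdet := det_fundTensor_modelL hp
  have hE := Real.exp_pos (2 * (p.1 0 * p.1 1))
  have hε : epsSign modelL p = 1 := by
    rw [epsSign, Real.sign_of_pos]
    rw [hdet]
    positivity
  have h3 : Real.sqrt 3 ^ 2 = 3 := Real.sq_sqrt (by norm_num)
  have h3p : 0 < Real.sqrt 3 := by positivity
  have hq : rootDet modelL p
      = Real.sqrt 3 / 2 * (Real.exp (2 * (p.1 0 * p.1 1)) * p.2 0 ^ 2 / p.2 1 ^ 2) := by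
    rw [rootDet, hε, hdet, one_mul, Real.sqrt_eq_iff_mul_self_eq (by positivity) (by positivity)]
    linear_combination -(1 / 4) * (Real.exp (2 * (p.1 0 * p.1 1)) * p.2 0 ^ 2 / p.2 1 ^ 2) ^ 2 * h3
  have hmi : ∀ i, mLow modelL i p = rootDet modelL p * ![-p.2 1, p.2 0] i / normF modelL p :=
    fun i => by
      rw [eq_div_iff hF.ne', hm.mLow_eq hpc hL i, hε, one_mul]
  rw [cartan_modelL hp, hmi, hmi, hmi]
  set F := normF modelL p
  set q := rootDet modelL p
  generalize ![-p.2 1, p.2 0] = z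
  have key : F ^ 4 * -(3 / 2 * Real.exp (2 * (p.1 0 * p.1 1)) / p.2 1 ^ 4)
      = -(4 / Real.sqrt 3) * q ^ 3 := by
    rw [show F ^ 4 = (F * F) ^ 2 by ring, hFF, modelL_apply, hq]
    field_simp
    linear_combination 4 * h3
  have : F * (-(3 / 2 * Real.exp (2 * (p.1 0 * p.1 1)) / p.2 1 ^ 4) * z i * z j * z k)
      = (F ^ 4 * -(3 / 2 * Real.exp (2 * (p.1 0 * p.1 1)) / p.2 1 ^ 4)) / F ^ 3
        * (z i * z j * z k) := by
    field_simp
  rw [this, key]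
  field_simp

/-- The form of the model spray. -/
noncomputable def modelForm : TwoForm 2 (E 2) where
  -- From R = (4/3) y¹y² and τ_1 = 2y² one gets R_{.1} - 2τ_1 = (4/3 - 4) y².
  toFun _ := (-(8 / 3) : ℝ) • areaAlt
  smooth φ hφ u w := by
    rw [chartedSpaceSelf_atlas] at hφ
    subst hφ
    refine (contDiffOn_const (c := -(8 / 3) * (u 0 * w 1 - u 1 * w 0))).congr fun x _ => ?_
    rw [vec_refl, vec_refl]
    rfl

lemma modelForm_apply (x u v : E 2) :
    modelForm.toFun x ![u, v] = -(8 / 3) * (u 0 * v 1 - u 1 * v 0) := rfl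

lemma model_weakIsotropy : WeakIsotropy modelRegion modelR modelTau modelForm :=
  fun φ hφ p hp i => by
    rw [chartedSpaceSelf_atlas] at hφ
    subst hφ
    rw [coords_modelRegion] at hp
    rw [modelTau_lift, vec_refl, vec_refl]
    refine Eq.trans ?_ (modelForm_apply _ _ _).symm
    have hR : (fun q => modelR (lift (OpenPartialHomeomorph.refl (E 2)) q))
        = expMono 0 (4 / 3) 0 0 1 1 := by
      ext q
      rw [modelR, planeCoord_lift]
      simp [expMono]
      ring
    rw [hR]
    fin_cases i
    · simp [dy_zero_expMono _ _ _ _ _ _ hp, expMono, e_apply]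
      ring
    · simp [dy_one_expMono _ _ _ _ _ _ hp, expMono, e_apply]
      ring

lemma modelForm_not_isZero : ¬ modelForm.IsZero := fun h => by
  have h1 := modelForm_apply 0 (e 0) (e 1)
  rw [h 0] at h1
  have h2 : (0 : ℝ)
      = -(8 / 3) * ((e 0 : E 2) 0 * (e 1 : E 2) 1 - (e 0 : E 2) 1 * (e 1 : E 2) 0) := h1
  simp [e_apply] at h2

end Model

end SprayGeometry

theorem theorem1p4 :
    -- (ia)
    (∀ (n : ℕ) (_ : 3 ≤ n) (M : Type*) [TopologicalSpace M] [ConnectedSpace M]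
        [ChartedSpace (E n) M] [IsManifold (𝓡 n) ∞ M]
        (C : ConicalRegion n M) (G : Spray C) (R : TangentBundle (𝓡 n) M → ℝ)
        (τ : SprayCovector n M) (Ω : TwoForm n M) (L : FinslerMetric C),
        G.IsOfScalarCurvature R τ → G.IsInducedBy L → WeakIsotropy C R τ Ω →
          (∃ c : ℝ, L.HasFlagCurvature (fun _ => c)) ∧ Ω.IsZero) ∧
    -- (ib)
    (∀ (M : Type*) [TopologicalSpace M]
        [ChartedSpace (E 2) M] [IsManifold (𝓡 2) ∞ M]
        (C : ConicalRegion 2 M) (G : Spray C) (R : TangentBundle (𝓡 2) M → ℝ)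
        (τ : SprayCovector 2 M) (Ω : TwoForm 2 M) (L : FinslerMetric C),
        G.IsOfScalarCurvature R τ → G.IsInducedBy L → WeakIsotropy C R τ Ω →
          (∃ lam : TangentBundle (𝓡 2) M → ℝ, L.HasFlagCurvature lam) ∧
          (L.IsPositive → ∀ lam : TangentBundle (𝓡 2) M → ℝ, L.HasFlagCurvature lam →
            ∀ φ ∈ atlas (E 2) M, ∀ p ∈ C.coords φ,
              (∃ (U : Set (E 2)) (θ : E 2 → ℝ) (l I : ℝ → ℝ), p.2 ∈ U ∧
                (∀ y ∈ U, (p.1, y) ∈ C.coords φ) ∧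
                InLandsbergAngle (L.loc φ) (fun q => lam (lift φ q)) p.1 U θ l I) ∧
              (∀ (U : Set (E 2)) (θ : E 2 → ℝ) (l I : ℝ → ℝ), p.2 ∈ U →
                (∀ y ∈ U, (p.1, y) ∈ C.coords φ) →
                InLandsbergAngle (L.loc φ) (fun q => lam (lift φ q)) p.1 U θ l I →
                  deriv (deriv l) (θ p.2)
                    + epsSign (L.loc φ) p * I (θ p.2) * deriv l (θ p.2) = 0)) ∧
          (L.IsRiemannian ∨ L.IsRegular →
            (∃ k : M → ℝ, L.HasFlagCurvature (fun v => k v.1)) ∧ Ω.IsZero)) ∧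
    -- (ii)
    (∀ (M : Type*) [TopologicalSpace M]
        [ChartedSpace (E 2) M] [IsManifold (𝓡 2) ∞ M]
        (C : ConicalRegion 2 M) (G : Spray C) (R : TangentBundle (𝓡 2) M → ℝ)
        (τ : SprayCovector 2 M) (L : FinslerMetric C),
        G.IsOfScalarCurvature R τ → G.IsInducedBy L → L.IsPositive →
        L.HasConstantMainScalar → ∃ Ω : TwoForm 2 M, WeakIsotropy C R τ Ω) ∧
    -- (ii), the form need not vanish
    (∃ (C : ConicalRegion 2 (E 2)) (G : Spray C) (R : TangentBundle (𝓡 2) (E 2) → ℝ)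
        (τ : SprayCovector 2 (E 2)) (L : FinslerMetric C) (Ω : TwoForm 2 (E 2)),
        G.IsOfScalarCurvature R τ ∧ G.IsInducedBy L ∧ L.IsPositive ∧
        L.HasConstantMainScalar ∧ WeakIsotropy C R τ Ω ∧ ¬ Ω.IsZero) := by
  refine ⟨fun n hn M _ _ _ _ C G R τ Ω L hs h hw =>
      ⟨exists_constant_flagCurvature hs h hn hw, isZero_of_three_le hs h hn hw⟩,
    fun M _ _ _ C G R τ Ω L hs h hw => ?_,
    fun M _ _ _ C G R τ L hs h hpos hc => exists_twoForm hs h hpos hc,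
    modelRegion, modelSpray, modelR, modelTau, modelMetric, modelForm,
    modelSpray_isOfScalarCurvature, modelSpray_isInducedBy, modelMetric_isPositive,
    modelMetric_hasConstantMainScalar, model_weakIsotropy, modelForm_not_isZero⟩
  obtain ⟨lam, hl⟩ := exists_isFlag hs h le_rfl
  refine ⟨⟨lam, hl.hasFlagCurvature hs h⟩, fun hpos K hK φ hφ p hp => ?_, fun hL => ?_⟩
  · have hm := h.isLocalMetric hφ
    have hpos' : ∀ q ∈ C.opens hφ, 0 < L.loc φ q := fun q hq => hpos _ hq.2
    have hKl : ∀ q ∈ C.opens hφ, K (lift φ q) = lam (lift φ q) := fun q hq =>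
      hl.eq_of_hasFlagCurvature hs h le_rfl hK hφ hq
    refine ⟨?_, fun V θ l I hpV hV hA => ?_⟩
    · exact hm.exists_inLandsbergAngle hpos' (hl φ hφ).smooth
        (hm.euler_flag hpos' (hs.isLocalScalar h hφ) (hl φ hφ)) hKl (x := p.1) (v := p.2) hp
    · exact (hw.isLocalForm hφ).landsberg_ode hm hpos' (hl φ hφ) hKl hV hA hpV
  · have hΩ : Ω.IsZero := hL.elim (isZero_of_isRiemannian hs h hw) (isZero_of_isRegular hs h hw)
    obtain ⟨k, hk⟩ := hl.exists_base h hw hΩ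
    exact ⟨⟨k, hl.hasFlagCurvature_base hs h hk⟩, hΩ⟩
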